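/- Let $A$ be a stable matching instance with $n$ boys and $n$ girls, each having a complete strict preference list over the other side, and let $\mathcal{L}_A$ be the lattice of stable matchings of $A$ (ordered by dominance: $M \preceq M'$ if every boy weakly prefers his partner in $M$ to his partner in $M'$). Let $T$ be the set of all $2n\,(n!)$ errors, an error being the replacement of the preference list of one boy or one girl by an arbitrary permutation of it. For $S \subseteq T$, a matching is \emph{fully robust} with respect to $S$ if it is stable for $A$ and for each instance obtained from $A$ by introducing one error from $S$. The rotation poset $\Pi$ of $A$ consists of the rotations of $A$, where $\rho' \prec \rho$ if $\rho'$ is eliminated in every sequence of rotation eliminations from the boy-optimal stable matching to a stable matching in which $\rho$ is exposed, together with a least element $s$ and a greatest element $t$. A \emph{compression} $\Pi'$ of $\Pi$ is a partition of the elements of $\Pi$ into nonempty meta-elements with a partial order on the meta-elements such that, for all $x \preceq y$ in $\Pi$, the meta-element of $x$ is below or equal to that of $y$. A \emph{proper closed set} of $\Pi'$ is a set of meta-elements that is closed under predecessors, contains the meta-element of $s$, and does not contain that of $t$; $\Pi'$ \emph{generates} a sublattice $\mathcal{L}'$ of $\mathcal{L}_A$ if sending a proper closed set to the matching obtained from the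 boy-optimal stable matching by eliminating all rotations contained in its meta-elements is an isomorphism from the lattice of proper closed sets (ordered by inclusion) onto $\mathcal{L}'$. \textbf{Theorem.} For every $n$, $A$ and $S \subseteq T$, the set of matchings that are fully robust with respect to $S$ is a sublattice of $\mathcal{L}_A$. Moreover, there are a single algorithm and a polynomial $p$ such that, for all $n$, all instances $A$ with $n$ boys and $n$ girls, and all $S \subseteq T$ (given as a list, of length $|S|$), the algorithm on input $(A,S)$ decides in time at most $\max(|S|,1)\, p(n)$ whether a fully robust matching with respect to $S$ exists and, if the answer is yes, also outputs within that time a compression of the rotation poset of $A$ that generates the sublattice of all fully robust matchings. -/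

import Mathlib

namespace FullyRobust

/-! ### Stable matching instances, perturbations, stability -/

/-- An instance on `n` boys and `n` girls, both indexed by `Fin n`. Every agent has a complete strict
preference list: `boyList b k` is the girl at position `k` of the list of `b` (position `0` is the
favourite), and similarly for `girlList`. -/
structure Inst (n : ℕ) where
  boyList : Fin n → Equiv.Perm (Fin n)
  girlList : Fin n → Equiv.Perm (Fin n)

variable {n : ℕ}

/-- Position of girl `g` in the list of boy `b`; smaller is better. -/
def Inst.boyRank (A : Inst n) (b g : Fin n) : Fin n := (A.boyList b).symm g

/-- Position of boy `b` in the list of girl `g`; smaller is better. -/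
def Inst.girlRank (A : Inst n) (g b : Fin n) : Fin n := (A.girlList g).symm b

/-- An element of the domain `T` of errors: one agent, and the list that replaces its list. -/
inductive Perturbation (n : ℕ) where
  | boy (b : Fin n) (l : Equiv.Perm (Fin n))
  | girl (g : Fin n) (l : Equiv.Perm (Fin n))

/-- The instance that results from introducing one error. -/
def Inst.perturb (A : Inst n) : Perturbation n → Inst n
  | .boy b l => { A with boyList := Function.update A.boyList b l }
  | .girl g l => { A with girlList := Function.update A.girlList g l }

/-- A matching is a bijection `M` from boys to girls. The pair `b g` blocks `M` if `b` and `g`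
strictly prefer each other to their partners. -/
def IsBlocking (A : Inst n) (M : Equiv.Perm (Fin n)) (b g : Fin n) : Prop :=
  A.boyRank b g < A.boyRank b (M b) ∧ A.girlRank g b < A.girlRank g (M.symm g)

def IsStable (A : Inst n) (M : Equiv.Perm (Fin n)) : Prop :=
  ∀ b g, ¬ IsBlocking A M b g

/-- Stable for `A` and for each instance obtained by introducing one error from `S`. -/
def IsFullyRobust (A : Inst n) (S : List (Perturbation n)) (M : Equiv.Perm (Fin n)) : Prop :=
  IsStable A M ∧ ∀ e ∈ S, IsStable (A.perturb e) M

/-! ### The lattice of stable matchings -/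

def StableMatching (A : Inst n) : Type := {M : Equiv.Perm (Fin n) // IsStable A M}

theorem boyRank_inj (A : Inst n) {b g g' : Fin n} (h : A.boyRank b g = A.boyRank b g') :
    g = g' := (A.boyList b).symm.injective h

theorem girlRank_inj (A : Inst n) {g b b' : Fin n} (h : A.girlRank g b = A.girlRank g b') :
    b = b' := (A.girlList g).symm.injective h

/-- `M ≤ M'` means that `M` dominates `M'`: every boy weakly prefers his partner in `M`. -/
instance (A : Inst n) : PartialOrder (StableMatching A) where
  le M M' := ∀ b, A.boyRank b (M.1 b) ≤ A.boyRank b (M'.1 b)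
  le_refl _ _ := le_rfl
  le_trans _ _ _ h h' b := (h b).trans (h' b)
  le_antisymm _ _ h h' :=
    Subtype.ext (Equiv.ext fun b => boyRank_inj A (le_antisymm (h b) (h' b)))

/-- The girl that `b` prefers among his partners in `M` and `M'`. -/
def better (A : Inst n) (M M' : Equiv.Perm (Fin n)) (b : Fin n) : Fin n :=
  if A.boyRank b (M b) ≤ A.boyRank b (M' b) then M b else M' b

/-- The girl that `b` likes less among his partners in `M` and `M'`. -/
def worse (A : Inst n) (M M' : Equiv.Perm (Fin n)) (b : Fin n) : Fin n :=
  if A.boyRank b (M b) ≤ A.boyRank b (M' b) then M' b else M b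

theorem cross_false {A : Inst n} {M M' : Equiv.Perm (Fin n)} (hM : IsStable A M)
    (hM' : IsStable A M') {b b' g : Fin n} (hb : M b = g) (hb' : M' b' = g) (hne : b ≠ b')
    (h1 : A.boyRank b (M b) ≤ A.boyRank b (M' b))
    (h2 : A.boyRank b' (M' b') ≤ A.boyRank b' (M b')) : False := by
  have e1 : M.symm g = b := by rw [← hb]; simp
  have e2 : M'.symm g = b' := by rw [← hb']; simp
  have k1 : A.boyRank b g < A.boyRank b (M' b) := by
    rw [← hb]
    refine lt_of_le_of_ne h1 fun h => hne ?_
    exact M'.injective (by rw [hb', ← boyRank_inj A h, hb])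
  have k2 : A.boyRank b' g < A.boyRank b' (M b') := by
    rw [← hb']
    refine lt_of_le_of_ne h2 fun h => hne ?_
    exact M.injective (by rw [hb, ← boyRank_inj A h, hb'])
  rcases lt_trichotomy (A.girlRank g b) (A.girlRank g b') with h | h | h
  · exact hM' b g ⟨k1, by rwa [e2]⟩
  · exact hne (girlRank_inj A h)
  · exact hM b' g ⟨k2, by rwa [e1]⟩

theorem better_injective {A : Inst n} {M M' : Equiv.Perm (Fin n)} (hM : IsStable A M)
    (hM' : IsStable A M') : Function.Injective (better A M M') := by
  intro b b' h
  by_contra hne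
  unfold better at h
  split_ifs at h with h1 h2 h2
  · exact hne (M.injective h)
  · exact cross_false hM hM' rfl h.symm hne h1 (not_le.1 h2).le
  · exact cross_false hM hM' rfl h (Ne.symm hne) h2 (not_le.1 h1).le
  · exact hne (M'.injective h)

theorem worse_injective {A : Inst n} {M M' : Equiv.Perm (Fin n)} (hM : IsStable A M)
    (hM' : IsStable A M') : Function.Injective (worse A M M') := by
  have key : ∀ b b', M b = M' b' → b ≠ b' → A.boyRank b (M' b) ≤ A.boyRank b (M b) →
      A.boyRank b' (M b') ≤ A.boyRank b' (M' b') → False := by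
    intro b b' h hne h1 h2
    obtain ⟨c, hc⟩ := (Finite.injective_iff_surjective.1 (better_injective hM hM')) (M b)
    unfold better at hc
    split_ifs at hc with h3
    · obtain rfl := M.injective hc
      exact hne (M'.injective ((boyRank_inj A (le_antisymm h1 h3)).trans h))
    · obtain rfl := M'.injective (hc.trans h)
      exact h3 h2
  intro b b' h
  by_contra hne
  unfold worse at h
  split_ifs at h with h1 h2 h2
  · exact hne (M'.injective h)
  · exact key b' b h.symm (Ne.symm hne) (not_le.1 h2).le h1
  · exact key b b' h hne (not_le.1 h1).le h2
  · exact hne (M.injective h)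

noncomputable def meetPerm {A : Inst n} (M M' : StableMatching A) : Equiv.Perm (Fin n) :=
  Equiv.ofBijective _ (Finite.injective_iff_bijective.1 (better_injective M.2 M'.2))

noncomputable def joinPerm {A : Inst n} (M M' : StableMatching A) : Equiv.Perm (Fin n) :=
  Equiv.ofBijective _ (Finite.injective_iff_bijective.1 (worse_injective M.2 M'.2))

theorem meetPerm_apply {A : Inst n} (M M' : StableMatching A) (b : Fin n) :
    meetPerm M M' b = better A M.1 M'.1 b := rfl

theorem joinPerm_apply {A : Inst n} (M M' : StableMatching A) (b : Fin n) :
    joinPerm M M' b = worse A M.1 M'.1 b := rfl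

theorem meet_stable {A : Inst n} (M M' : StableMatching A) : IsStable A (meetPerm M M') := by
  rintro b g ⟨h1, h2⟩
  obtain ⟨c, rfl⟩ := (meetPerm M M').surjective g
  rw [Equiv.symm_apply_apply] at h2
  have hb : A.boyRank b (meetPerm M M' c) < A.boyRank b (M.1 b) ∧
      A.boyRank b (meetPerm M M' c) < A.boyRank b (M'.1 b) := by
    rw [meetPerm_apply M M' b] at h1
    unfold better at h1
    split_ifs at h1 with h
    · exact ⟨h1, h1.trans_le h⟩
    · exact ⟨h1.trans (not_le.1 h), h1⟩
  rw [meetPerm_apply] at hb h2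
  unfold better at hb h2
  split_ifs at hb h2 with h
  · exact M.2 b _ ⟨hb.1, by simpa using h2⟩
  · exact M'.2 b _ ⟨hb.2, by simpa using h2⟩

theorem join_stable_aux {A : Inst n} {M M' : Equiv.Perm (Fin n)} (hM : IsStable A M)
    (hM' : IsStable A M') {b c g : Fin n} (hb : A.boyRank b g < A.boyRank b (M b))
    (hc : M' c = g) (hcg : A.boyRank c (M c) ≤ A.boyRank c (M' c))
    (hg : A.girlRank g b < A.girlRank g c) : False := by
  have e' : M'.symm g = c := by rw [← hc]; simp
  obtain ⟨d, rfl⟩ := M.surjective g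
  have h1 : A.girlRank (M d) d ≤ A.girlRank (M d) b := by
    by_contra h
    exact hM b _ ⟨hb, by simpa using h⟩
  have hdc : d ≠ c := by
    rintro rfl
    exact absurd hg (not_lt.2 h1)
  have h2 : A.boyRank d (M' d) ≤ A.boyRank d (M d) := by
    by_contra h
    exact hM' d _ ⟨not_le.1 h, by rw [e']; exact h1.trans_lt hg⟩
  obtain ⟨a, ha⟩ := (Finite.injective_iff_surjective.1 (better_injective hM hM')) (M d)
  unfold better at ha
  split_ifs at ha with h3
  · obtain rfl := M.injective ha
    exact hdc (M'.injective ((boyRank_inj A (le_antisymm h2 h3)).trans hc.symm))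
  · obtain rfl := M'.injective (ha.trans hc.symm)
    exact h3 hcg

theorem join_stable {A : Inst n} (M M' : StableMatching A) : IsStable A (joinPerm M M') := by
  rintro b g ⟨h1, h2⟩
  obtain ⟨c, hc⟩ := (joinPerm M M').surjective g
  rw [← hc, Equiv.symm_apply_apply, hc] at h2
  rw [joinPerm_apply] at h1 hc
  unfold worse at h1 hc
  split_ifs at h1 hc with h h' h'
  · exact M'.2 b g ⟨h1, by rw [← hc] at h2 ⊢; simpa using h2⟩
  · exact join_stable_aux M'.2 M.2 h1 hc (not_le.1 h').le h2
  · exact join_stable_aux M.2 M'.2 h1 hc h' h2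
  · exact M.2 b g ⟨h1, by rw [← hc] at h2 ⊢; simpa using h2⟩

/-- The lattice of stable matchings of `A`. In the meet every boy gets his more preferred partner,
in the join his less preferred partner; the boy-optimal matching is the bottom. -/
noncomputable instance (A : Inst n) : Lattice (StableMatching A) where
  inf M M' := ⟨meetPerm M M', meet_stable M M'⟩
  sup M M' := ⟨joinPerm M M', join_stable M M'⟩
  inf_le_left M M' b := by
    change A.boyRank b (better A M.1 M'.1 b) ≤ _
    unfold better
    split_ifs with h
    · exact le_rfl
    · exact (not_le.1 h).le
  inf_le_right M M' b := by
    change A.boyRank b (better A M.1 M'.1 b) ≤ _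
    unfold better
    split_ifs with h
    · exact h
    · exact le_rfl
  le_inf N M M' h h' b := by
    change _ ≤ A.boyRank b (better A M.1 M'.1 b)
    unfold better
    split_ifs
    · exact h b
    · exact h' b
  le_sup_left M M' b := by
    change _ ≤ A.boyRank b (worse A M.1 M'.1 b)
    unfold worse
    split_ifs with h
    · exact h
    · exact le_rfl
  le_sup_right M M' b := by
    change _ ≤ A.boyRank b (worse A M.1 M'.1 b)
    unfold worse
    split_ifs with h
    · exact le_rfl
    · exact (not_le.1 h).le
  sup_le M M' N h h' b := by
    change A.boyRank b (worse A M.1 M'.1 b) ≤ _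
    unfold worse
    split_ifs
    · exact h' b
    · exact h b

/-- The set of fully robust stable matchings, as a subset of the lattice of stable matchings. -/
def fullyRobustSet (A : Inst n) (S : List (Perturbation n)) : Set (StableMatching A) :=
  {M | IsFullyRobust A S M.1}

/-! ### Rotations and the rotation poset -/

/-- `g` is the first girl on the list of `b` who strictly prefers `b` to her partner in `M`
(the girl `s_M(b)`). -/
def IsFirstWilling (A : Inst n) (M : Equiv.Perm (Fin n)) (b g : Fin n) : Prop :=
  A.girlRank g b < A.girlRank g (M.symm g) ∧
    ∀ g', A.girlRank g' b < A.girlRank g' (M.symm g') → A.boyRank b g ≤ A.boyRank b g'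

/-- `b'` is the partner in `M` of `s_M(b)`. -/
def IsNext (A : Inst n) (M : Equiv.Perm (Fin n)) (b b' : Fin n) : Prop :=
  IsFirstWilling A M b (M b')

/-- The cyclic sequence `ρ` of (boy, girl) pairs is a rotation exposed in `M`: it is a nonempty
cyclic sequence of distinct pairs of `M`, and the boy of each pair is the next boy of the boy of
the preceding pair, cyclically. -/
def IsExposed (A : Inst n) (M : Equiv.Perm (Fin n)) (ρ : Cycle (Fin n × Fin n)) : Prop :=
  ρ ≠ Cycle.nil ∧ ρ.Nodup ∧ (∀ p ∈ ρ, M p.1 = p.2) ∧ ρ.Chain fun p q => IsNext A M p.1 q.1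

/-- The rotations of `A`: cyclic sequences of pairs that are exposed in some stable matching. -/
def Rotation (A : Inst n) : Type :=
  {ρ : Cycle (Fin n × Fin n) // ∃ M : StableMatching A, IsExposed A M.1 ρ}

/-- `M' = M / ρ`: the rotation `ρ` is exposed in `M`, each boy `b` of `ρ` is matched to `s_M(b)` in
`M'`, and every other boy keeps his partner. -/
def IsElimination {A : Inst n} (M : StableMatching A) (ρ : Rotation A) (M' : StableMatching A) :
    Prop :=
  IsExposed A M.1 ρ.1 ∧ (∀ p ∈ ρ.1, IsFirstWilling A M.1 p.1 (M'.1 p.1)) ∧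
    ∀ b, (∀ p ∈ ρ.1, p.1 ≠ b) → M'.1 b = M.1 b

/-- `ElimSeq M l M'`: eliminating the rotations of the list `l` one after the other leads from `M`
to `M'`. -/
inductive ElimSeq {A : Inst n} : StableMatching A → List (Rotation A) → StableMatching A → Prop
  | nil (M : StableMatching A) : ElimSeq M [] M
  | cons {M M₁ M' : StableMatching A} {ρ : Rotation A} {l : List (Rotation A)} :
      IsElimination M ρ M₁ → ElimSeq M₁ l M' → ElimSeq M (ρ :: l) M'

/-- `ρ'` precedes `ρ`: it is eliminated in every sequence of eliminations from the boy-optimal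
stable matching to a stable matching in which `ρ` is exposed. -/
def Precedes {A : Inst n} (ρ' ρ : Rotation A) : Prop :=
  ∀ (M₀ M : StableMatching A) (l : List (Rotation A)),
    IsBot M₀ → ElimSeq M₀ l M → IsExposed A M.1 ρ.1 → ρ' ∈ l

/-- Elements of the rotation poset `Π`: the rotations and the two dummy elements `s` and `t`. -/
inductive RotElem (A : Inst n) where
  | s
  | t
  | rot (ρ : Rotation A)

/-- The order of `Π`: precedence or equality of rotations; `s` is below and `t` is above
everything. -/
def RotElem.le {A : Inst n} : RotElem A → RotElem A → Prop
  | .s, _ => True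
  | _, .t => True
  | .rot ρ', .rot ρ => ρ' = ρ ∨ Precedes ρ' ρ
  | _, _ => False

/-- `R` generates `M`: eliminating exactly the rotations of the set `R`, each once, in a suitable
order, leads from the boy-optimal stable matching to `M`. -/
def GeneratesMatching {A : Inst n} (R : Set (Rotation A)) (M : StableMatching A) : Prop :=
  ∃ (M₀ : StableMatching A) (l : List (Rotation A)),
    IsBot M₀ ∧ l.Nodup ∧ (∀ ρ, ρ ∈ l ↔ ρ ∈ R) ∧ ElimSeq M₀ l M

/-! ### Compressions -/

/-- A compression of the rotation poset `Π`: a partition of the elements of `Π` into `m` nonempty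
meta-elements, numbered by `Fin m`, where `cls x` is the meta-element that contains `x`, and a
partial order on the meta-elements that contains the projection of the order of `Π`. -/
structure Compression (A : Inst n) where
  m : ℕ
  cls : RotElem A → Fin m
  cls_surjective : Function.Surjective cls
  le : Fin m → Fin m → Prop
  le_refl : ∀ i, le i i
  le_trans : ∀ i j k, le i j → le j k → le i k
  le_antisymm : ∀ i j, le i j → le j i → i = j
  le_of_le : ∀ x y : RotElem A, x.le y → le (cls x) (cls y)

/-- The lattice `L(Π')` of proper closed sets of a compression `Π'`, ordered by inclusion: sets of
meta-elements closed under predecessors that contain the meta-element of `s` but not that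
of `t`. -/
abbrev Compression.ProperClosed {A : Inst n} (C : Compression A) : Type :=
  {I : Set (Fin C.m) // (∀ i j, C.le i j → j ∈ I → i ∈ I) ∧ C.cls .s ∈ I ∧ C.cls .t ∉ I}

/-- The rotations contained in the meta-elements of `I`. -/
def Compression.rot {A : Inst n} (C : Compression A) (I : Set (Fin C.m)) : Set (Rotation A) :=
  {ρ | C.cls (.rot ρ) ∈ I}

/-- The compression `Π'` generates the set `X` of stable matchings: sending a proper closed set of
`Π'` to the matching obtained by eliminating its rotations is an isomorphism of `L(Π')` onto `X`. -/
def Compression.Generates {A : Inst n} (C : Compression A) (X : Set (StableMatching A)) : Prop :=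
  ∃ φ : C.ProperClosed ≃o X, ∀ I : C.ProperClosed, GeneratesMatching (C.rot I.1) (φ I).1

/-! ### The model of computation

A small imperative language whose variables hold binary trees (pointers to immutable cells). Each
operation is a constant number of pointer operations and costs one step; in particular there is no
unit-cost arithmetic and no unit-cost comparison of trees. -/

inductive Data where
  | nil
  | node (l r : Data)

def Data.hd : Data → Data
  | .nil => .nil
  | .node l _ => l

def Data.tl : Data → Data
  | .nil => .nil
  | .node _ r => r

abbrev Store := ℕ → Data

inductive Expr where
  | var (i : ℕ)
  | nil
  | cons (e₁ e₂ : Expr)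
  | hd (e : Expr)
  | tl (e : Expr)

def Expr.eval (σ : Store) : Expr → Data
  | .var i => σ i
  | .nil => .nil
  | .cons e₁ e₂ => .node (e₁.eval σ) (e₂.eval σ)
  | .hd e => (e.eval σ).hd
  | .tl e => (e.eval σ).tl

/-- The number of operations performed in the evaluation of an expression. -/
def Expr.cost : Expr → ℕ
  | .var _ => 1
  | .nil => 1
  | .cons e₁ e₂ => e₁.cost + e₂.cost + 1
  | .hd e => e.cost + 1
  | .tl e => e.cost + 1

/-- Programs: assignment, sequence, branching and looping on whether a value is different from
`nil`. -/
inductive Prog where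
  | assign (x : ℕ) (e : Expr)
  | seq (c₁ c₂ : Prog)
  | cond (e : Expr) (c₁ c₂ : Prog)
  | loop (e : Expr) (c : Prog)

/-- `Exec c σ σ' k`: started in the store `σ`, the program `c` halts after exactly `k` steps in the
store `σ'`. -/
inductive Exec : Prog → Store → Store → ℕ → Prop
  | assign (x : ℕ) (e : Expr) (σ : Store) :
      Exec (.assign x e) σ (Function.update σ x (e.eval σ)) (e.cost + 1)
  | seq {c₁ c₂ : Prog} {σ σ₁ σ₂ : Store} {k₁ k₂ : ℕ} :
      Exec c₁ σ σ₁ k₁ → Exec c₂ σ₁ σ₂ k₂ → Exec (.seq c₁ c₂) σ σ₂ (k₁ + k₂)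
  | cond_true {e : Expr} {c₁ c₂ : Prog} {σ σ' : Store} {k : ℕ} :
      e.eval σ ≠ .nil → Exec c₁ σ σ' k → Exec (.cond e c₁ c₂) σ σ' (e.cost + 1 + k)
  | cond_false {e : Expr} {c₁ c₂ : Prog} {σ σ' : Store} {k : ℕ} :
      e.eval σ = .nil → Exec c₂ σ σ' k → Exec (.cond e c₁ c₂) σ σ' (e.cost + 1 + k)
  | loop_false {e : Expr} {c : Prog} {σ : Store} :
      e.eval σ = .nil → Exec (.loop e c) σ σ (e.cost + 1)
  | loop_true {e : Expr} {c : Prog} {σ σ₁ σ₂ : Store} {k₁ k₂ : ℕ} :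
      e.eval σ ≠ .nil → Exec c σ σ₁ k₁ → Exec (.loop e c) σ₁ σ₂ k₂ →
        Exec (.loop e c) σ σ₂ (e.cost + 1 + k₁ + k₂)

/-- On input `x` (in variable `0`, all other variables being `nil`) the program halts after exactly
`k` steps with output `y` (in variable `0`). -/
def Prog.Computes (c : Prog) (x y : Data) (k : ℕ) : Prop :=
  ∃ σ : Store, Exec c (Function.update (fun _ => Data.nil) 0 x) σ k ∧ σ 0 = y

/-! ### Encodings of the input and of the output -/

/-- Numbers in unary. -/
def encNat : ℕ → Data
  | 0 => .nil
  | k + 1 => .node .nil (encNat k)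

def encBool : Bool → Data
  | false => .nil
  | true => .node .nil .nil

def encList {α : Type} (f : α → Data) : List α → Data
  | [] => .nil
  | a :: l => .node (f a) (encList f l)

/-- A preference list, from the favourite to the least preferred agent. -/
def encPref (l : Equiv.Perm (Fin n)) : Data :=
  encList (fun k => encNat (l k).val) (List.finRange n)

def encInst (A : Inst n) : Data :=
  .node (encList (fun b => encPref (A.boyList b)) (List.finRange n))
    (encList (fun g => encPref (A.girlList g)) (List.finRange n))

def encPerturbation : Perturbation n → Data
  | .boy b l => .node (encBool false) (.node (encNat b.val) (encPref l))
  | .girl g l => .node (encBool true) (.node (encNat g.val) (encPref l))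

/-- The input: the instance `A`, and the errors in `S` as a list. -/
def encInput (A : Inst n) (S : List (Perturbation n)) : Data :=
  .node (encInst A) (encList encPerturbation S)

/-- An explicit description of a compression: the list of all rotations, each written as a list of
pairs together with the number of its meta-element; the numbers of the meta-elements of `s`
and `t`; the matrix of the order on the meta-elements. -/
structure PosetData (n : ℕ) where
  rots : List (List (Fin n × Fin n) × ℕ)
  s : ℕ
  t : ℕ
  le : List (List Bool)

def encPosetData (P : PosetData n) : Data :=
  .node
    (encList (fun r => .node (encList (fun p => .node (encNat p.1.val) (encNat p.2.val)) r.1)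
      (encNat r.2)) P.rots)
    (.node (encNat P.s) (.node (encNat P.t) (encList (encList encBool) P.le)))

/-- The output: `none` stands for the answer no, `some P` for the answer yes together with `P`. -/
def encOutput : Option (PosetData n) → Data
  | none => .nil
  | some P => .node .nil (encPosetData P)

open Classical in
/-- `P` is an explicit description of the compression `C`; each rotation is listed exactly once,
starting from an arbitrary one of its pairs. -/
def PosetData.Describes {A : Inst n} (P : PosetData n) (C : Compression A) : Prop :=
  (∃ rots : List (Rotation A), rots.Nodup ∧ (∀ ρ, ρ ∈ rots) ∧
    List.Forall₂ (fun r ρ => (r.1 : Cycle (Fin n × Fin n)) = ρ.1 ∧ r.2 = (C.cls (.rot ρ)).val)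
      P.rots rots) ∧
  P.s = (C.cls .s).val ∧ P.t = (C.cls .t).val ∧
  P.le = List.ofFn fun i => List.ofFn fun j => decide (C.le i j)

end FullyRobust

/-! Stable matchings are encoded by the sets `rotSet` of eliminated rotations. This embeds the order
(`rotSet_subset_iff`) and turns joins and meets into unions and intersections. In such a ring of
sets a sublattice `X` is recovered from the implications between elements that hold in all its
members: every set closed under them that contains `s` and omits `t` is the closed set of a member
(`exists_of_closed`). Hence the classes of mutually implying elements, ordered by reversed
implication, generate `X` (`Compression.generates_ofImplies`). Fully robust matchings form a
sublattice because an error changes the list of one agent only, and a bijection is determined by its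
values off one point. It remains to compute the implications.

Errors of girls can be merged: a matching survives all of them iff no boy strictly prefers to his
partner a girl who, in one of her lists, prefers him to hers (`robust_girl_iff`). Merged preferences
are total but need be neither antisymmetric nor transitive; the boys' lists remain linear orders,
which suffices for a deferred-acceptance argument. From the demand that `b` be strictly below `g`,
`forced` successively excludes girls for boys. Either some boy loses all girls and no such matching
is robust, or the best remaining girls form the least one (`exists_robust`). So all implications
valid under errors of girls are decided (`impl_iff`). For errors of boys the sides are exchanged;
the girls see the negations of the elements (`Rep.dual_iff`), and implications are obtained by
contraposition.

With errors on both sides, the fully robust matchings are the intersection of two sublattices, and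
their implications are the transitive closure of the two families (`reach_iff`): a set closed under
both families is the closed set of a member of either sublattice, and the two members coincide since
`rotSet` is injective. No fully robust matching exists iff `s` implies `t`.

The rotations are read off the exclusions for `A` itself. A pair lies on a rotation iff it occurs in
a stable matching and its boy is strictly below it in another (`isRotPair_iff`); two such pairs
share a rotation iff each forces the other (`sameRot_iff`).

For the running time, combinators for programs show that each ingredient takes time polynomial in
`n`. The list `S` serves only to fill a Boolean table of size polynomial in `n`, at polynomial cost
per error, whence the factor `|S|` (`cmp_answer`). -/

namespace FullyRobust

/-! ### Computing functions of an environment -/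

/-- Some program that finds `env i` in variable `0` replaces it by `f i` in at most `T i` steps. It
leaves all but finitely many variables alone, and makes no assumption on their values. -/
def Cmp {ι : Type} (env f : ι → Data) (T : ι → ℕ) : Prop :=
  ∃ (c : Prog) (k : ℕ), 1 ≤ k ∧ ∀ i (σ : Store), σ 0 = env i →
    ∃ σ' t, Exec c σ σ' t ∧ σ' 0 = f i ∧ (∀ j, k ≤ j → σ' j = σ j) ∧ t ≤ T i

namespace Cmp

variable {ι : Type} {env f g b : ι → Data} {T T₁ T₂ T₃ : ι → ℕ}

theorem mono (h : Cmp env f T₁) (hT : ∀ i, T₁ i ≤ T₂ i) : Cmp env f T₂ := by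
  obtain ⟨c, k, hk, H⟩ := h
  refine ⟨c, k, hk, fun i σ hσ => ?_⟩
  obtain ⟨σ', t, h1, h2, h3, h4⟩ := H i σ hσ
  exact ⟨σ', t, h1, h2, h3, h4.trans (hT i)⟩

theorem congr (h : Cmp env f T) (hg : ∀ i, g i = f i) : Cmp env g T := by
  rwa [show g = f from funext hg]

theorem congrEnv {env' : ι → Data} (h : Cmp env f T) (he : ∀ i, env' i = env i) :
    Cmp env' f T := by
  rwa [show env' = env from funext he]

theorem expr (e : Expr) (he : ∀ i (σ : Store), σ 0 = env i → e.eval σ = f i) :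
    Cmp env f fun _ => e.cost + 1 := by
  refine ⟨.assign 0 e, 1, le_rfl, fun i σ hσ => ⟨_, _, Exec.assign 0 e σ, ?_, ?_, le_rfl⟩⟩
  · simp [he i σ hσ]
  · intro j hj
    exact Function.update_of_ne (by omega) _ _

theorem comp (h₁ : Cmp env f T₁) (h₂ : Cmp f g T₂) : Cmp env g fun i => T₁ i + T₂ i := by
  obtain ⟨c₁, k₁, hk₁, H₁⟩ := h₁
  obtain ⟨c₂, k₂, hk₂, H₂⟩ := h₂
  refine ⟨.seq c₁ c₂, max k₁ k₂, by omega, fun i σ hσ => ?_⟩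
  obtain ⟨σ₁, t₁, e₁, v₁, f₁, b₁⟩ := H₁ i σ hσ
  obtain ⟨σ₂, t₂, e₂, v₂, f₂, b₂⟩ := H₂ i σ₁ v₁
  refine ⟨σ₂, _, Exec.seq e₁ e₂, v₂, fun j hj => ?_, Nat.add_le_add b₁ b₂⟩
  rw [f₂ j (by omega), f₁ j (by omega)]

/-- Substitution in the environment along a map of index types. -/
theorem reindex {κ : Type} (h : Cmp env f T) (π : κ → ι) :
    Cmp (fun j => env (π j)) (fun j => f (π j)) fun j => T (π j) := by
  obtain ⟨c, k, hk, H⟩ := h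
  exact ⟨c, k, hk, fun j σ hσ => H (π j) σ hσ⟩

/-- The environment is saved in variable `K`, which neither program touches, so that the second can
start from it again; the first result waits in `K + 1`. -/
theorem node (h₁ : Cmp env f T₁) (h₂ : Cmp env g T₂) :
    Cmp env (fun i => Data.node (f i) (g i)) fun i => T₁ i + T₂ i + 10 := by
  obtain ⟨c₁, k₁, hk₁, H₁⟩ := h₁
  obtain ⟨c₂, k₂, hk₂, H₂⟩ := h₂
  set K := max k₁ k₂ with hK
  refine ⟨.seq (.assign K (.var 0)) (.seq c₁ (.seq (.assign (K + 1) (.var 0))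
    (.seq (.assign 0 (.var K)) (.seq c₂ (.assign 0 (.cons (.var (K + 1)) (.var 0))))))), K + 2,
    by omega, fun i σ hσ => ?_⟩
  obtain ⟨σ₁, t₁, e₁, v₁, f₁, b₁⟩ := H₁ i (Function.update σ K (σ 0))
    (by rw [Function.update_of_ne (by omega), hσ])
  have hK1 : σ₁ K = env i := by rw [f₁ K (by omega)]; simp [hσ]
  obtain ⟨σ₂, t₂, e₂, v₂, f₂, b₂⟩ := H₂ i
    (Function.update (Function.update σ₁ (K + 1) (σ₁ 0)) 0 (σ₁ K)) (by simp [hK1])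
  have hK2 : σ₂ (K + 1) = f i := by
    rw [f₂ _ (by omega), Function.update_of_ne (by omega)]; simp [v₁]
  have hx := Exec.seq (Exec.assign K (.var 0) σ) (Exec.seq e₁
    (Exec.seq (Exec.assign (K + 1) (.var 0) σ₁)
    (Exec.seq (Exec.assign 0 (.var K) (Function.update σ₁ (K + 1) (σ₁ 0)))
    (Exec.seq (by simpa [Expr.eval] using e₂)
      (Exec.assign 0 (.cons (.var (K + 1)) (.var 0)) σ₂)))))
  refine ⟨_, _, hx, by simp [Expr.eval, hK2, v₂], fun j hj => ?_, by simp [Expr.cost]; omega⟩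
  rw [Function.update_of_ne (by omega), f₂ j (by omega), Function.update_of_ne (by omega),
    Function.update_of_ne (by omega), f₁ j (by omega), Function.update_of_ne (by omega)]

/-- The first branch has to be correct only where the test succeeds; this lets it decode the content
of an option. -/
theorem ite (h₁ : Cmp env b T₁)
    (h₂ : Cmp (ι := {i // b i ≠ .nil}) (fun i => env i) (fun i => f i) fun i => T₂ i)
    (h₃ : Cmp env g T₃) [∀ i, Decidable (b i ≠ .nil)] :
    Cmp env (fun i => if b i ≠ .nil then f i else g i) fun i => T₁ i + T₂ i + T₃ i + 10 := by
  obtain ⟨c₁, k₁, hk₁, H₁⟩ := h₁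
  obtain ⟨c₂, k₂, hk₂, H₂⟩ := h₂
  obtain ⟨c₃, k₃, hk₃, H₃⟩ := h₃
  set K := max k₁ (max k₂ k₃) with hK
  refine ⟨.seq (.assign K (.var 0)) (.seq c₁ (.cond (.var 0) (.seq (.assign 0 (.var K)) c₂)
    (.seq (.assign 0 (.var K)) c₃))), K + 2, by omega, fun i σ hσ => ?_⟩
  obtain ⟨σ₁, t₁, e₁, v₁, f₁, b₁⟩ := H₁ i (Function.update σ K (σ 0))
    (by rw [Function.update_of_ne (by omega), hσ])
  have hK1 : σ₁ K = env i := by rw [f₁ K (by omega)]; simp [hσ]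
  by_cases hb : b i = .nil
  · obtain ⟨σ₂, t₂, e₂, v₂, f₂, b₂⟩ := H₃ i (Function.update σ₁ 0 (σ₁ K)) (by simp [hK1])
    refine ⟨σ₂, _, Exec.seq (Exec.assign K (.var 0) σ) (Exec.seq e₁
      (Exec.cond_false (by simp [Expr.eval, v₁, hb]) (Exec.seq (Exec.assign 0 (.var K) σ₁) e₂))),
      by simp [v₂, hb], fun j hj => ?_, by simp [Expr.cost]; omega⟩
    rw [f₂ j (by omega), Function.update_of_ne (by omega), f₁ j (by omega),
      Function.update_of_ne (by omega)]
  · obtain ⟨σ₂, t₂, e₂, v₂, f₂, b₂⟩ := H₂ ⟨i, hb⟩ (Function.update σ₁ 0 (σ₁ K)) (by simp [hK1])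
    simp only at b₂
    refine ⟨σ₂, _, Exec.seq (Exec.assign K (.var 0) σ) (Exec.seq e₁
      (Exec.cond_true (by simp [Expr.eval, v₁, hb]) (Exec.seq (Exec.assign 0 (.var K) σ₁) e₂))),
      by simp [v₂, hb], fun j hj => ?_, by simp [Expr.cost]; omega⟩
    rw [f₂ j (by omega), Function.update_of_ne (by omega), f₁ j (by omega),
      Function.update_of_ne (by omega)]

/-- Variable `K` keeps the environment, `K + 1` the unread part of the list, `K + 2` the
accumulator. The bound `T₃` does not depend on the accumulator, so the cost is linear in the length
of the list. -/
theorem foldl {D Y : ι → Type} {eD : ∀ i, D i → Data} {eY : ∀ i, Y i → Data}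
    {l : ∀ i, List (D i)} {init : ∀ i, Y i} {step : ∀ i, Y i → D i → Y i} {q : ι → ℕ}
    (hl : Cmp env (fun i => encList (eD i) (l i)) T₁)
    (hi : Cmp env (fun i => eY i (init i)) T₂)
    (hs : Cmp (ι := Σ j : (Σ i, D i), Y j.1)
      (fun j => .node (.node (env j.1.1) (eD j.1.1 j.1.2)) (eY j.1.1 j.2))
      (fun j => eY j.1.1 (step j.1.1 j.2 j.1.2)) fun j => T₃ j.1.1)
    (hq : ∀ i, (l i).length ≤ q i) :
    Cmp env (fun i => eY i ((l i).foldl (step i) (init i)))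
      fun i => T₁ i + T₂ i + q i * (T₃ i + 20) + 20 := by
  obtain ⟨c₁, k₁, hk₁, H₁⟩ := hl
  obtain ⟨c₂, k₂, hk₂, H₂⟩ := hi
  obtain ⟨c₃, k₃, hk₃, H₃⟩ := hs
  set K := max k₁ (max k₂ k₃) with hK
  let body : Prog := .seq (.assign 0 (.cons (.cons (.var K) (.hd (.var (K + 1)))) (.var (K + 2))))
    (.seq c₃ (.seq (.assign (K + 2) (.var 0)) (.assign (K + 1) (.tl (.var (K + 1))))))
  have loop : ∀ i (l' : List (D i)) (y : Y i) (σ : Store), σ K = env i →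
      σ (K + 1) = encList (eD i) l' → σ (K + 2) = eY i y →
      ∃ σ' t, Exec (.loop (.var (K + 1)) body) σ σ' t ∧
        σ' (K + 2) = eY i (l'.foldl (step i) y) ∧
        (∀ j, K + 3 ≤ j → σ' j = σ j) ∧ t ≤ l'.length * (T₃ i + 20) + 2 := by
    intro i l'
    induction l' with
    | nil =>
      intro y σ h0 h1 h2
      exact ⟨σ, _, Exec.loop_false (by simp [Expr.eval, h1, encList]), by simpa using h2,
        fun _ _ => rfl, by simp [Expr.cost]⟩
    | cons d l' ih =>
      intro y σ h0 h1 h2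
      obtain ⟨σ₁, t₁, e₁, v₁, f₁, b₁⟩ := H₃ ⟨⟨i, d⟩, y⟩ (Function.update σ 0
        ((Expr.cons (.cons (.var K) (.hd (.var (K + 1)))) (.var (K + 2))).eval σ))
        (by simp [Expr.eval, h0, h1, h2, encList, Data.hd])
      have g0 : σ₁ K = env i := by
        rw [f₁ _ (by omega), Function.update_of_ne (by omega), h0]
      have g1 : σ₁ (K + 1) = encList (eD i) (d :: l') := by
        rw [f₁ _ (by omega), Function.update_of_ne (by omega), h1]
      obtain ⟨σ₂, t₂, e₂, v₂, f₂, b₂⟩ := ih (step i y d)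
        (Function.update (Function.update σ₁ (K + 2) (σ₁ 0)) (K + 1) (Data.tl (σ₁ (K + 1))))
        (by simp [g0]) (by simp [g1, encList, Data.tl]) (by simp [v₁])
      have hbody : Exec body σ _ _ := Exec.seq (Exec.assign 0 _ σ) (Exec.seq e₁
        (Exec.seq (Exec.assign (K + 2) (.var 0) σ₁) (Exec.assign (K + 1) (.tl (.var (K + 1))) _)))
      have hne : (Expr.var (K + 1)).eval σ ≠ .nil := by simp [Expr.eval, h1, encList]
      refine ⟨σ₂, _, Exec.loop_true hne hbody (by simpa [Expr.eval] using e₂),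
        by simpa using v₂, fun j hj => ?_, ?_⟩
      · rw [f₂ j hj, Function.update_of_ne (by omega), Function.update_of_ne (by omega),
          f₁ j (by omega), Function.update_of_ne (by omega)]
      · simp only [Expr.cost, List.length_cons, Nat.add_mul] at *
        omega
  refine ⟨.seq (.assign K (.var 0)) (.seq c₁ (.seq (.assign (K + 1) (.var 0))
    (.seq (.assign 0 (.var K)) (.seq c₂ (.seq (.assign (K + 2) (.var 0))
      (.seq (.loop (.var (K + 1)) body) (.assign 0 (.var (K + 2))))))))), K + 3, by omega,
    fun i σ hσ => ?_⟩
  obtain ⟨σ₁, t₁, e₁, v₁, f₁, b₁⟩ := H₁ i (Function.update σ K (σ 0))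
    (by rw [Function.update_of_ne (by omega), hσ])
  have g1 : σ₁ K = env i := by rw [f₁ K (by omega)]; simp [hσ]
  obtain ⟨σ₂, t₂, e₂, v₂, f₂, b₂⟩ := H₂ i
    (Function.update (Function.update σ₁ (K + 1) (σ₁ 0)) 0 (σ₁ K)) (by simp [g1])
  have g2 : σ₂ K = env i := by
    rw [f₂ K (by omega), Function.update_of_ne (by omega), Function.update_of_ne (by omega), g1]
  have g3 : σ₂ (K + 1) = encList (eD i) (l i) := by
    rw [f₂ _ (by omega), Function.update_of_ne (by omega)]; simp [v₁]
  obtain ⟨σ₃, t₃, e₃, v₃, f₃, b₃⟩ := loop i (l i) (init i) (Function.update σ₂ (K + 2) (σ₂ 0))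
    (by simp [g2]) (by simp [g3]) (by simp [v₂])
  have b₃' := b₃.trans (Nat.add_le_add_right (Nat.mul_le_mul_right (T₃ i + 20) (hq i)) 2)
  refine ⟨_, _, Exec.seq (Exec.assign K (.var 0) σ) (Exec.seq e₁
    (Exec.seq (Exec.assign (K + 1) (.var 0) σ₁) (Exec.seq (Exec.assign 0 (.var K) _)
    (Exec.seq (by simpa [Expr.eval] using e₂) (Exec.seq (Exec.assign (K + 2) (.var 0) σ₂)
    (Exec.seq (by simpa [Expr.eval] using e₃) (Exec.assign 0 (.var (K + 2)) σ₃))))))),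
    by simp [Expr.eval, v₃], fun j hj => ?_, by simp only [Expr.cost]; omega⟩
  rw [Function.update_of_ne (by omega), f₃ j hj, Function.update_of_ne (by omega),
    f₂ j (by omega), Function.update_of_ne (by omega),
    Function.update_of_ne (by omega), f₁ j (by omega), Function.update_of_ne (by omega)]

end Cmp


/-! ### Contexts and functions computable in time polynomial in the size -/

def encOpt {α : Type} (e : α → Data) : Option α → Data
  | none => .nil
  | some a => .node .nil (e a)

def encPair {α β : Type} (e : α → Data) (e' : β → Data) (p : α × β) : Data :=
  .node (e p.1) (e' p.2)

def encFin {n : ℕ} (a : Fin n) : Data := encNat a.val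

/-- A context: an index type, a size, and an environment from which the list of the elements of
`Fin n` for the size `n` can be computed in polynomial time. -/
structure Ctx where
  ι : Type
  N : ι → ℕ
  env : ι → Data
  range : ∃ p : Polynomial ℕ,
    Cmp env (fun i => encList encFin (List.finRange (N i))) fun i => p.eval (N i)

/-- `f` is computable from the environment in time polynomial in the size. -/
def Easy (Γ : Ctx) (f : Γ.ι → Data) : Prop :=
  ∃ p : Polynomial ℕ, Cmp Γ.env f fun i => p.eval (Γ.N i)

/-- The extension of a context by a variable. -/
@[reducible] def Ctx.ext (Γ : Ctx) (D : Γ.ι → Type) (e : ∀ i, D i → Data) : Ctx where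
  ι := Σ i, D i
  N j := Γ.N j.1
  env j := .node (Γ.env j.1) (e j.1 j.2)
  range := by
    obtain ⟨p, hp⟩ := Γ.range
    refine ⟨Polynomial.C 3 + p, ((Cmp.expr (.hd (.var 0)) (f := fun j => Γ.env j.1) ?_).comp
      (hp.reindex Sigma.fst)).mono fun j => ?_⟩
    · intro j σ h
      simp [Expr.eval, h, Data.hd]
    · simp [Expr.cost]

namespace Easy

variable {Γ : Ctx}

theorem range : Easy Γ fun i => encList encFin (List.finRange (Γ.N i)) := Γ.range

theorem expr {f : Γ.ι → Data} (e : Expr)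
    (he : ∀ i (σ : Store), σ 0 = Γ.env i → e.eval σ = f i) : Easy Γ f :=
  ⟨Polynomial.C (e.cost + 1), (Cmp.expr e he).mono fun i => by simp⟩

theorem self : Easy Γ Γ.env := expr (.var 0) fun i σ h => by simp [Expr.eval, h]

theorem nil : Easy Γ fun _ => .nil := expr .nil fun _ _ _ => rfl

/-- Functions computed from a value that is itself easy. -/
theorem comp {Δ : Ctx} {f : Δ.ι → Data} (hf : Easy Δ f) (π : Γ.ι → Δ.ι)
    (hN : ∀ i, Δ.N (π i) = Γ.N i) (he : Easy Γ fun i => Δ.env (π i)) :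
    Easy Γ fun i => f (π i) := by
  obtain ⟨p, hp⟩ := hf
  obtain ⟨q, hq⟩ := he
  exact ⟨q + p, (hq.comp (hp.reindex π)).mono fun i => by simp [hN]⟩

theorem top {D : Γ.ι → Type} {e : ∀ i, D i → Data} :
    Easy (Γ.ext D e) fun j => e j.1 j.2 :=
  expr (.tl (.var 0)) fun i σ h => by simp [Expr.eval, h, Data.tl]

theorem wk {D : Γ.ι → Type} {e : ∀ i, D i → Data} {f : Γ.ι → Data} (hf : Easy Γ f) :
    Easy (Γ.ext D e) fun j => f j.1 :=
  hf.comp (Γ := Γ.ext D e) Sigma.fst (fun _ => rfl)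
    (expr (.hd (.var 0)) fun i σ h => by simp [Expr.eval, h, Data.hd])

theorem node {f g : Γ.ι → Data} (hf : Easy Γ f) (hg : Easy Γ g) :
    Easy Γ fun i => .node (f i) (g i) := by
  obtain ⟨p, hp⟩ := hf
  obtain ⟨q, hq⟩ := hg
  exact ⟨p + q + Polynomial.C 10, (hp.node hq).mono fun i => by simp⟩

/-- Binding of an auxiliary value. -/
theorem bind {D : Γ.ι → Type} {e : ∀ i, D i → Data} {v : ∀ i, D i}
    {f : ∀ i, D i → Data} (hv : Easy Γ fun i => e i (v i))
    (hf : Easy (Γ.ext D e) fun j => f j.1 j.2) : Easy Γ fun i => f i (v i) :=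
  hf.comp (Γ := Γ) (fun i => ⟨i, v i⟩) (fun _ => rfl) (self.node hv)

theorem hd {f : Γ.ι → Data} (hf : Easy Γ f) : Easy Γ fun i => (f i).hd :=
  bind (D := fun _ => Data) (e := fun _ d => d) (f := fun _ d => d.hd) hf
    (expr (.hd (.tl (.var 0))) fun i σ h => by simp [Expr.eval, h, Data.tl])

theorem tl {f : Γ.ι → Data} (hf : Easy Γ f) : Easy Γ fun i => (f i).tl :=
  bind (D := fun _ => Data) (e := fun _ d => d) (f := fun _ d => d.tl) hf
    (expr (.tl (.tl (.var 0))) fun i σ h => by simp [Expr.eval, h, Data.tl])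

theorem congr {f g : Γ.ι → Data} (hf : Easy Γ f) (h : ∀ i, g i = f i) : Easy Γ g := by
  rwa [show g = f from funext h]

theorem isNil {b f g : Γ.ι → Data} (hb : Easy Γ b) (hf : Easy Γ f) (hg : Easy Γ g)
    [∀ i, Decidable (b i ≠ .nil)] : Easy Γ fun i => if b i ≠ .nil then f i else g i := by
  obtain ⟨p, hp⟩ := hb
  obtain ⟨q, hq⟩ := hf
  obtain ⟨r, hr⟩ := hg
  exact ⟨p + q + r + Polynomial.C 10, (hp.ite (T₂ := fun i => q.eval (Γ.N i)) (hq.reindex Subtype.val) hr).mono fun i => by simp⟩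

theorem encBool_ne (b : Bool) : encBool b ≠ .nil ↔ b = true := by cases b <;> simp [encBool]

theorem ite {b : Γ.ι → Bool} {f g : Γ.ι → Data} (hb : Easy Γ fun i => encBool (b i))
    (hf : Easy Γ f) (hg : Easy Γ g) : Easy Γ fun i => if b i then f i else g i := by
  classical
  exact (hb.isNil hf hg).congr fun i => by simp only [encBool_ne]

theorem bool (b : Bool) : Easy Γ fun _ => encBool b := by
  cases b
  · exact nil
  · exact nil.node nil

theorem not {b : Γ.ι → Bool} (hb : Easy Γ fun i => encBool (b i)) :
    Easy Γ fun i => encBool (!b i) :=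
  (hb.ite (bool false) (bool true)).congr fun i => by cases b i <;> simp

theorem and {b c : Γ.ι → Bool} (hb : Easy Γ fun i => encBool (b i))
    (hc : Easy Γ fun i => encBool (c i)) : Easy Γ fun i => encBool (b i && c i) :=
  (hb.ite hc (bool false)).congr fun i => by cases b i <;> simp

theorem or {b c : Γ.ι → Bool} (hb : Easy Γ fun i => encBool (b i))
    (hc : Easy Γ fun i => encBool (c i)) : Easy Γ fun i => encBool (b i || c i) :=
  (hb.ite (bool true) hc).congr fun i => by cases b i <;> simp

theorem boolEq {b c : Γ.ι → Bool} (hb : Easy Γ fun i => encBool (b i))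
    (hc : Easy Γ fun i => encBool (c i)) : Easy Γ fun i => encBool (b i == c i) :=
  (hb.ite hc hc.not).congr fun i => by cases b i <;> simp

/-- Where the encoding is not `nil`, its tail encodes the content; pairing the environment with this
tail gives the extended environment in which `g` is evaluated. -/
theorem none_or_some {D : Γ.ι → Type} {e : ∀ i, D i → Data} {o : ∀ i, Option (D i)} {f : Γ.ι → Data}
    {g : ∀ i, D i → Data} (ho : Easy Γ fun i => encOpt (e i) (o i)) (hf : Easy Γ f)
    (hg : Easy (Γ.ext D e) fun j => g j.1 j.2) :
    Easy Γ fun i => (o i).elim (f i) (g i) := by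
  classical
  have key : ∀ i, encOpt (e i) (o i) ≠ .nil ↔ (o i).isSome = true := by
    intro i; cases o i <;> simp [encOpt]
  obtain ⟨r, hr⟩ := self.node ho.tl
  obtain ⟨p, hp⟩ := ho
  obtain ⟨q, hq⟩ := hf
  obtain ⟨u, hu⟩ := hg
  refine ⟨p + (r + u) + q + Polynomial.C 10, ((hp.ite (T₂ := fun i => r.eval (Γ.N i) +
    u.eval (Γ.N i)) (f := fun i => (o i).elim (f i) (g i)) ?_ hq).mono fun i => by simp).congr
    fun i => ?_⟩
  · have h1 := hu.reindex (κ := {i // encOpt (e i) (o i) ≠ .nil})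
      fun i => ⟨i.1, (o i.1).get ((key i.1).1 i.2)⟩
    refine Cmp.congr ((hr.reindex Subtype.val).comp (h1.congrEnv fun i => ?_)) fun i => ?_
    · obtain ⟨i, hi⟩ := i
      obtain ⟨d, hd⟩ := Option.isSome_iff_exists.1 ((key i).1 hi)
      simp [hd, encOpt, Data.tl]
    · obtain ⟨i, hi⟩ := i
      obtain ⟨d, hd⟩ := Option.isSome_iff_exists.1 ((key i).1 hi)
      simp [hd]
  · cases h : o i <;> simp [encOpt]

/-! ### Lists -/

variable {D Y : Γ.ι → Type} {eD : ∀ i, D i → Data} {eY : ∀ i, Y i → Data}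
  {l : ∀ i, List (D i)}

/-- The length of a list is polynomially bounded. -/
def Short (Γ : Ctx) {D : Γ.ι → Type} (l : ∀ i, List (D i)) : Prop :=
  ∃ q : Polynomial ℕ, ∀ i, (l i).length ≤ q.eval (Γ.N i)

theorem foldl {init : ∀ i, Y i} {step : ∀ i, Y i → D i → Y i}
    (hq : Short Γ l) (hl : Easy Γ fun i => encList (eD i) (l i))
    (hi : Easy Γ fun i => eY i (init i))
    (hs : Easy ((Γ.ext D eD).ext (fun j => Y j.1) fun j => eY j.1)
      fun j => eY j.1.1 (step j.1.1 j.2 j.1.2)) :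
    Easy Γ fun i => eY i ((l i).foldl (step i) (init i)) := by
  obtain ⟨p, hp⟩ := hl
  obtain ⟨r, hr⟩ := hi
  obtain ⟨u, hu⟩ := hs
  obtain ⟨q, hq⟩ := hq
  exact ⟨p + r + q * (u + Polynomial.C 20) + Polynomial.C 20,
    (Cmp.foldl (T₃ := fun i => u.eval (Γ.N i)) hp hr hu hq).mono fun i => by simp⟩

theorem reverse (hq : Short Γ l) (hl : Easy Γ fun i => encList (eD i) (l i)) :
    Easy Γ fun i => encList (eD i) (l i).reverse := by
  refine (foldl (Y := fun i => List (D i)) (eY := fun i => encList (eD i))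
    (init := fun _ => []) (step := fun _ y d => d :: y) hq hl nil ?_).congr fun i => ?_
  · exact (top (Γ := Γ)).wk.node top
  · rw [← List.foldr_reverse]; simp

theorem Short.reverse (hq : Short Γ l) : Short Γ fun i => (l i).reverse := by
  simpa [Short] using hq

theorem foldr {init : ∀ i, Y i} {step : ∀ i, D i → Y i → Y i}
    (hq : Short Γ l) (hl : Easy Γ fun i => encList (eD i) (l i))
    (hi : Easy Γ fun i => eY i (init i))
    (hs : Easy ((Γ.ext D eD).ext (fun j => Y j.1) fun j => eY j.1)
      fun j => eY j.1.1 (step j.1.1 j.1.2 j.2)) :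
    Easy Γ fun i => eY i ((l i).foldr (step i) (init i)) := by
  refine (foldl (step := fun i y d => step i d y) hq.reverse (hl.reverse hq) hi hs).congr
    fun i => ?_
  rw [List.foldl_reverse]

theorem map {B : Γ.ι → Type} {eB : ∀ i, B i → Data} {f : ∀ i, D i → B i}
    (hq : Short Γ l) (hl : Easy Γ fun i => encList (eD i) (l i))
    (hf : Easy (Γ.ext D eD) fun j => eB j.1 (f j.1 j.2)) :
    Easy Γ fun i => encList (eB i) ((l i).map (f i)) := by
  refine (foldr (Y := fun i => List (B i)) (eY := fun i => encList (eB i))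
    (init := fun _ => []) (step := fun i d y => f i d :: y) hq hl nil ?_).congr fun i => ?_
  · exact hf.wk.node top
  · rw [← List.map_eq_foldr]

theorem filter {f : ∀ i, D i → Bool} (hq : Short Γ l)
    (hl : Easy Γ fun i => encList (eD i) (l i))
    (hf : Easy (Γ.ext D eD) fun j => encBool (f j.1 j.2)) :
    Easy Γ fun i => encList (eD i) ((l i).filter (f i)) := by
  refine (foldr (Y := fun i => List (D i)) (eY := fun i => encList (eD i))
    (init := fun _ => []) (step := fun i d y => if f i d then d :: y else y) hq hl nil
    ?_).congr fun i => ?_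
  · exact (hf.wk.ite ((top (Γ := Γ)).wk.node top) top).congr fun j => by
      split_ifs <;> simp [encList]
  · congr 1
    induction l i with
    | nil => rfl
    | cons a l ih => simp [List.filter_cons, ih]

theorem Short.filter (hq : Short Γ l) (f : ∀ i, D i → Bool) :
    Short Γ fun i => (l i).filter (f i) := by
  obtain ⟨q, hq⟩ := hq
  exact ⟨q, fun i => (List.length_filter_le _ _).trans (hq i)⟩

theorem any {f : ∀ i, D i → Bool} (hq : Short Γ l)
    (hl : Easy Γ fun i => encList (eD i) (l i))
    (hf : Easy (Γ.ext D eD) fun j => encBool (f j.1 j.2)) :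
    Easy Γ fun i => encBool ((l i).any (f i)) := by
  refine (foldr (Y := fun _ => Bool) (eY := fun _ => encBool)
    (init := fun _ => false) (step := fun i d y => f i d || y) hq hl nil ?_).congr fun i => ?_
  · exact hf.wk.or top
  · congr 1
    induction l i with
    | nil => rfl
    | cons a l ih => simp [ih]

theorem all {f : ∀ i, D i → Bool} (hq : Short Γ l)
    (hl : Easy Γ fun i => encList (eD i) (l i))
    (hf : Easy (Γ.ext D eD) fun j => encBool (f j.1 j.2)) :
    Easy Γ fun i => encBool ((l i).all (f i)) := by
  refine (foldr (Y := fun _ => Bool) (eY := fun _ => encBool)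
    (init := fun _ => true) (step := fun i d y => f i d && y) hq hl (bool true) ?_).congr
    fun i => ?_
  · exact hf.wk.and top
  · congr 1
    induction l i with
    | nil => rfl
    | cons a l ih => simp [ih]

theorem headD {d : ∀ i, D i} (hl : Easy Γ fun i => encList (eD i) (l i))
    (hd : Easy Γ fun i => eD i (d i)) : Easy Γ fun i => eD i ((l i).headD (d i)) := by
  classical
  refine (hl.isNil hl.hd hd).congr fun i => ?_
  cases l i <;> simp [encList, Data.hd]

theorem findIdx {f : ∀ i, D i → Bool} (hq : Short Γ l)
    (hl : Easy Γ fun i => encList (eD i) (l i))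
    (hf : Easy (Γ.ext D eD) fun j => encBool (f j.1 j.2)) :
    Easy Γ fun i => encNat ((l i).findIdx (f i)) := by
  refine (foldr (Y := fun _ => ℕ) (eY := fun _ => encNat)
    (init := fun _ => 0) (step := fun i d y => if f i d then 0 else y + 1) hq hl nil
    ?_).congr fun i => ?_
  · exact (hf.wk.ite nil (nil.node top)).congr fun j => by
      split_ifs <;> simp [encNat]
  · congr 1
    induction l i with
    | nil => rfl
    | cons a l ih => simp [List.findIdx_cons, ih, Bool.cond_eq_ite]

theorem append {l' : ∀ i, List (D i)} (hq : Short Γ l)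
    (hl : Easy Γ fun i => encList (eD i) (l i)) (hl' : Easy Γ fun i => encList (eD i) (l' i)) :
    Easy Γ fun i => encList (eD i) (l i ++ l' i) := by
  refine (foldr (Y := fun i => List (D i)) (eY := fun i => encList (eD i))
    (init := l') (step := fun i d y => d :: y) hq hl hl' ?_).congr fun i => ?_
  · exact (top (Γ := Γ)).wk.node top
  · simp

theorem flatMap {B : Γ.ι → Type} {eB : ∀ i, B i → Data} {f : ∀ i, D i → List (B i)}
    (hq : Short Γ l) (hl : Easy Γ fun i => encList (eD i) (l i))
    (hqf : Short (Γ.ext D eD) fun j => f j.1 j.2)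
    (hf : Easy (Γ.ext D eD) fun j => encList (eB j.1) (f j.1 j.2)) :
    Easy Γ fun i => encList (eB i) ((l i).flatMap (f i)) := by
  refine (foldr (Y := fun i => List (B i)) (eY := fun i => encList (eB i))
    (init := fun _ => []) (step := fun i d y => f i d ++ y) hq hl nil ?_).congr fun i => ?_
  · refine append (Γ := (Γ.ext D eD).ext (fun j => List (B j.1)) fun j => encList (eB j.1))
      (l := fun j => f j.1.1 j.1.2) (l' := fun j => j.2) (eD := fun j => eB j.1.1) ?_ hf.wk top
    obtain ⟨q, hq⟩ := hqf
    exact ⟨q, fun j => hq j.1⟩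
  · congr 1
    induction l i with
    | nil => rfl
    | cons a l ih => simp [ih]

/-- Iteration of a map, as often as a list has elements. -/
theorem iterate {init : ∀ i, Y i} {step : ∀ i, Y i → Y i}
    (hq : Short Γ l) (hl : Easy Γ fun i => encList (eD i) (l i))
    (hi : Easy Γ fun i => eY i (init i))
    (hs : Easy (Γ.ext Y eY) fun j => eY j.1 (step j.1 j.2)) :
    Easy Γ fun i => eY i ((step i)^[(l i).length] (init i)) := by
  refine (foldl (step := fun i y _ => step i y) hq hl hi ?_).congr fun i => ?_
  · refine hs.comp (Δ := Γ.ext Y eY)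
      (Γ := (Γ.ext D eD).ext (fun j => Y j.1) fun j => eY j.1)
      (fun j => ⟨j.1.1, j.2⟩) (fun _ => rfl) ?_
    exact (self (Γ := Γ)).wk.wk.node top
  · congr 1
    exact (List.foldl_const _ _ _).symm

/-! ### Numbers -/

theorem encNat_eq (k : ℕ) : encNat k = encList (fun _ : Unit => .nil) (List.replicate k ()) := by
  induction k with
  | zero => rfl
  | succ k ih => simp [encNat, List.replicate_succ, encList, ih]

theorem short_fin (x : ∀ i, Fin (Γ.N i)) : Short Γ fun i => List.replicate (x i).val () :=
  ⟨Polynomial.X, fun i => by simp⟩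

/-- The tail of `d` after `k` cells. -/
def drop (k : ℕ) (d : Data) : Data := Data.tl^[k] d

theorem drop_encNat (k m : ℕ) : drop k (encNat m) = encNat (m - k) := by
  induction k generalizing m with
  | zero => rfl
  | succ k ih =>
    rw [drop, Function.iterate_succ_apply, ← drop]
    cases m with
    | zero => simpa [encNat, Data.tl] using ih 0
    | succ m => simpa [encNat, Data.tl] using ih m

theorem drop_encList {α : Type} (e : α → Data) (k : ℕ) (l : List α) :
    drop k (encList e l) = encList e (l.drop k) := by
  induction k generalizing l with
  | zero => rfl
  | succ k ih =>
    rw [drop, Function.iterate_succ_apply, ← drop]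
    cases l with
    | nil => simpa [encList, Data.tl] using ih []
    | cons a l => simpa [encList, Data.tl] using ih l

/-- A unary numeral is itself a list of the right length and can drive the loop. -/
theorem dropFin {x : ∀ i, Fin (Γ.N i)} {f : Γ.ι → Data} (hx : Easy Γ fun i => encFin (x i))
    (hf : Easy Γ f) : Easy Γ fun i => drop (x i) (f i) := by
  refine (iterate (l := fun i => List.replicate (x i).val ()) (D := fun _ => Unit)
    (eD := fun _ _ => .nil) (Y := fun _ => Data) (eY := fun _ d => d) (init := f)
    (step := fun _ d => d.tl) (short_fin x)
    (hx.congr fun i => (encNat_eq _).symm) hf (top (Γ := Γ)).tl).congr fun i => ?_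
  simp [drop]

/-- Two numbers are equal iff both truncated differences vanish. -/
theorem finEq {x y : ∀ i, Fin (Γ.N i)} (hx : Easy Γ fun i => encFin (x i))
    (hy : Easy Γ fun i => encFin (y i)) : Easy Γ fun i => encBool (decide (x i = y i)) := by
  classical
  refine ((hx.dropFin hy).isNil (bool false) ((hy.dropFin hx).isNil (bool false)
    (bool true))).congr fun i => ?_
  have key : ∀ k, encNat k ≠ .nil ↔ k ≠ 0 := by
    intro k; cases k <;> simp [encNat]
  simp only [encFin, drop_encNat, key]
  split_ifs with h1 h2
  · rw [decide_eq_false]; rintro h; rw [h] at h1; simp at h1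
  · rw [decide_eq_false]; rintro h; rw [h] at h2; simp at h2
  · rw [decide_eq_true]; exact Fin.ext (by omega)

/-- Look-up in a list indexed by `Fin n`. -/
theorem get {α : Γ.ι → Type} {e : ∀ i, α i → Data} {f : ∀ i, Fin (Γ.N i) → α i}
    {x : ∀ i, Fin (Γ.N i)}
    (hf : Easy Γ fun i => encList (fun k => e i (f i k)) (List.finRange (Γ.N i)))
    (hx : Easy Γ fun i => encFin (x i)) : Easy Γ fun i => e i (f i (x i)) := by
  refine ((hx.dropFin hf).hd).congr fun i => ?_
  rw [drop_encList, List.drop_eq_getElem_cons (by simp)]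
  simp [encList, Data.hd]

end Easy


/-! ### Enumerated types and tables -/

/-- A family of finite types whose elements can be listed and compared in polynomial time. -/
structure Fam where
  V : ℕ → Type
  enc : ∀ {n}, V n → Data
  list : ∀ n, List (V n)
  mem : ∀ {n} (v : V n), v ∈ list n
  nodup : ∀ n, (list n).Nodup
  eqb : ∀ {n}, V n → V n → Bool
  eqb_iff : ∀ {n} (v w : V n), eqb v w = true ↔ v = w
  short : ∃ q : Polynomial ℕ, ∀ n, (list n).length ≤ q.eval n
  easyList : ∀ Γ : Ctx, Easy Γ fun i => encList enc (list (Γ.N i))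
  easyEq : ∀ (Γ : Ctx) (x y : ∀ i, V (Γ.N i)), (Easy Γ fun i => enc (x i)) →
    (Easy Γ fun i => enc (y i)) → Easy Γ fun i => encBool (eqb (x i) (y i))

namespace Fam

@[reducible] def fin : Fam where
  V := Fin
  enc := encFin
  list := List.finRange
  mem := List.mem_finRange
  nodup := List.nodup_finRange
  eqb x y := decide (x = y)
  eqb_iff _ _ := decide_eq_true_iff
  short := ⟨Polynomial.X, by simp⟩
  easyList _ := Easy.range
  easyEq _ _ _ hx hy := hx.finEq hy

@[reducible] def bool : Fam where
  V _ := Bool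
  enc := encBool
  list _ := [false, true]
  mem := by simp
  nodup := by simp
  eqb x y := x == y
  eqb_iff _ _ := beq_iff_eq
  short := ⟨Polynomial.C 2, by simp⟩
  easyList _ := (Easy.bool _).node ((Easy.bool _).node Easy.nil)
  easyEq _ _ _ hx hy := hx.boolEq hy

@[reducible] def prod (F G : Fam) : Fam where
  V n := F.V n × G.V n
  enc := encPair F.enc G.enc
  list n := F.list n ×ˢ G.list n
  mem v := List.mem_product.2 ⟨F.mem _, G.mem _⟩
  nodup n := (F.nodup n).product (G.nodup n)
  eqb x y := F.eqb x.1 y.1 && G.eqb x.2 y.2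
  eqb_iff x y := by simp [F.eqb_iff, G.eqb_iff, Prod.ext_iff]
  short := by
    obtain ⟨p, hp⟩ := F.short
    obtain ⟨q, hq⟩ := G.short
    exact ⟨p * q, fun n => by
      rw [List.length_product, Polynomial.eval_mul]; exact Nat.mul_le_mul (hp n) (hq n)⟩
  easyList Γ := by
    obtain ⟨p, hp⟩ := F.short
    obtain ⟨q, hq⟩ := G.short
    refine Easy.flatMap (f := fun i a => (G.list (Γ.N i)).map (Prod.mk a))
      (eB := fun _ => encPair F.enc G.enc) (eD := fun _ => F.enc)
      ⟨p, fun _ => hp _⟩ (F.easyList Γ) ⟨q, fun j => by simpa using hq _⟩ ?_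
    exact Easy.map (Γ := Γ.ext (fun i => F.V (Γ.N i)) fun _ => F.enc)
      (f := fun j b => (j.2, b)) (eD := fun _ => G.enc)
      (eB := fun _ => encPair F.enc G.enc) ⟨q, fun j => hq _⟩ (G.easyList _)
      ((Easy.top (Γ := Γ)).wk.node Easy.top)
  easyEq Γ x y hx hy := (F.easyEq Γ _ _ hx.hd hy.hd).and (G.easyEq Γ _ _ hx.tl hy.tl)

@[reducible] def opt (F : Fam) : Fam where
  V n := Option (F.V n)
  enc := encOpt F.enc
  list n := none :: (F.list n).map some
  mem v := by cases v <;> simp [F.mem]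
  nodup n := List.nodup_cons.2 ⟨by simp, (F.nodup n).map (Option.some_injective _)⟩
  eqb
    | none, none => true
    | some x, some y => F.eqb x y
    | _, _ => false
  eqb_iff x y := by cases x <;> cases y <;> simp [F.eqb_iff]
  short := by
    obtain ⟨p, hp⟩ := F.short
    exact ⟨p + Polynomial.C 1, fun n => by simpa using hp n⟩
  easyList Γ := by
    obtain ⟨p, hp⟩ := F.short
    refine Easy.nil.node (Easy.map (f := fun _ => some) (eB := fun _ => encOpt F.enc)
      (eD := fun _ => F.enc) ⟨p, fun _ => hp _⟩ (F.easyList Γ) (Easy.nil.node Easy.top))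
  easyEq Γ x y hx hy := by
    let Δ := Γ.ext (fun i => F.V (Γ.N i)) fun _ => F.enc
    have hs : Easy Δ fun j => (y j.1).elim (encBool false) fun b => encBool (F.eqb j.2 b) :=
      Easy.none_or_some (Γ := Δ) (D := fun j => F.V (Γ.N j.1)) (e := fun _ => F.enc)
        (o := fun j => y j.1) (g := fun j b => encBool (F.eqb j.2 b)) hy.wk (Easy.bool false)
        (F.easyEq (Δ.ext (fun j => F.V (Γ.N j.1)) fun _ => F.enc) (fun j => j.1.2)
          (fun j => j.2) (Easy.top (Γ := Γ)).wk Easy.top)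
    have h1 : Easy Γ fun i => (x i).elim ((y i).elim (encBool true) fun _ => encBool false)
        fun a => (y i).elim (encBool false) fun b => encBool (F.eqb a b) :=
      hx.none_or_some (hy.none_or_some (Easy.bool true) (Easy.bool false)) hs
    exact h1.congr fun i => by cases x i <;> cases y i <;> rfl

/-- The table of the values of a Boolean function. -/
def table (F : Fam) {n : ℕ} (T : F.V n → Bool) : Data :=
  encList (fun v => .node (F.enc v) (encBool (T v))) (F.list n)

theorem easy_table (F : Fam) {Γ : Ctx} {T : ∀ i, F.V (Γ.N i) → Bool}
    (hT : Easy (Γ.ext (fun i => F.V (Γ.N i)) fun _ => F.enc) fun j => encBool (T j.1 j.2)) :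
    Easy Γ fun i => F.table (T i) := by
  obtain ⟨p, hp⟩ := F.short
  refine (Easy.map (f := fun i v => (v, T i v)) (eB := fun _ => encPair F.enc encBool)
      (eD := fun _ => F.enc) ⟨p, fun _ => hp _⟩ (F.easyList Γ) (Easy.top.node hT)).congr
    fun i => ?_
  rw [table]
  induction F.list (Γ.N i) with
  | nil => rfl
  | cons a l ih => simp [encList, ih, encPair]

/-- The table is searched as an association list, the first matching key deciding. The enumeration
is complete, so the default `false` never matters. -/
theorem easy_lookup (F : Fam) {Γ : Ctx} {T : ∀ i, F.V (Γ.N i) → Bool} {x : ∀ i, F.V (Γ.N i)}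
    (hT : Easy Γ fun i => F.table (T i)) (hx : Easy Γ fun i => F.enc (x i)) :
    Easy Γ fun i => encBool (T i (x i)) := by
  obtain ⟨p, hp⟩ := F.short
  refine (Easy.foldr (l := fun i => (F.list (Γ.N i)).map fun v => (v, T i v))
    (eD := fun _ => encPair F.enc encBool) (Y := fun _ => Bool) (eY := fun _ => encBool)
    (init := fun _ => false) (step := fun i d y => if F.eqb d.1 (x i) then d.2 else y)
    ⟨p, fun i => by simpa using hp _⟩ (hT.congr fun i => ?_) Easy.nil ?_).congr fun i => ?_
  · rw [table]
    induction F.list (Γ.N i) with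
    | nil => rfl
    | cons a l ih => simp [encList, ih, encPair]
  · refine ((F.easyEq (((Γ.ext (fun i => F.V (Γ.N i) × Bool) fun _ => encPair F.enc encBool).ext
      (fun _ => Bool) fun _ => encBool)) (fun j => j.1.2.1) (fun j => x j.1.1)
      (Easy.top (Γ := Γ)).wk.hd hx.wk.wk).ite (Easy.top (Γ := Γ)).wk.tl Easy.top).congr fun j => ?_
    dsimp only
    split_ifs <;> rfl
  · congr 1
    have key : ∀ l : List (F.V (Γ.N i)), x i ∈ l → T i (x i) = (l.map fun v => (v, T i v)).foldr
        (fun d y => if F.eqb d.1 (x i) then d.2 else y) false := by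
      intro l hl
      induction l with
      | nil => simp at hl
      | cons a l ih =>
        rw [List.map_cons, List.foldr_cons]
        dsimp only
        split_ifs with h
        · rw [(F.eqb_iff _ _).1 h]
        · refine ih ((List.mem_cons.1 hl).resolve_left fun h' => h ?_)
          exact (F.eqb_iff _ _).2 h'.symm
    exact key _ (F.mem _)

end Fam


variable {n : ℕ}

/-! ### Cyclic chains -/

section Cyclic

variable {α : Type*} {r : α → α → Prop} {c : Cycle α}

theorem exists_cons_of_mem_cycle {a : α} (ha : a ∈ c) : ∃ l : List α, c = ↑(a :: l) := by
  induction c using Cycle.induction_on with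
  | nil => simp at ha
  | cons b l _ =>
    obtain ⟨s, t, hst⟩ := List.append_of_mem (Cycle.mem_coe_iff.1 ha)
    refine ⟨t ++ s, ?_⟩
    rw [hst, Cycle.coe_eq_coe]
    exact ⟨s.length, by simp⟩

theorem exists_succ_of_chain (h : c.Chain r) {a : α} (ha : a ∈ c) : ∃ b ∈ c, r a b := by
  obtain ⟨l, rfl⟩ := exists_cons_of_mem_cycle ha
  rw [Cycle.chain_coe_cons] at h
  cases l with
  | nil => exact ⟨a, by simp, by simpa using h⟩
  | cons b l => exact ⟨b, by simp, by simpa using (List.isChain_cons_cons.1 h).1⟩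

theorem exists_pred_of_chain (h : c.Chain r) {a : α} (ha : a ∈ c) : ∃ b ∈ c, r b a := by
  obtain ⟨l, rfl⟩ := exists_cons_of_mem_cycle ha
  rw [Cycle.chain_coe_cons] at h
  rcases List.eq_nil_or_concat l with rfl | ⟨l, b, rfl⟩
  · exact ⟨a, by simp, by simpa using h⟩
  · refine ⟨b, by simp, ?_⟩
    have h' : List.IsChain r ((a :: l) ++ [b, a]) := by simpa using h
    have := (List.isChain_append.1 h').2.1
    simpa using this

/-- A cyclic chain leads from any of its elements to all others. -/
theorem forall_of_chain (h : c.Chain r) {P : α → Prop}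
    (hP : ∀ a ∈ c, ∀ b ∈ c, r a b → P a → P b) {a : α} (ha : a ∈ c) (h0 : P a) :
    ∀ b ∈ c, P b := by
  obtain ⟨l, rfl⟩ := exists_cons_of_mem_cycle ha
  rw [Cycle.chain_coe_cons] at h
  have key : ∀ (m : List α) (x : α), List.IsChain r (x :: m) → (∀ y ∈ x :: m, y ∈ a :: l) →
      P x → ∀ y ∈ x :: m, P y := by
    intro m
    induction m with
    | nil => intro x _ _ hx y hy; simp_all
    | cons z m ih =>
      intro x hc hm hx y hy
      rw [List.isChain_cons_cons] at hc
      rcases List.mem_cons.1 hy with rfl | hy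
      · exact hx
      · refine ih z hc.2 (fun w hw => hm w (List.mem_cons_of_mem _ hw)) ?_ y hy
        exact hP x (Cycle.mem_coe_iff.2 (hm x (by simp))) z
          (Cycle.mem_coe_iff.2 (hm z (by simp))) hc.1 hx
  intro b hb
  refine key (l ++ [a]) a h (fun y hy => ?_) h0 b ?_
  · simp at hy ⊢; tauto
  · have := Cycle.mem_coe_iff.1 hb
    simp at this ⊢; tauto

theorem chain_imp {r' : α → α → Prop} (h : c.Chain r)
    (hr : ∀ a ∈ c, ∀ b ∈ c, r a b → r' a b) : c.Chain r' := by
  have key : ∀ l : List α, (∀ a ∈ l, a ∈ c) → List.IsChain r l → List.IsChain r' l := by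
    intro l
    induction l with
    | nil => simp
    | cons a l ih =>
      cases l with
      | nil => simp
      | cons b l =>
        simp only [List.isChain_cons_cons]
        exact fun hm h => ⟨hr a (hm a (by simp)) b (hm b (by simp)) h.1,
          ih (fun x hx => hm x (List.mem_cons_of_mem _ hx)) h.2⟩
  induction c using Cycle.induction_on with
  | nil => exact Cycle.Chain.nil _
  | cons a l _ =>
    rw [Cycle.chain_coe_cons] at h ⊢
    exact key _ (fun x hx => by simp at hx ⊢; tauto) h

/-- A duplicate-free cyclic chain for a function is determined by one of its elements. -/
theorem cycle_ext_of_chain {c' : Cycle α} {f : α → α} (hc : c.Chain fun a b => f a = b)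
    (hc' : c'.Chain fun a b => f a = b) (hn : c.Nodup) (hn' : c'.Nodup) {a : α} (ha : a ∈ c)
    (ha' : a ∈ c') : c = c' := by
  obtain ⟨l, rfl⟩ := exists_cons_of_mem_cycle ha
  obtain ⟨l', rfl⟩ := exists_cons_of_mem_cycle ha'
  rw [Cycle.chain_coe_cons] at hc hc'
  rw [Cycle.nodup_coe_iff] at hn hn'
  -- Both lists follow `f` from the same point and stop at the first return to `a`.
  have key : ∀ (l l' : List α) (x : α), List.IsChain (fun a b => f a = b) (x :: (l ++ [a])) →
      List.IsChain (fun a b => f a = b) (x :: (l' ++ [a])) → a ∉ l → a ∉ l' → l = l' := by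
    intro l
    induction l with
    | nil =>
      intro l' x h h' hl hl'
      cases l' with
      | nil => rfl
      | cons b l' =>
        simp only [List.nil_append, List.cons_append, List.isChain_cons_cons] at h h'
        exact absurd (h.1.symm.trans h'.1) (fun e => hl' (by simp [e]))
    | cons b l ih =>
      intro l' x h h' hl hl'
      cases l' with
      | nil =>
        simp only [List.nil_append, List.cons_append, List.isChain_cons_cons] at h h'
        exact absurd (h'.1.symm.trans h.1) (fun e => hl (by simp [e]))
      | cons b' l' =>
        simp only [List.cons_append, List.isChain_cons_cons] at h h'
        obtain rfl := h.1.symm.trans h'.1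
        rw [ih l' b h.2 h'.2 (fun h => hl (by simp [h])) (fun h => hl' (by simp [h]))]
  rw [key l l' a hc hc' (List.nodup_cons.1 hn).1 (List.nodup_cons.1 hn').1]

end Cyclic

/-! ### Elimination of rotations -/

variable {A : Inst n}

instance : Finite (StableMatching A) := inferInstanceAs (Finite {M // IsStable A M})

theorem rank_sup (M N : StableMatching A) (b : Fin n) :
    A.boyRank b ((M ⊔ N).1 b) = max (A.boyRank b (M.1 b)) (A.boyRank b (N.1 b)) := by
  change A.boyRank b (worse A M.1 N.1 b) = _
  unfold worse
  split_ifs with h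
  · exact (max_eq_right h).symm
  · exact (max_eq_left (not_le.1 h).le).symm

theorem rank_inf (M N : StableMatching A) (b : Fin n) :
    A.boyRank b ((M ⊓ N).1 b) = min (A.boyRank b (M.1 b)) (A.boyRank b (N.1 b)) := by
  change A.boyRank b (better A M.1 N.1 b) = _
  unfold better
  split_ifs with h
  · exact (min_eq_left h).symm
  · exact (min_eq_right (not_le.1 h).le).symm

/-- A girl who was worse off in `N` would block it with her partner in `M`, who then strictly
prefers her. -/
theorem girlRank_antitone {M N : StableMatching A} (h : M ≤ N) (g : Fin n) :
    A.girlRank g (N.1.symm g) ≤ A.girlRank g (M.1.symm g) := by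
  by_contra hlt
  rw [not_le] at hlt
  refine N.2 (M.1.symm g) g ⟨?_, hlt⟩
  have h1 := h (M.1.symm g)
  rw [Equiv.apply_symm_apply] at h1
  refine lt_of_le_of_ne h1 fun e => hlt.ne ?_
  rw [Equiv.symm_apply_eq N.1 |>.2 (boyRank_inj A e)]

theorem IsFirstWilling.unique {M : Equiv.Perm (Fin n)} {b g g' : Fin n}
    (h : IsFirstWilling A M b g) (h' : IsFirstWilling A M b g') : g = g' :=
  boyRank_inj A (le_antisymm (h.2 g' h'.1) (h'.2 g h.1))

/-- A willing girl whom `b` prefers to his partner would block `M` with him. -/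
theorem IsFirstWilling.lt {M : StableMatching A} {b g : Fin n}
    (h : IsFirstWilling A M.1 b g) : A.boyRank b (M.1 b) < A.boyRank b g := by
  by_contra hlt
  rcases (not_lt.1 hlt).lt_or_eq with h' | h'
  · exact M.2 b g ⟨h', h.1⟩
  · have := h.1
    rw [boyRank_inj A h', Equiv.symm_apply_apply] at this
    exact lt_irrefl _ this

theorem exists_firstWilling {M : Equiv.Perm (Fin n)} {b g : Fin n}
    (h : A.girlRank g b < A.girlRank g (M.symm g)) :
    ∃ g', IsFirstWilling A M b g' ∧ A.boyRank b g' ≤ A.boyRank b g := by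
  obtain ⟨g', hg', hmin⟩ := Set.exists_min_image
    {g | A.girlRank g b < A.girlRank g (M.symm g)} (A.boyRank b) (Set.toFinite _) ⟨g, h⟩
  exact ⟨g', ⟨hg', hmin⟩, hmin g h⟩

/-- If a boy changes his partner from `M` to `N`, then he gets at most his first willing girl, and
so her partner changes too. -/
theorem move_step {M N : StableMatching A} (hMN : M ≤ N) {b : Fin n} (hb : M.1 b ≠ N.1 b) :
    ∃ g, IsFirstWilling A M.1 b g ∧ A.boyRank b g ≤ A.boyRank b (N.1 b) ∧
      M.1 (M.1.symm g) ≠ N.1 (M.1.symm g) := by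
  have hw : A.girlRank (N.1 b) b < A.girlRank (N.1 b) (M.1.symm (N.1 b)) := by
    have := girlRank_antitone hMN (N.1 b)
    rw [Equiv.symm_apply_apply] at this
    refine lt_of_le_of_ne this fun e => hb ?_
    exact ((Equiv.symm_apply_eq M.1).1 (girlRank_inj A e).symm).symm
  obtain ⟨g, hg, hle⟩ := exists_firstWilling hw
  refine ⟨g, hg, hle, fun e => ?_⟩
  rw [Equiv.apply_symm_apply] at e
  -- Suppose she keeps her partner. If `b` prefers her to his partner in `N`, they block `N`;
  -- otherwise she is that partner, so `b` has not moved.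
  rcases hle.lt_or_eq with hlt | heq
  · refine N.2 b g ⟨hlt, ?_⟩
    rw [(Equiv.symm_apply_eq N.1).2 e]
    exact hg.1
  · have h1 := boyRank_inj A heq
    have : M.1.symm g = b := N.1.injective (by rw [← e, h1])
    exact hb (by rw [← this, Equiv.apply_symm_apply, ← e])

/-- By `move_step`, a boy who moves makes the next boy move, and so the motion runs round the whole
rotation. -/
theorem exposed_move {N Q : StableMatching A} (hNQ : N ≤ Q) {ρ : Cycle (Fin n × Fin n)}
    (hρ : IsExposed A N.1 ρ) {p : Fin n × Fin n} (hp : p ∈ ρ) (hne : N.1 p.1 ≠ Q.1 p.1) :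
    ∀ q ∈ ρ, ∃ g, IsFirstWilling A N.1 q.1 g ∧ A.boyRank q.1 g ≤ A.boyRank q.1 (Q.1 q.1) := by
  have h := forall_of_chain (P := fun q => N.1 q.1 ≠ Q.1 q.1) hρ.2.2.2 ?_ hp hne
  · intro q hq
    obtain ⟨g, h1, h2, -⟩ := move_step hNQ (h q hq)
    exact ⟨g, h1, h2⟩
  · intro a _ b _ hab ha
    obtain ⟨g, h1, -, h3⟩ := move_step hNQ ha
    have := h1.unique hab
    subst this
    simpa using h3

/-- If one boy of a rotation is strictly below his pair in a stable matching, then all boys of the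
rotation are at least as far down as after its elimination. -/
theorem exposed_beyond {N M : StableMatching A} {ρ : Cycle (Fin n × Fin n)}
    (hρ : IsExposed A N.1 ρ) {p : Fin n × Fin n} (hp : p ∈ ρ)
    (hlt : A.boyRank p.1 p.2 < A.boyRank p.1 (M.1 p.1)) {q : Fin n × Fin n} (hq : q ∈ ρ) {g : Fin n}
    (hg : IsFirstWilling A N.1 q.1 g) : A.boyRank q.1 g ≤ A.boyRank q.1 (M.1 q.1) := by
  -- The matchings `M` and `N` need not be comparable, so `M ⊔ N` replaces `M`; the boy of `p` moves
  -- there because `M` has him strictly lower.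
  have hle : N ≤ M ⊔ N := le_sup_right
  rw [← hρ.2.2.1 p hp] at hlt
  obtain ⟨g', h1, h2⟩ := exposed_move hle hρ hp (fun e => by
    have := rank_sup M N p.1
    rw [← e, max_eq_left hlt.le] at this
    exact hlt.ne this) q hq
  rw [hg.unique h1]
  rw [rank_sup] at h2
  rcases le_max_iff.1 h2 with h | h
  · exact h
  · exact absurd h (not_le.2 h1.lt)

theorem IsExposed.pair_eq {N : Equiv.Perm (Fin n)} {ρ : Cycle (Fin n × Fin n)}
    (hρ : IsExposed A N ρ) {p q : Fin n × Fin n} (hp : p ∈ ρ) (hq : q ∈ ρ) (h : p.1 = q.1) :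
    p = q :=
  Prod.ext h (by rw [← hρ.2.2.1 p hp, ← hρ.2.2.1 q hq, h])

/-- Every boy of the cycle has a predecessor, so the shifted assignment is onto, and every girl
weakly gains by it. A blocking pair would therefore either offer a boy of `ρ` a willing girl before
his first one, or already block `N`. -/
theorem exists_elimination (N : StableMatching A) (ρ : Rotation A) (hρ : IsExposed A N.1 ρ.1) :
    ∃ N', IsElimination N ρ N' := by
  classical
  have hsucc : ∀ b, (∃ p ∈ ρ.1, p.1 = b) → ∃ g, IsFirstWilling A N.1 b g := by
    rintro _ ⟨p, hp, rfl⟩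
    obtain ⟨q, -, hq⟩ := exists_succ_of_chain hρ.2.2.2 hp
    exact ⟨_, hq⟩
  let f : Fin n → Fin n := fun b =>
    if h : ∃ p ∈ ρ.1, p.1 = b then (hsucc b h).choose else N.1 b
  have hf1 : ∀ b, (∃ p ∈ ρ.1, p.1 = b) → IsFirstWilling A N.1 b (f b) := by
    intro b hb
    simp only [f, dif_pos hb]
    exact (hsucc b hb).choose_spec
  have hf2 : ∀ b, (¬ ∃ p ∈ ρ.1, p.1 = b) → f b = N.1 b := fun b hb => dif_neg hb
  have hsurj : Function.Surjective f := by
    intro g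
    obtain ⟨c, rfl⟩ := N.1.surjective g
    by_cases hc : ∃ p ∈ ρ.1, p.1 = c
    · obtain ⟨p, hp, rfl⟩ := hc
      obtain ⟨q, hq, hqp⟩ := exists_pred_of_chain hρ.2.2.2 hp
      exact ⟨q.1, (hf1 q.1 ⟨q, hq, rfl⟩).unique hqp⟩
    · exact ⟨c, hf2 c hc⟩
  let F : Equiv.Perm (Fin n) := Equiv.ofBijective f (Finite.surjective_iff_bijective.1 hsurj)
  have hgirl : ∀ g, A.girlRank g (F.symm g) ≤ A.girlRank g (N.1.symm g) := by
    intro g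
    obtain ⟨c, hc⟩ := F.surjective g
    rw [← hc, Equiv.symm_apply_apply]
    by_cases hcρ : ∃ p ∈ ρ.1, p.1 = c
    · exact (hf1 c hcρ).1.le
    · change A.girlRank (f c) c ≤ A.girlRank (f c) _
      rw [show F c = N.1 c from hf2 c hcρ, Equiv.symm_apply_apply, hf2 c hcρ]
  have hstab : IsStable A F := by
    rintro b g ⟨h1, h2⟩
    have h3 := h2.trans_le (hgirl g)
    by_cases hb : ∃ p ∈ ρ.1, p.1 = b
    · exact absurd ((hf1 b hb).2 g h3) (not_le.2 h1)
    · refine N.2 b g ⟨?_, h3⟩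
      rw [← hf2 b hb]
      exact h1
  exact ⟨⟨F, hstab⟩, hρ, fun p hp => hf1 p.1 ⟨p, hp, rfl⟩,
    fun b hb => hf2 b fun ⟨p, hp, h⟩ => hb p hp h⟩

theorem IsElimination.le {M M' : StableMatching A} {ρ : Rotation A} (h : IsElimination M ρ M') :
    M ≤ M' := by
  intro b
  by_cases hb : ∃ p ∈ ρ.1, p.1 = b
  · obtain ⟨p, hp, rfl⟩ := hb
    exact (h.2.1 p hp).lt.le
  · rw [h.2.2 b fun p hp e => hb ⟨p, hp, e⟩]

theorem Rotation.exists_mem (ρ : Rotation A) : ∃ p, p ∈ ρ.1 := by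
  obtain ⟨ρ, M, h, -⟩ := ρ
  induction ρ using Cycle.induction_on with
  | nil => exact absurd rfl h
  | cons a l _ => exact ⟨a, by simp⟩

theorem IsElimination.lt {M M' : StableMatching A} {ρ : Rotation A} (h : IsElimination M ρ M') :
    M < M' := by
  refine lt_of_le_of_ne h.le fun e => ?_
  subst e
  obtain ⟨p, hp⟩ := ρ.exists_mem
  exact lt_irrefl _ (h.2.1 p hp).lt

/-- The boys who change partners between `M` and `N` are closed under passing to the next boy.
Iterating on this finite set becomes periodic, and the periodic orbit is an exposed rotation. Its
elimination does not overtake `N`, where each of these boys is at or beyond his first willing girl.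
-/
theorem exists_exposed_of_lt {M N : StableMatching A} (h : M < N) :
    ∃ (ρ : Rotation A) (M' : StableMatching A), IsElimination M ρ M' ∧ M' ≤ N := by
  classical
  have hstep : ∀ b, M.1 b ≠ N.1 b → ∃ b', IsNext A M.1 b b' ∧ M.1 b' ≠ N.1 b' := by
    intro b hb
    obtain ⟨g, h1, -, h3⟩ := move_step h.le hb
    exact ⟨M.1.symm g, by simpa [IsNext] using h1, h3⟩
  choose! f hf1 hf2 using hstep
  obtain ⟨b₀, hb₀⟩ : ∃ b, M.1 b ≠ N.1 b := by
    by_contra hcon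
    push Not at hcon
    exact h.ne (Subtype.ext (Equiv.ext hcon))
  let F : Fin n × Fin n → Fin n × Fin n := fun p => (f p.1, M.1 (f p.1))
  have hF : ∀ k, (fun p : Fin n × Fin n => M.1 p.1 = p.2 ∧ M.1 p.1 ≠ N.1 p.1)
      (F^[k] (b₀, M.1 b₀)) := by
    intro k
    induction k with
    | zero => exact ⟨rfl, hb₀⟩
    | succ k ih =>
      rw [Function.iterate_succ_apply']
      exact ⟨rfl, hf2 _ ih.2⟩
  obtain ⟨i, j, hij, he⟩ : ∃ i j, i < j ∧ F^[i] (b₀, M.1 b₀) = F^[j] (b₀, M.1 b₀) := by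
    have := not_injective_infinite_finite fun k => F^[k] (b₀, M.1 b₀)
    simp only [Function.Injective, not_forall] at this
    obtain ⟨i, j, h1, h2⟩ := this
    rcases lt_or_gt_of_ne h2 with h | h
    · exact ⟨i, j, h, h1⟩
    · exact ⟨j, i, h, h1.symm⟩
  set x := F^[i] (b₀, M.1 b₀) with hx
  have hper : x ∈ Function.periodicPts F := by
    refine ⟨j - i, by omega, ?_⟩
    rw [Function.IsPeriodicPt, Function.IsFixedPt, hx, ← Function.iterate_add_apply,
      Nat.sub_add_cancel hij.le, ← he]
  have hmem : ∀ p ∈ Function.periodicOrbit F x, M.1 p.1 = p.2 ∧ M.1 p.1 ≠ N.1 p.1 := by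
    intro p hp
    obtain ⟨k, rfl⟩ := (Function.mem_periodicOrbit_iff hper).1 hp
    rw [hx, ← Function.iterate_add_apply]
    exact hF _
  have hexp : IsExposed A M.1 (Function.periodicOrbit F x) := by
    refine ⟨fun e => ?_, Function.nodup_periodicOrbit, fun p hp => (hmem p hp).1, ?_⟩
    · have := Function.self_mem_periodicOrbit hper
      rw [e] at this
      simp at this
    · rw [Function.periodicOrbit_chain]
      intro k _
      rw [Function.iterate_succ_apply', hx, ← Function.iterate_add_apply]
      exact hf1 _ (hF _).2
  obtain ⟨M', hM'⟩ := exists_elimination M ⟨_, M, hexp⟩ hexp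
  refine ⟨_, M', hM', fun b => ?_⟩
  by_cases hb : ∃ p ∈ Function.periodicOrbit F x, p.1 = b
  · obtain ⟨p, hp, rfl⟩ := hb
    obtain ⟨g, h1, h2⟩ := exposed_move h.le hexp hp (hmem p hp).2 p hp
    rw [(hM'.2.1 p hp).unique h1]
    exact h2
  · rw [hM'.2.2 b fun p hp e => hb ⟨p, hp, e⟩]
    exact h.le b

theorem exists_elimSeq {M N : StableMatching A} (h : M ≤ N) : ∃ l, ElimSeq M l N := by
  induction M using WellFoundedGT.induction with
  | ind M ih =>
    rcases h.lt_or_eq with h | rfl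
    · obtain ⟨ρ, M', h1, h2⟩ := exists_exposed_of_lt h
      obtain ⟨l, hl⟩ := ih M' h1.lt h2
      exact ⟨ρ :: l, .cons h1 hl⟩
    · exact ⟨[], .nil M⟩

theorem ElimSeq.le {M N : StableMatching A} {l : List (Rotation A)} (h : ElimSeq M l N) :
    M ≤ N := by
  induction h with
  | nil M => exact le_rfl
  | cons h1 _ ih => exact h1.le.trans ih

/-! ### The rotations of a stable matching -/

/-- The rotations whose elimination leads to `M`: all their boys are strictly below their pairs. -/
def rotSet (M : StableMatching A) : Set (Rotation A) :=
  {ρ | ∀ p ∈ ρ.1, A.boyRank p.1 p.2 < A.boyRank p.1 (M.1 p.1)}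

/-- A single boy below his pair suffices, since `exposed_beyond` carries all boys of the rotation
along. -/
theorem mem_rotSet_iff {M : StableMatching A} {ρ : Rotation A} {p : Fin n × Fin n}
    (hp : p ∈ ρ.1) : ρ ∈ rotSet M ↔ A.boyRank p.1 p.2 < A.boyRank p.1 (M.1 p.1) := by
  refine ⟨fun h => h p hp, fun h q hq => ?_⟩
  obtain ⟨N, hN⟩ := ρ.2
  obtain ⟨r, -, hr⟩ := exists_succ_of_chain hN.2.2.2 hq
  refine lt_of_lt_of_le ?_ (exposed_beyond hN hp h hq hr)
  rw [← hN.2.2.1 q hq]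
  exact IsFirstWilling.lt hr

theorem notMem_rotSet_of_exposed {M : StableMatching A} {ρ : Rotation A}
    (h : IsExposed A M.1 ρ.1) : ρ ∉ rotSet M := by
  obtain ⟨p, hp⟩ := ρ.exists_mem
  rw [mem_rotSet_iff hp, h.2.2.1 p hp]
  exact lt_irrefl _

theorem rotSet_mono {M N : StableMatching A} (h : M ≤ N) : rotSet M ⊆ rotSet N :=
  fun _ hρ p hp => (hρ p hp).trans_le (h p.1)

theorem IsElimination.mem_rotSet {M M' : StableMatching A} {ρ : Rotation A}
    (h : IsElimination M ρ M') : ρ ∈ rotSet M' := by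
  intro p hp
  rw [← h.1.2.2.1 p hp]
  exact (h.2.1 p hp).lt

theorem rotSet_sup (M N : StableMatching A) : rotSet (M ⊔ N) = rotSet M ∪ rotSet N := by
  ext ρ
  obtain ⟨p, hp⟩ := ρ.exists_mem
  rw [Set.mem_union, mem_rotSet_iff hp, mem_rotSet_iff hp, mem_rotSet_iff hp, rank_sup, lt_max_iff]

theorem rotSet_inf (M N : StableMatching A) : rotSet (M ⊓ N) = rotSet M ∩ rotSet N := by
  ext ρ
  obtain ⟨p, hp⟩ := ρ.exists_mem
  rw [Set.mem_inter_iff, mem_rotSet_iff hp, mem_rotSet_iff hp, mem_rotSet_iff hp, rank_inf,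
    lt_min_iff]

/-- If `M ≤ N` fails, some rotation exposed in `N` is eliminated on the way to `M ⊔ N`. It lies in
`rotSet M ∪ rotSet N = rotSet N`, which is impossible for an exposed rotation. -/
theorem rotSet_subset_iff {M N : StableMatching A} : rotSet M ⊆ rotSet N ↔ M ≤ N := by
  refine ⟨fun h => ?_, rotSet_mono⟩
  by_contra hle
  have hlt : N < M ⊔ N := lt_of_le_of_ne le_sup_right fun e => hle (e ▸ le_sup_left)
  obtain ⟨ρ, N', h1, h2⟩ := exists_exposed_of_lt hlt
  have h3 := rotSet_mono h2 h1.mem_rotSet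
  rw [rotSet_sup, Set.union_eq_self_of_subset_left h] at h3
  exact notMem_rotSet_of_exposed h1.1 h3

theorem rotSet_injective {M N : StableMatching A} (h : rotSet M = rotSet N) : M = N :=
  le_antisymm (rotSet_subset_iff.1 h.subset) (rotSet_subset_iff.1 h.superset)

/-- The only rotation that an elimination adds is the eliminated one. -/
theorem IsElimination.eq_of_mem {M M' : StableMatching A} {π ρ : Rotation A}
    (h : IsElimination M π M') (h1 : ρ ∉ rotSet M) (h2 : ρ ∈ rotSet M') : ρ = π := by
  obtain ⟨N, hN⟩ := ρ.2
  have hle : ∀ p ∈ ρ.1, A.boyRank p.1 (M.1 p.1) ≤ A.boyRank p.1 p.2 := fun p hp =>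
    not_lt.1 ((mem_rotSet_iff hp).not.1 h1)
  have hπ : ∀ p ∈ ρ.1, ∃ q ∈ π.1, q.1 = p.1 := by
    intro p hp
    by_contra hcon
    have h3 := h2 p hp
    rw [h.2.2 p.1 fun q hq e => hcon ⟨q, hq, e⟩] at h3
    exact absurd (hle p hp) (not_le.2 h3)
  -- Were `N` past `π`, a boy of `ρ` would be at least as low in `N` as in `M'`; but `M'` is past
  -- `ρ` and `N` is not.
  have hnot : π ∉ rotSet N := by
    intro hcon
    obtain ⟨p, hp⟩ := ρ.exists_mem
    obtain ⟨q, hq, hqp⟩ := hπ p hp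
    have h3 := exposed_beyond h.1 hq (hcon q hq) hq (h.2.1 q hq)
    rw [hqp, hN.2.2.1 p hp] at h3
    exact absurd h3 (not_le.2 (h2 p hp))
  -- A squeeze: `M` is not past the pairs of `ρ`, held by `N`, and `N` is not past the pairs of `π`,
  -- held by `M`.
  have hMN : ∀ p ∈ ρ.1, M.1 p.1 = p.2 := by
    intro p hp
    obtain ⟨q, hq, hqp⟩ := hπ p hp
    have h3 := not_lt.1 ((mem_rotSet_iff hq).not.1 hnot)
    rw [← h.1.2.2.1 q hq, hqp, hN.2.2.1 p hp] at h3
    exact boyRank_inj A (le_antisymm (hle p hp) h3)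
  -- In both matchings the first willing girl of a boy of `ρ` turns out to be his partner in `M'`.
  have hnext : ∀ p ∈ ρ.1, ∀ q ∈ ρ.1, IsNext A N.1 p.1 q.1 → IsNext A M.1 p.1 q.1 := by
    intro p hp q hq hpq
    obtain ⟨r, hr, hrp⟩ := hπ p hp
    have hf := h.2.1 r hr
    rw [hrp] at hf
    have hw : A.girlRank q.2 p.1 < A.girlRank q.2 q.1 := by
      have h4 := hpq.1
      rwa [Equiv.symm_apply_apply, hN.2.2.1 q hq] at h4
    have h5 : A.boyRank p.1 (M'.1 p.1) ≤ A.boyRank p.1 q.2 := by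
      refine hf.2 _ ?_
      rwa [(Equiv.symm_apply_eq M.1).2 (hMN q hq).symm]
    have h6 : A.boyRank p.1 q.2 ≤ A.boyRank p.1 (M'.1 p.1) := by
      rw [← hN.2.2.1 q hq]
      exact exposed_beyond hN hp (h2 p hp) hp hpq
    rw [boyRank_inj A (le_antisymm h5 h6), ← hMN q hq] at hf
    exact hf
  obtain ⟨p, hp⟩ := ρ.exists_mem
  obtain ⟨q, hq, hqp⟩ := hπ p hp
  have hpq : p ∈ π.1 := by
    have : q = p := Prod.ext hqp (by rw [← h.1.2.2.1 q hq, ← hMN p hp, hqp])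
    rwa [this] at hq
  classical
  -- The next-pair function of `M`. Both rotations are chains for it and share the pair `p`, so they
  -- are equal.
  let f : Fin n × Fin n → Fin n × Fin n := fun a =>
    if h : ∃ b : Fin n, IsNext A M.1 a.1 b then (h.choose, M.1 h.choose) else a
  have hf : ∀ a b : Fin n × Fin n, IsNext A M.1 a.1 b.1 → M.1 b.1 = b.2 → f a = b := by
    intro a b hab hb
    have hex : ∃ b : Fin n, IsNext A M.1 a.1 b := ⟨_, hab⟩
    have : hex.choose = b.1 := M.1.injective (IsFirstWilling.unique hex.choose_spec hab)
    simp only [f, dif_pos hex, this, hb]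
  refine Subtype.ext (cycle_ext_of_chain (f := f) ?_ ?_ hN.2.1 h.1.2.1 hp hpq)
  · refine chain_imp hN.2.2.2 fun a ha b hb hab => ?_
    exact hf a b (hnext a ha b hb hab) (hMN b hb)
  · refine chain_imp h.1.2.2.2 fun a ha b hb hab => ?_
    exact hf a b hab (h.1.2.2.1 b hb)

theorem ElimSeq.mem_iff {M N : StableMatching A} {l : List (Rotation A)} (h : ElimSeq M l N)
    (ρ : Rotation A) : ρ ∈ rotSet N ↔ ρ ∈ rotSet M ∨ ρ ∈ l := by
  induction h with
  | nil M => simp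
  | @cons M M₁ M' π l h1 h2 ih =>
    rw [ih, List.mem_cons, ← or_assoc]
    refine or_congr ⟨fun h => ?_, ?_⟩ Iff.rfl
    · by_cases h3 : ρ ∈ rotSet M
      · exact Or.inl h3
      · exact Or.inr (h1.eq_of_mem h3 h)
    · rintro (h | rfl)
      · exact rotSet_mono h1.le h
      · exact h1.mem_rotSet

theorem ElimSeq.nodup {M N : StableMatching A} {l : List (Rotation A)} (h : ElimSeq M l N) :
    l.Nodup ∧ ∀ ρ ∈ l, ρ ∉ rotSet M := by
  induction h with
  | nil M => simp
  | @cons M M₁ M' π l h1 h2 ih =>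
    refine ⟨List.nodup_cons.2 ⟨fun h => ih.2 _ h h1.mem_rotSet, ih.1⟩, fun ρ hρ => ?_⟩
    rcases List.mem_cons.1 hρ with rfl | hρ
    · exact notMem_rotSet_of_exposed h1.1
    · exact fun h => ih.2 _ hρ (rotSet_mono h1.le h)

/-- Each rotation is exposed in some `N`, which is then not past it; still less is the bottom `M₀ ≤
N`. -/
theorem rotSet_bot {M₀ : StableMatching A} (h : IsBot M₀) : rotSet M₀ = ∅ := by
  ext ρ
  simp only [Set.mem_empty_iff_false, iff_false]
  intro hρ
  obtain ⟨N, hN⟩ := ρ.2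
  exact notMem_rotSet_of_exposed hN (rotSet_mono (h N) hρ)

theorem exists_isBot (M : StableMatching A) : ∃ M₀ : StableMatching A, IsBot M₀ := by
  obtain ⟨M₀, -, h⟩ := WellFounded.has_min (wellFounded_lt (α := StableMatching A)) Set.univ
    ⟨M, trivial⟩
  refine ⟨M₀, fun N => ?_⟩
  have h1 : M₀ ⊓ N = M₀ := eq_of_le_of_not_lt inf_le_left (h _ trivial)
  exact h1 ▸ inf_le_right

theorem generatesMatching_rotSet (M : StableMatching A) : GeneratesMatching (rotSet M) M := by
  obtain ⟨M₀, h0⟩ := exists_isBot M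
  obtain ⟨l, hl⟩ := exists_elimSeq (h0 M)
  refine ⟨M₀, l, h0, hl.nodup.1, fun ρ => ?_, hl⟩
  rw [hl.mem_iff, rotSet_bot h0]
  simp

/-- A sequence of eliminations leading to `M` is cut just before `ρ`; its first part already
contains `ρ'`. -/
theorem Precedes.mem_rotSet {ρ' ρ : Rotation A} (h : Precedes ρ' ρ) {M : StableMatching A}
    (hM : ρ ∈ rotSet M) : ρ' ∈ rotSet M := by
  obtain ⟨M₀, h0⟩ := exists_isBot M
  obtain ⟨l, hl⟩ := exists_elimSeq (h0 M)
  have hsplit : ∀ {N l M}, ElimSeq N l M → (ρ : Rotation A) ∈ l → ∃ l₁ N' l₂, ElimSeq N l₁ N' ∧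
      IsExposed A N'.1 ρ.1 ∧ ElimSeq N' l₂ M := by
    intro N l M h
    induction h with
    | nil M => simp
    | @cons M M₁ M' π l h1 h2 ih =>
      intro hρ
      rcases List.mem_cons.1 hρ with rfl | hρ
      · exact ⟨[], M, _, .nil M, h1.1, .cons h1 h2⟩
      · obtain ⟨l₁, N', l₂, a, b, c⟩ := ih hρ
        exact ⟨π :: l₁, N', l₂, .cons h1 a, b, c⟩
  obtain ⟨l₁, N', l₂, a, b, c⟩ := hsplit hl
    (((hl.mem_iff ρ).1 hM).resolve_left (by simp [rotSet_bot h0]))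
  exact rotSet_mono c.le ((a.mem_iff ρ').2 (Or.inr (h M₀ N' l₁ h0 a b)))


variable {n : ℕ} {A : Inst n}

/-! ### Fully robust matchings form a sublattice -/

/-- Bijectivity forces the remaining value. This is why an error in the list of one boy does not
affect meets and joins. -/
theorem perm_eq_of_forall_ne {α : Type*} {σ τ : Equiv.Perm α} {a : α}
    (h : ∀ b, b ≠ a → σ b = τ b) : σ = τ := by
  have key : σ a = τ a := by
    obtain ⟨c, hc⟩ := τ.surjective (σ a)
    by_cases hca : c = a
    · rw [← hc, hca]
    · exact absurd (σ.injective ((h c hca).trans hc)) hca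
  exact Equiv.ext fun b => (eq_or_ne b a).elim (fun e => e ▸ key) (h b)

theorem perturb_boy_rank {b c : Fin n} (l : Equiv.Perm (Fin n)) (h : c ≠ b) (g : Fin n) :
    (A.perturb (.boy b l)).boyRank c g = A.boyRank c g := by
  simp [Inst.boyRank, Inst.perturb, Function.update_of_ne h]

/-- The meet is defined by the boys' lists, of which an error changes at most one. The meets in `A`
and in the perturbed instance thus agree for all boys but one, hence for all. -/
theorem stable_inf_perturb (e : Perturbation n) {M N : StableMatching A}
    (hM : IsStable (A.perturb e) M.1) (hN : IsStable (A.perturb e) N.1) :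
    IsStable (A.perturb e) (M ⊓ N).1 := by
  have h : (M ⊓ N).1 = meetPerm (A := A.perturb e) ⟨M.1, hM⟩ ⟨N.1, hN⟩ := by
    cases e with
    | girl g l => rfl
    | boy b l =>
      refine perm_eq_of_forall_ne (a := b) fun c hc => ?_
      change better A M.1 N.1 c = better (A.perturb (.boy b l)) M.1 N.1 c
      simp only [better, perturb_boy_rank l hc]
  rw [h]
  exact meet_stable (A := A.perturb e) ⟨M.1, hM⟩ ⟨N.1, hN⟩

theorem stable_sup_perturb (e : Perturbation n) {M N : StableMatching A}
    (hM : IsStable (A.perturb e) M.1) (hN : IsStable (A.perturb e) N.1) :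
    IsStable (A.perturb e) (M ⊔ N).1 := by
  have h : (M ⊔ N).1 = joinPerm (A := A.perturb e) ⟨M.1, hM⟩ ⟨N.1, hN⟩ := by
    cases e with
    | girl g l => rfl
    | boy b l =>
      refine perm_eq_of_forall_ne (a := b) fun c hc => ?_
      change worse A M.1 N.1 c = worse (A.perturb (.boy b l)) M.1 N.1 c
      simp only [worse, perturb_boy_rank l hc]
  rw [h]
  exact join_stable (A := A.perturb e) ⟨M.1, hM⟩ ⟨N.1, hN⟩

theorem isSublattice_fullyRobust (A : Inst n) (S : List (Perturbation n)) :
    SupClosed (fullyRobustSet A S) ∧ InfClosed (fullyRobustSet A S) :=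
  ⟨fun M hM N hN => ⟨(M ⊔ N).2, fun e he => stable_sup_perturb e (hM.2 e he) (hN.2 e he)⟩,
    fun M hM N hN => ⟨(M ⊓ N).2, fun e he => stable_inf_perturb e (hM.2 e he) (hN.2 e he)⟩⟩

/-! ### Sublattices and implications between elements of the rotation poset -/

/-- The element `x` of the rotation poset belongs to the closed set of `M`. -/
def RotElem.Holds : RotElem A → StableMatching A → Prop
  | .s, _ => True
  | .t, _ => False
  | .rot ρ, M => ρ ∈ rotSet M

theorem RotElem.Holds.mono {x : RotElem A} {M N : StableMatching A} (h : x.Holds M)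
    (hMN : M ≤ N) : x.Holds N := by
  cases x with
  | s => trivial
  | t => exact h
  | rot ρ => exact rotSet_mono hMN h

theorem RotElem.holds_inf {x : RotElem A} {M N : StableMatching A} :
    x.Holds (M ⊓ N) ↔ x.Holds M ∧ x.Holds N := by
  cases x <;> simp [Holds, rotSet_inf]

theorem RotElem.holds_sup {x : RotElem A} {M N : StableMatching A} :
    x.Holds (M ⊔ N) ↔ x.Holds M ∨ x.Holds N := by
  cases x <;> simp [Holds, rotSet_sup]

/-- Every matching of `X` whose closed set contains `x` has a closed set that contains `y`. -/
def Implies (X : Set (StableMatching A)) (x y : RotElem A) : Prop :=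
  ∀ M ∈ X, x.Holds M → y.Holds M

theorem implies_of_le {X : Set (StableMatching A)} {x y : RotElem A} (h : x.le y) :
    Implies X y x := by
  intro M _ hy
  cases x <;> cases y <;> simp only [RotElem.le, RotElem.Holds] at *
  rcases h with rfl | h
  · exact hy
  · exact h.mem_rotSet hy

/-- A set that is closed under the implications of a sublattice is the closed set of a member. -/
theorem exists_of_closed {X : Set (StableMatching A)} (hsup : SupClosed X) (hinf : InfClosed X)
    {J : Set (RotElem A)} (hs : .s ∈ J) (ht : .t ∉ J)
    (hJ : ∀ x ∈ J, ∀ y, Implies X x y → y ∈ J) : ∃ M ∈ X, ∀ x, x ∈ J ↔ x.Holds M := by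
  -- If `x` held in no member of `X`, it would vacuously imply `t`. A minimal member in which `x`
  -- holds is least, by closure under meets.
  have hleast : ∀ x ∈ J, ∃ m ∈ X, x.Holds m ∧ ∀ M ∈ X, x.Holds M → m ≤ M := by
    intro x hx
    have hne : {M | M ∈ X ∧ x.Holds M}.Nonempty := by
      by_contra hcon
      rw [Set.not_nonempty_iff_eq_empty] at hcon
      refine ht (hJ x hx _ fun M hM h => ?_)
      have : M ∈ {M | M ∈ X ∧ x.Holds M} := ⟨hM, h⟩
      rw [hcon] at this
      exact this
    obtain ⟨m, ⟨hm1, hm2⟩, h⟩ := WellFounded.has_min (wellFounded_lt (α := StableMatching A)) _ hne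
    refine ⟨m, hm1, hm2, fun M hM hx => ?_⟩
    have h1 : m ⊓ M = m := eq_of_le_of_not_lt inf_le_left
      (h _ ⟨hinf hm1 hM, RotElem.holds_inf.2 ⟨hm2, hx⟩⟩)
    exact h1 ▸ inf_le_right
  have hsub : ∀ x ∈ J, ∀ m, x.Holds m → (∀ M ∈ X, x.Holds M → m ≤ M) → ∀ y, y.Holds m → y ∈ J :=
    fun x hx m _ hmin y hy => hJ x hx y fun M hM hxM => hy.mono (hmin M hM hxM)
  obtain ⟨m₀, hm₀, hm₁, hm₂⟩ := hleast _ hs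
  -- A maximal member with closed set inside `J` absorbs, through joins, the least member of every
  -- `x ∈ J`.
  obtain ⟨M, ⟨hM, hMJ⟩, hmax⟩ := WellFounded.has_min (wellFounded_gt (α := StableMatching A))
    {M | M ∈ X ∧ ∀ y : RotElem A, y.Holds M → y ∈ J} ⟨m₀, hm₀, hsub _ hs m₀ hm₁ hm₂⟩
  refine ⟨M, hM, fun x => ⟨fun hx => ?_, hMJ x⟩⟩
  obtain ⟨m, hm, hxm, hmin⟩ := hleast x hx
  have h1 : M = M ⊔ m := eq_of_le_of_not_lt le_sup_left (hmax _ ⟨hsup hM hm, fun y hy =>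
    (RotElem.holds_sup.1 hy).elim (hMJ y) (hsub x hx m hxm hmin y)⟩)
  rw [h1]
  exact RotElem.holds_sup.2 (Or.inr hxm)

/-- The compression whose order is the reverse of the implications of `X`. -/
@[reducible] def Compression.ofImplies (X : Set (StableMatching A)) {m : ℕ}
    (cls : RotElem A → Fin m)
    (hcls : Function.Surjective cls) (le : Fin m → Fin m → Prop)
    (hle : ∀ x y, le (cls x) (cls y) ↔ Implies X y x)
    (heq : ∀ x y, Implies X x y → Implies X y x → cls x = cls y) : Compression A where
  m := m
  cls := cls
  cls_surjective := hcls
  le := le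
  le_refl i := by
    obtain ⟨x, rfl⟩ := hcls i
    exact (hle x x).2 fun _ _ h => h
  le_trans i j k h h' := by
    obtain ⟨x, rfl⟩ := hcls i
    obtain ⟨y, rfl⟩ := hcls j
    obtain ⟨z, rfl⟩ := hcls k
    exact (hle _ _).2 fun M hM hz => (hle _ _).1 h M hM ((hle _ _).1 h' M hM hz)
  le_antisymm i j h h' := by
    obtain ⟨x, rfl⟩ := hcls i
    obtain ⟨y, rfl⟩ := hcls j
    exact heq x y ((hle _ _).1 h') ((hle _ _).1 h)
  le_of_le x y h := (hle x y).2 (implies_of_le h)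

/-- A member of `X` is sent to the meta-elements that hold in it. This is an order embedding because
`rotSet` is one, and it is onto by `exists_of_closed`. -/
theorem Compression.generates_ofImplies {X : Set (StableMatching A)} (hsup : SupClosed X)
    (hinf : InfClosed X) {m : ℕ} (cls : RotElem A → Fin m)
    (hcls : Function.Surjective cls) (le : Fin m → Fin m → Prop)
    (hle : ∀ x y, le (cls x) (cls y) ↔ Implies X y x)
    (heq : ∀ x y, Implies X x y → Implies X y x → cls x = cls y) :
    (Compression.ofImplies X cls hcls le hle heq).Generates X := by
  set C := Compression.ofImplies X cls hcls le hle heq with hC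
  have hmem : ∀ (M : X) (x : RotElem A), (∃ y, cls y = cls x ∧ y.Holds M.1) ↔ x.Holds M.1 := by
    refine fun M x => ⟨?_, fun h => ⟨x, rfl, h⟩⟩
    rintro ⟨y, hyx, hy⟩
    refine (hle x y).1 ?_ M.1 M.2 hy
    rw [hyx]
    exact C.le_refl _
  let ψ : X → C.ProperClosed := fun M => ⟨{i | ∃ y, cls y = i ∧ y.Holds M.1}, by
    refine ⟨?_, ⟨_, rfl, trivial⟩, fun h => (hmem M .t).1 h⟩
    rintro i _ hij ⟨y, rfl, hy⟩
    obtain ⟨x, rfl⟩ := hcls i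
    exact ⟨x, rfl, (hle x y).1 hij M.1 M.2 hy⟩⟩
  have hψ : ∀ M N, ψ M ≤ ψ N ↔ M ≤ N := by
    intro M N
    refine ⟨fun h => rotSet_subset_iff.1 fun ρ hρ => ?_, fun h => ?_⟩
    · exact (hmem N (.rot ρ)).1 (h ((hmem M (.rot ρ)).2 hρ))
    · rintro _ ⟨y, rfl, hy⟩
      exact ⟨y, rfl, hy.mono h⟩
  have hsurj : Function.Surjective ψ := by
    rintro ⟨I, hI1, hI2, hI3⟩
    obtain ⟨M, hM, hMJ⟩ := exists_of_closed hsup hinf (J := {x | cls x ∈ I}) hI2 hI3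
      fun x hx y hxy => hI1 _ _ ((hle y x).2 hxy) hx
    refine ⟨⟨M, hM⟩, Subtype.ext (Set.ext fun i => ?_)⟩
    obtain ⟨x, rfl⟩ := hcls i
    exact (hmem ⟨M, hM⟩ x).trans (hMJ x).symm
  refine ⟨(RelIso.ofSurjective (OrderEmbedding.ofMapLEIff ψ hψ) hsurj).symm, fun I => ?_⟩
  obtain ⟨M, rfl⟩ := hsurj I
  have h1 : (RelIso.ofSurjective (OrderEmbedding.ofMapLEIff ψ hψ) hsurj).symm (ψ M) = M :=
    (RelIso.ofSurjective (OrderEmbedding.ofMapLEIff ψ hψ) hsurj).symm_apply_apply M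
  rw [h1]
  have h2 : C.rot (ψ M).1 = rotSet M.1 := Set.ext fun ρ => hmem M (.rot ρ)
  rw [h2]
  exact generatesMatching_rotSet M.1


/-! ### Fixed points of inflationary maps on Boolean functions -/

/-- A round that changes anything makes a further entry true, which can happen at most `L.length`
times. -/
theorem iterate_fixed {V : Type} {L : List V} (hL : ∀ v, v ∈ L) {f : (V → Bool) → V → Bool}
    (hf : ∀ T v, T v = true → f T v = true) (T : V → Bool) :
    f (f^[L.length] T) = f^[L.length] T := by
  classical
  have hlt : ∀ T : V → Bool, f T ≠ T → L.countP T < L.countP (f T) := by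
    intro T hne
    obtain ⟨v, hv⟩ : ∃ v, f T v ≠ T v := by
      by_contra hcon
      push Not at hcon
      exact hne (funext hcon)
    have hv1 : T v = false := by
      by_contra h
      rw [Bool.not_eq_false] at h
      exact hv (by rw [h, hf T v h])
    have hv2 : f T v = true := by
      rw [hv1] at hv
      simpa using hv
    have key : ∀ l : List V, l.countP T + (if v ∈ l then 1 else 0) ≤ l.countP (f T) := by
      intro l
      induction l with
      | nil => simp
      | cons w l ih =>
        rw [List.countP_cons, List.countP_cons]
        have h1 := hf T w
        by_cases hvw : v = w
        · subst hvw
          simp only [hv1, hv2, List.mem_cons_self]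
          simp only [Bool.false_eq_true, if_false, if_true]
          split_ifs at ih <;> omega
        · simp only [List.mem_cons, hvw, false_or]
          split_ifs at ih ⊢ <;> simp_all <;> omega
    have := key L
    rw [if_pos (hL v)] at this
    omega
  have key : ∀ k, f (f^[k] T) = f^[k] T ∨ k + 1 ≤ L.countP (f (f^[k] T)) := by
    intro k
    induction k with
    | zero =>
      rcases eq_or_ne (f T) T with h | h
      · exact Or.inl h
      · exact Or.inr (by have := hlt T h; simp only [Function.iterate_zero, id]; omega)
    | succ k ih =>
      rw [Function.iterate_succ_apply']
      rcases ih with h | h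
      · exact Or.inl (by rw [h, h])
      · rcases eq_or_ne (f (f (f^[k] T))) (f (f^[k] T)) with h' | h'
        · exact Or.inl h'
        · exact Or.inr (by have := hlt _ h'; omega)
  refine (key L.length).resolve_right fun h => ?_
  have := List.countP_le_length (p := f (f^[L.length] T)) (l := L)
  omega

/-! ### Propositions about matchings and their closure under forced moves -/

/-- The elements between which implications are computed: `none` is always true, `some none` is
always false, and the pair `(b, g)` says that `b` is strictly below `g`. -/
abbrev Lit (n : ℕ) := Option (Option (Fin n × Fin n))

abbrev pairs (n : ℕ) : List (Fin n × Fin n) := List.finRange n ×ˢ List.finRange n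

abbrev lits (n : ℕ) : List (Lit n) := none :: (none :: (pairs n).map some).map some

theorem mem_pairs (p : Fin n × Fin n) : p ∈ pairs n :=
  List.mem_product.2 ⟨List.mem_finRange _, List.mem_finRange _⟩

theorem mem_lits (u : Lit n) : u ∈ lits n := by
  rcases u with _ | _ | p <;> simp [-List.pair_mem_product, mem_pairs]

abbrev PrefTable (n : ℕ) := Fin n → Fin n → Fin n → Bool

def isFalse (u : Lit n) : Bool := u.elim false fun w => w.elim true fun _ => false

abbrev LitTable (n : ℕ) := Lit n × Fin n × Fin n → Bool

/-- All girls that `c` prefers to `g` are excluded for `c`. -/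
def allBetter (X : PrefTable n) (T : LitTable n) (u : Lit n) (c g : Fin n) : Bool :=
  (List.finRange n).all fun g' => !X c g' g || T (u, c, g')

def isStart (X : PrefTable n) (u : Lit n) (c g : Fin n) : Bool :=
  u.elim false fun w => w.elim false fun q => decide (q.1 = c) && !X c q.2 g

/-- One round of exclusions: `g` is excluded for `c` if some `b` has no better choice than `g` and
is preferred to `c` by `g`. -/
def forceStep (X Y : PrefTable n) (T : LitTable n) : LitTable n := fun v =>
  T v || (isStart X v.1 v.2.1 v.2.2 || (allBetter X T v.1 v.2.1 v.2.2 &&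
    (List.finRange n).any fun b => !decide (b = v.2.1) && (Y v.2.2 b v.2.1 &&
      allBetter X T v.1 b v.2.2)))

/-- The entry at `(u, c, g)` stands for: in every robust matching that satisfies `u`, the agent `c`
is strictly below `g`. There are as many rounds as entries, so a fixed point is reached. -/
def forced (X Y : PrefTable n) : LitTable n :=
  (forceStep X Y)^[(lits n ×ˢ pairs n).length] fun _ => false

def isFail (T : LitTable n) (u : Lit n) : Bool :=
  (List.finRange n).any fun c => (List.finRange n).all fun g => T (u, c, g)

/-- The implication from `u` to `v`. -/
def impl (T : LitTable n) (u v : Lit n) : Bool :=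
  v.elim true fun w => isFalse u || (isFail T u || w.elim false fun q => T (u, q))

def Holds (X : PrefTable n) (M : Equiv.Perm (Fin n)) (u : Lit n) : Prop :=
  u.elim True fun w => w.elim False fun q => X q.1 q.2 (M q.1) = true

/-- Stability for arbitrary relations; `Y` will collect preferences from several lists and need not
be an order. -/
def Robust (X Y : PrefTable n) (M : Equiv.Perm (Fin n)) : Prop :=
  ∀ b g, ¬ (X b g (M b) = true ∧ Y g b (M.symm g) = true)

/-- `X` is the table of strict preferences given by ranks. -/
def IsRank (X : PrefTable n) (r : Fin n → Equiv.Perm (Fin n)) : Prop :=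
  ∀ b g h, X b g h = true ↔ r b g < r b h

section Forced

variable {X Y : PrefTable n} {r : Fin n → Equiv.Perm (Fin n)} {T : LitTable n}

theorem allBetter_iff {u : Lit n} {c g : Fin n} :
    allBetter X T u c g = true ↔ ∀ g', X c g' g = true → T (u, c, g') = true := by
  simp only [allBetter, List.all_eq_true, List.mem_finRange, true_implies, Bool.or_eq_true,
    Bool.not_eq_true', ← Bool.not_eq_true]
  exact forall_congr' fun g' => by tauto

theorem isStart_iff {u : Lit n} {c g : Fin n} :
    isStart X u c g = true ↔ ∃ h, u = some (some (c, h)) ∧ ¬ X c h g = true := by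
  rcases u with _ | _ | ⟨c', h'⟩
  · simp [isStart]
  · simp [isStart]
  · simp only [isStart, Option.elim, Bool.and_eq_true, decide_eq_true_iff, Option.some.injEq,
      Prod.mk.injEq, Bool.not_eq_true', Bool.not_eq_true]
    constructor
    · rintro ⟨rfl, h⟩; exact ⟨h', ⟨rfl, rfl⟩, h⟩
    · rintro ⟨h, ⟨rfl, rfl⟩, h1⟩; exact ⟨rfl, h1⟩

theorem forceStep_iff {u : Lit n} {c g : Fin n} :
    forceStep X Y T (u, c, g) = true ↔ T (u, c, g) = true ∨
      (∃ h, u = some (some (c, h)) ∧ ¬ X c h g = true) ∨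
      ((∀ g', X c g' g = true → T (u, c, g') = true) ∧ ∃ b, b ≠ c ∧ Y g b c = true ∧
        ∀ g', X b g' g = true → T (u, b, g') = true) := by
  simp only [forceStep, Bool.or_eq_true, Bool.and_eq_true, isStart_iff, allBetter_iff,
    List.any_eq_true, List.mem_finRange, true_and, Bool.not_eq_true', decide_eq_false_iff_not, ne_eq]

theorem forced_fixed : forceStep X Y (forced X Y) = forced X Y :=
  iterate_fixed (fun _ => List.mem_product.2 ⟨mem_lits _, mem_pairs _⟩)
    (fun _ _ h => forceStep_iff.2 (Or.inl h)) _

/-- If a round excluded the partner `g` of `c` because of `b`, then `b`, who has nothing better than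
`g` and is not matched to her, would strictly prefer her to his partner, and `(b, g)` would block.
-/
theorem forced_sound (hX : IsRank X r) {M : Equiv.Perm (Fin n)} (hM : Robust X Y M) {u : Lit n}
    (hu : Holds X M u) {c g : Fin n} (h : forced X Y (u, c, g) = true) :
    X c g (M c) = true := by
  rw [forced] at h
  generalize (lits n ×ˢ pairs n).length = k at h
  induction k generalizing c g with
  | zero => simp at h
  | succ k ih =>
    rw [Function.iterate_succ_apply', forceStep_iff] at h
    have hle : ∀ b, (∀ g', X b g' g = true →
        (forceStep X Y)^[k] (fun _ => false) (u, b, g') = true) → r b g ≤ r b (M b) := by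
      intro b hb
      by_contra hlt
      have := ih (hb (M b) ((hX _ _ _).2 (not_le.1 hlt)))
      rw [hX] at this
      exact lt_irrefl _ this
    rcases h with h | ⟨h', rfl, h2⟩ | ⟨h1, b, hbc, h2, h3⟩
    · exact ih h
    · simp only [Holds, Option.elim] at hu
      rw [hX] at hu h2 ⊢
      exact (not_lt.1 h2).trans_lt hu
    · by_contra hcon
      rw [hX] at hcon
      have hMc : M c = g := (r c).injective (le_antisymm (not_lt.1 hcon) (hle c h1))
      have hMb : r b g < r b (M b) := by
        refine lt_of_le_of_ne (hle b h3) fun e => hbc (M.injective ?_)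
        rw [← (r b).injective e, hMc]
      refine hM b g ⟨(hX _ _ _).2 hMb, ?_⟩
      rwa [← hMc, Equiv.symm_apply_apply, hMc]

/-- The excluded girls form an initial segment of the list: the starting exclusions do, and the rule
requires all better girls to be excluded already. -/
theorem forced_lower (hX : IsRank X r) {u : Lit n} {c g g' : Fin n} (hg : X c g' g = true)
    (h : forced X Y (u, c, g) = true) : forced X Y (u, c, g') = true := by
  rw [forced] at h ⊢
  generalize (lits n ×ˢ pairs n).length = k at h ⊢
  induction k generalizing c g g' with
  | zero => simp at h
  | succ k ih =>
    rw [Function.iterate_succ_apply', forceStep_iff] at h ⊢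
    rcases h with h | ⟨h', rfl, h2⟩ | ⟨h1, -⟩
    · exact Or.inl (ih hg h)
    · refine Or.inr (Or.inl ⟨h', rfl, ?_⟩)
      rw [hX] at hg h2 ⊢
      exact not_lt.2 (hg.le.trans (not_lt.1 h2))
    · exact Or.inl (h1 g' hg)

theorem isFail_iff {u : Lit n} : isFail T u = true ↔ ∃ c, ∀ g, T (u, c, g) = true := by
  simp [isFail]

/-- Unless the exclusions fail, they describe the least robust matching that satisfies `u`. -/
theorem exists_robust (hX : IsRank X r) (hY : ∀ g b c, b ≠ c → Y g b c = true ∨ Y g c b = true)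
    {u : Lit n} (hu : isFalse u ≠ true) (hf : ¬ isFail (forced X Y) u = true) :
    ∃ M, Robust X Y M ∧ Holds X M u ∧
      ∀ c g, X c g (M c) = true ↔ forced X Y (u, c, g) = true := by
  rw [isFail_iff] at hf
  push Not at hf
  have hmin : ∀ c, ∃ g, ¬ forced X Y (u, c, g) = true ∧
      ∀ g', X c g' g = true → forced X Y (u, c, g') = true := by
    intro c
    obtain ⟨g, hg, hm⟩ := Set.exists_min_image {g | ¬ forced X Y (u, c, g) = true} (r c)
      (Set.toFinite _) (hf c)
    refine ⟨g, hg, fun g' hg' => ?_⟩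
    by_contra hcon
    exact absurd (hm g' hcon) (not_le.2 ((hX _ _ _).1 hg'))
  choose f hf1 hf2 using hmin
  have hrule : ∀ {b c g : Fin n}, b ≠ c → Y g b c = true →
      (∀ g', X b g' g = true → forced X Y (u, b, g') = true) →
      (∀ g', X c g' g = true → forced X Y (u, c, g') = true) →
      forced X Y (u, c, g) = true := by
    intro b c g hbc h1 h2 h3
    rw [← forced_fixed, forceStep_iff]
    exact Or.inr (Or.inr ⟨h3, b, hbc, h1, h2⟩)
  -- If two boys shared their best remaining girl, totality of `Y` would let the rule exclude her
  -- for one of them.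
  have hinj : Function.Injective f := by
    intro b c hbc
    by_contra hne
    rcases hY (f b) b c hne with h | h
    · exact hf1 c (hbc ▸ hrule hne h (hf2 b) (hbc ▸ hf2 c))
    · exact hf1 b (hrule (Ne.symm hne) h (hbc ▸ hf2 c) (hf2 b))
  let M : Equiv.Perm (Fin n) := Equiv.ofBijective f (Finite.injective_iff_bijective.1 hinj)
  have hiff : ∀ c g, X c g (M c) = true ↔ forced X Y (u, c, g) = true := by
    refine fun c g => ⟨hf2 c g, fun h => ?_⟩
    rw [hX]
    by_contra hlt
    rcases (not_lt.1 hlt).lt_or_eq with h' | h'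
    · exact hf1 c (forced_lower hX ((hX _ _ _).2 h') h)
    · rw [← (r c).injective h'] at h
      exact hf1 c h
  refine ⟨M, ?_, ?_, hiff⟩
  · rintro b g ⟨h1, h2⟩
    obtain ⟨c, rfl⟩ := M.surjective g
    rw [Equiv.symm_apply_apply] at h2
    -- The boy `b` of a blocking pair has all girls better than `M c` excluded, so the rule would
    -- exclude `M c` for her own partner `c`.
    refine hf1 c (hrule ?_ h2 (fun g' hg' => ?_) (hf2 c))
    · rintro rfl
      rw [hX] at h1
      exact lt_irrefl _ h1
    · exact forced_lower hX hg' ((hiff _ _).1 h1)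
  · rcases u with _ | _ | ⟨c, h⟩
    · trivial
    · simp [isFalse] at hu
    · simp only [Holds, Option.elim]
      rw [hiff, ← forced_fixed, forceStep_iff]
      refine Or.inr (Or.inl ⟨h, rfl, ?_⟩)
      rw [hX]
      exact lt_irrefl _

theorem fails_sound (hX : IsRank X r) {u : Lit n} (hf : isFail (forced X Y) u = true)
    {M : Equiv.Perm (Fin n)} (hM : Robust X Y M) (hu : Holds X M u) : False := by
  obtain ⟨c, hc⟩ := isFail_iff.1 hf
  have := forced_sound hX hM hu (hc (M c))
  rw [hX] at this
  exact lt_irrefl _ this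

/-- Completeness comes from the least matching of `exists_robust`, in which a pair proposition holds
only if it is forced. -/
theorem impl_iff (hX : IsRank X r) (hY : ∀ g b c, b ≠ c → Y g b c = true ∨ Y g c b = true)
    {u v : Lit n} :
    impl (forced X Y) u v = true ↔ ∀ M, Robust X Y M → Holds X M u → Holds X M v := by
  rcases v with _ | w
  · simp [impl, Holds]
  simp only [impl, Option.elim, Bool.or_eq_true]
  constructor
  · rintro (h | h | h) M hM hu
    · rcases u with _ | _ | q <;> simp_all [isFalse, Holds]
    · exact (fails_sound hX h hM hu).elim
    · rcases w with _ | q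
      · simp at h
      · exact forced_sound hX hM hu h
  · intro h
    by_contra hcon
    push Not at hcon
    obtain ⟨M, h1, h2, h3⟩ := exists_robust hX hY hcon.1 hcon.2.1
    have h4 := h M h1 h2
    rcases w with _ | q
    · exact h4
    · exact hcon.2.2 ((h3 _ _).1 h4)

end Forced

/-! ### Transitive closure -/

def transStep {V : Type} (L : List V) (T : V × V → Bool) : V × V → Bool := fun p =>
  T p || L.any fun w => T (p.1, w) && T (w, p.2)

def transClosure {V : Type} (L : List V) (E : V × V → Bool) : V × V → Bool :=
  (transStep L)^[(L ×ˢ L).length] E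

section Trans

variable {V : Type} {L : List V} {E : V × V → Bool}

theorem transStep_iff {T : V × V → Bool} {u v : V} : transStep L T (u, v) = true ↔
    T (u, v) = true ∨ ∃ w ∈ L, T (u, w) = true ∧ T (w, v) = true := by
  simp [transStep]

theorem transClosure_trans (hL : ∀ v, v ∈ L) {u v w : V} (h : transClosure L E (u, v) = true)
    (h' : transClosure L E (v, w) = true) : transClosure L E (u, w) = true := by
  have hfix : transStep L (transClosure L E) = transClosure L E :=
    iterate_fixed (fun _ => List.mem_product.2 ⟨hL _, hL _⟩)
      (fun _ _ h => transStep_iff.2 (Or.inl h)) _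
  rw [← hfix, transStep_iff]
  exact Or.inr ⟨v, hL v, h, h'⟩

theorem transClosure_of {u v : V} (h : E (u, v) = true) : transClosure L E (u, v) = true := by
  rw [transClosure]
  generalize (L ×ˢ L).length = k
  induction k with
  | zero => exact h
  | succ k ih =>
    rw [Function.iterate_succ_apply']
    exact transStep_iff.2 (Or.inl ih)

theorem transClosure_le {R : V → V → Prop} (hR : ∀ u v w, R u v → R v w → R u w)
    (hE : ∀ u v, E (u, v) = true → R u v) {u v : V} (h : transClosure L E (u, v) = true) :
    R u v := by
  rw [transClosure] at h
  generalize (L ×ˢ L).length = k at h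
  induction k generalizing u v with
  | zero => exact hE u v h
  | succ k ih =>
    rw [Function.iterate_succ_apply', transStep_iff] at h
    rcases h with h | ⟨w, -, h1, h2⟩
    · exact ih h
    · exact hR _ _ _ (ih h1) (ih h2)

end Trans

/-! ### Classes of an equivalence relation on a list -/

/-- The first equivalent element of `L`. It depends only on the class of `u`; for `u` in `L` the
default value is never needed. -/
def classRep {V : Type} (L : List V) (e : V → V → Bool) (u : V) : V := (L.filter (e u)).headD u

def classReps {V : Type} (L : List V) (eqb e : V → V → Bool) : List V :=
  L.filter fun u => eqb (classRep L e u) u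

section Classes

variable {V : Type} {L : List V} {eqb e : V → V → Bool}

theorem headD_mem {l : List V} {a : V} (h : l ≠ []) : l.headD a ∈ l := by
  cases l <;> simp_all

theorem headD_congr {l : List V} {a b : V} (h : l ≠ []) : l.headD a = l.headD b := by
  cases l <;> simp_all

/-- `e` is an equivalence relation on the elements of `L`. -/
structure IsEquivOn (L : List V) (e : V → V → Bool) : Prop where
  refl : ∀ u ∈ L, e u u = true
  symm : ∀ u ∈ L, ∀ v ∈ L, e u v = true → e v u = true
  trans : ∀ u ∈ L, ∀ v ∈ L, ∀ w ∈ L, e u v = true → e v w = true → e u w = true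

theorem classRep_eq (he : IsEquivOn L e) {u v : V} (hu : u ∈ L) (hv : v ∈ L) (h : e u v = true) :
    classRep L e u = classRep L e v := by
  have h1 : L.filter (e u) = L.filter (e v) := by
    refine List.filter_congr fun w hw => ?_
    rw [Bool.eq_iff_iff]
    exact ⟨he.trans v hv u hu w hw (he.symm u hu v hv h), he.trans u hu v hv w hw h⟩
  rw [classRep, classRep, h1]
  exact headD_congr (List.ne_nil_of_mem (List.mem_filter.2 ⟨hv, he.refl v hv⟩))

theorem classRep_mem (he : IsEquivOn L e) {u : V} (hu : u ∈ L) : classRep L e u ∈ L ∧ e u (classRep L e u) = true :=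
  List.mem_filter.1 (headD_mem (List.ne_nil_of_mem (List.mem_filter.2 ⟨hu, he.refl u hu⟩)))

theorem exists_classReps (hb : ∀ u v, eqb u v = true ↔ u = v) (he : IsEquivOn L e) {u : V} (hu : u ∈ L) : ∃ v ∈ classReps L eqb e, e u v = true := by
  obtain ⟨h1, h2⟩ := classRep_mem he hu
  exact ⟨_, List.mem_filter.2 ⟨h1, (hb _ _).2
    (classRep_eq he hu h1 h2).symm⟩, h2⟩

theorem classReps_unique (hb : ∀ u v, eqb u v = true ↔ u = v) (he : IsEquivOn L e) {u v : V} (hu : u ∈ classReps L eqb e) (hv : v ∈ classReps L eqb e)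
    (h : e u v = true) : u = v := by
  rw [classReps, List.mem_filter, hb] at hu hv
  rw [← hu.2, ← hv.2]
  exact classRep_eq he hu.1 hv.1 h

end Classes


/-! ### The algorithm -/

def prefOf (A : Inst n) (side : Bool) (a : Fin n) : Equiv.Perm (Fin n) :=
  if side then A.girlList a else A.boyList a

def base (A : Inst n) (side : Bool) : PrefTable n := fun a x y =>
  decide ((prefOf A side a).symm x < (prefOf A side a).symm y)

def Perturbation.side : Perturbation n → Bool
  | .boy _ _ => false
  | .girl _ _ => true

def Perturbation.agent : Perturbation n → Fin n
  | .boy b _ => b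
  | .girl g _ => g

def Perturbation.newList : Perturbation n → Equiv.Perm (Fin n)
  | .boy _ l => l
  | .girl _ l => l

/-- The preferences introduced by an error. -/
def Perturbation.prefers (e : Perturbation n) (side : Bool) : PrefTable n := fun a x y =>
  (e.side == side) && (decide (e.agent = a) && decide (e.newList.symm x < e.newList.symm y))

def errors (S : List (Perturbation n)) (side : Bool) : PrefTable n := fun a x y =>
  S.any fun e => e.prefers side a x y

/-- The preferences of an instance and of errors. -/
def extend (A : Inst n) (W : Bool → PrefTable n) (side : Bool) : PrefTable n := fun a x y =>
  base A side a x y || W side a x y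

section Rot

variable (X : PrefTable n) (T : LitTable n)

/-- `g` is the best girl that is not excluded for `b`. -/
def firstLeft (u : Lit n) (b g : Fin n) : Bool := allBetter X T u b g && !T (u, b, g)

/-- The first condition finds the pair in the least stable matching that satisfies some `u`; the
second says that some stable matching has the boy strictly below the pair. -/
def isRotPair (x : Fin n × Fin n) : Bool :=
  ((lits n).any fun u => !isFalse u && (!isFail T u && firstLeft X T u x.1 x.2)) &&
    !isFail T (some (some x))

/-- The girl to whom the boy of `x` moves in the rotation of `x`. -/
def nextGirl (x : Fin n × Fin n) : Fin n :=
  ((List.finRange n).filter fun h => firstLeft X T (some (some x)) x.1 h).headD x.2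

def sameRot (x y : Fin n × Fin n) : Bool :=
  isRotPair X T y && (T (some (some x), y) && T (some (some y), x))

/-- The pairs of the rotation of `x`. -/
def rotPairs (x : Fin n × Fin n) : List (Fin n × Fin n) := (pairs n).filter (sameRot X T x)

def nextPair (x : Fin n × Fin n) : Fin n × Fin n :=
  ((rotPairs X T x).filter fun y => decide (y.2 = nextGirl X T x)).headD x

/-- Selects one pair of every rotation, so that each rotation is listed once. -/
def isCanon (x : Fin n × Fin n) : Bool :=
  isRotPair X T x && decide ((rotPairs X T x).headD x = x)

/-- The rotation of `x`, starting from `x`. -/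
def orbit (x : Fin n × Fin n) : List (Fin n × Fin n) :=
  List.iterate (nextPair X T) x (rotPairs X T x).length

/-- The negation of `u`, seen from the girls. -/
def dual (u : Lit n) : Lit n :=
  u.elim (some none) fun w => w.elim none fun x => some (some (nextGirl X T x, x.1))

def isElem (u : Lit n) : Bool := u.elim true fun w => w.elim true (isRotPair X T)

/-- Errors of boys enter by contraposition. Both ends must be genuine elements, because `nextGirl`,
and hence `dual`, is meaningful only on pairs of rotations. -/
def edge (T₁ T₂ : LitTable n) (p : Lit n × Lit n) : Bool :=
  isElem X T p.1 && (isElem X T p.2 && (impl T₁ p.1 p.2 || impl T₂ (dual X T p.2) (dual X T p.1)))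

variable (R : Lit n × Lit n → Bool)

def eqv (u v : Lit n) : Bool := R (u, v) && R (v, u)

def reps : List (Lit n) :=
  classReps ((lits n).filter (isElem X T)) (fun u v => decide (u = v)) (eqv R)

def clsNum (u : Lit n) : ℕ := (reps X T R).findIdx (eqv R u)

def posetData : PosetData n where
  rots := ((pairs n).filter (isCanon X T)).map fun x => (orbit X T x, clsNum X T R (some (some x)))
  s := clsNum X T R none
  t := clsNum X T R (some none)
  le := (reps X T R).map fun u => (reps X T R).map fun v => R (v, u)

end Rot

def tableA (A : Inst n) : LitTable n := forced (base A false) (base A true)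

def tableG (A : Inst n) (W : Bool → PrefTable n) : LitTable n :=
  forced (base A false) (extend A W true)

/-- The sides are exchanged: the girls' lists, free of errors here, provide the linear orders, and
matchings are read as maps from girls to boys. -/
def tableB (A : Inst n) (W : Bool → PrefTable n) : LitTable n :=
  forced (base A true) (extend A W false)

def reach (A : Inst n) (W : Bool → PrefTable n) : Lit n × Lit n → Bool :=
  transClosure (lits n) (edge (base A false) (tableA A) (tableG A W) (tableB A W))

def answer (A : Inst n) (W : Bool → PrefTable n) : Option (PosetData n) :=
  if reach A W (none, some none) then none
  else some (posetData (base A false) (tableA A) (reach A W))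

/-! ### Robustness in terms of preference tables -/

variable {A : Inst n}

theorem isRank_base (A : Inst n) (side : Bool) :
    IsRank (base A side) fun a => (prefOf A side a).symm :=
  fun _ _ _ => decide_eq_true_iff

theorem base_total (A : Inst n) (side : Bool) (g b c : Fin n) (h : b ≠ c) :
    base A side g b c = true ∨ base A side g c b = true := by
  simp only [base, decide_eq_true_iff]
  exact lt_or_gt_of_ne fun e => h ((prefOf A side g).symm.injective e)

theorem extend_total (A : Inst n) (W : Bool → PrefTable n) (side : Bool) (g b c : Fin n)
    (h : b ≠ c) : extend A W side g b c = true ∨ extend A W side g c b = true := by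
  simp only [extend, Bool.or_eq_true]
  have := base_total A side g b c h
  tauto

theorem base_boy {b g h : Fin n} :
    base A false b g h = true ↔ A.boyRank b g < A.boyRank b h := decide_eq_true_iff

theorem base_girl {g b c : Fin n} :
    base A true g b c = true ↔ A.girlRank g b < A.girlRank g c := decide_eq_true_iff

theorem robust_base_iff {M : Equiv.Perm (Fin n)} :
    Robust (base A false) (base A true) M ↔ IsStable A M := by
  simp only [Robust, base_boy, base_girl]
  rfl

theorem errors_iff {S : List (Perturbation n)} {side : Bool} {a x y : Fin n} :
    errors S side a x y = true ↔ ∃ e ∈ S, e.side = side ∧ e.agent = a ∧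
      e.newList.symm x < e.newList.symm y := by
  simp [errors, Perturbation.prefers]

/-- A blocking pair involves the list of one girl only, and each of these errors replaces one list.
So blocking under some error, or in `A`, is blocking for the merged preferences. -/
theorem robust_girl_iff {S : List (Perturbation n)} {M : Equiv.Perm (Fin n)} :
    Robust (base A false) (extend A (errors S) true) M ↔
      IsFullyRobust A (S.filter fun e => e.side) M := by
  simp only [Robust, extend, Bool.or_eq_true, base_boy, base_girl, errors_iff]
  constructor
  · refine fun h => ⟨fun b g hbg => h b g ⟨hbg.1, Or.inl hbg.2⟩, fun e he b g hbg => ?_⟩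
    rw [List.mem_filter] at he
    rcases e with ⟨b₀, l⟩ | ⟨g₀, l⟩
    · simp [Perturbation.side] at he
    · refine h b g ⟨hbg.1, ?_⟩
      by_cases hg : g = g₀
      · subst hg
        refine Or.inr ⟨_, he.1, rfl, rfl, ?_⟩
        simpa [Inst.girlRank, Inst.perturb, Perturbation.newList] using hbg.2
      · refine Or.inl ?_
        simpa [Inst.girlRank, Inst.perturb, Function.update_of_ne hg] using hbg.2
  · rintro ⟨h1, h2⟩ b g ⟨h3, h4 | ⟨e, he, hs, rfl, h4⟩⟩
    · exact h1 b g ⟨h3, h4⟩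
    · rcases e with ⟨b₀, l⟩ | ⟨g₀, l⟩
      · simp [Perturbation.side] at hs
      · refine h2 _ (List.mem_filter.2 ⟨he, rfl⟩) b g₀ ⟨h3, ?_⟩
        simpa [Inst.girlRank, Inst.perturb, Perturbation.newList, Perturbation.agent] using h4

theorem robust_boy_iff {S : List (Perturbation n)} {M : Equiv.Perm (Fin n)} :
    Robust (base A true) (extend A (errors S) false) M.symm ↔
      IsFullyRobust A (S.filter fun e => !e.side) M := by
  simp only [Robust, extend, Bool.or_eq_true, base_boy, base_girl, errors_iff, Equiv.symm_symm]
  constructor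
  · refine fun h => ⟨fun b g hbg => h g b ⟨hbg.2, Or.inl hbg.1⟩, fun e he b g hbg => ?_⟩
    rw [List.mem_filter] at he
    rcases e with ⟨b₀, l⟩ | ⟨g₀, l⟩
    · refine h g b ⟨hbg.2, ?_⟩
      by_cases hg : b = b₀
      · subst hg
        refine Or.inr ⟨_, he.1, rfl, rfl, ?_⟩
        simpa [Inst.boyRank, Inst.perturb, Perturbation.newList] using hbg.1
      · refine Or.inl ?_
        simpa [Inst.boyRank, Inst.perturb, Function.update_of_ne hg] using hbg.1
    · simp [Perturbation.side] at he
  · rintro ⟨h1, h2⟩ g b ⟨h3, h4 | ⟨e, he, hs, rfl, h4⟩⟩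
    · exact h1 b g ⟨h4, h3⟩
    · rcases e with ⟨b₀, l⟩ | ⟨g₀, l⟩
      · refine h2 _ (List.mem_filter.2 ⟨he, rfl⟩) b₀ g ⟨?_, h3⟩
        simpa [Inst.boyRank, Inst.perturb, Perturbation.newList, Perturbation.agent] using h4
      · simp [Perturbation.side] at hs

theorem isFullyRobust_iff {S : List (Perturbation n)} {M : Equiv.Perm (Fin n)} :
    IsFullyRobust A S M ↔ IsFullyRobust A (S.filter fun e => e.side) M ∧
      IsFullyRobust A (S.filter fun e => !e.side) M := by
  simp only [IsFullyRobust, List.mem_filter]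
  constructor
  · exact fun h => ⟨⟨h.1, fun e he => h.2 e he.1⟩, ⟨h.1, fun e he => h.2 e he.1⟩⟩
  · refine fun h => ⟨h.1.1, fun e he => ?_⟩
    cases hs : e.side
    · exact h.2.2 e ⟨he, by simp [hs]⟩
    · exact h.1.2 e ⟨he, hs⟩

/-! ### Correctness of the computation of the rotations -/

theorem firstLeft_iff {X : PrefTable n} {r : Fin n → Equiv.Perm (Fin n)} (hX : IsRank X r)
    {T : LitTable n} {u : Lit n} {b m : Fin n} (h : ∀ g, X b g m = true ↔ T (u, b, g) = true)
    {g : Fin n} : firstLeft X T u b g = true ↔ g = m := by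
  simp only [firstLeft, Bool.and_eq_true, allBetter_iff, Bool.not_eq_true', ← Bool.not_eq_true,
    ← h]
  constructor
  · rintro ⟨h1, h2⟩
    rcases lt_trichotomy (r b g) (r b m) with h3 | h3 | h3
    · exact absurd ((hX _ _ _).2 h3) h2
    · exact (r b).injective h3
    · have := h1 _ ((hX _ _ _).2 h3)
      rw [hX] at this
      exact absurd this (lt_irrefl _)
  · rintro rfl
    refine ⟨fun _ h => h, ?_⟩
    rw [hX]
    exact lt_irrefl _

theorem headD_filter_of_unique {α : Type} {l : List α} {p : α → Bool} {a d : α} (ha : a ∈ l)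
    (h : ∀ b ∈ l, p b = true ↔ b = a) : (l.filter p).headD d = a := by
  have h1 : (l.filter p).headD d ∈ l.filter p :=
    headD_mem (List.ne_nil_of_mem (List.mem_filter.2 ⟨ha, (h a ha).2 rfl⟩))
  rw [List.mem_filter] at h1
  exact (h _ h1.1).1 h1.2

theorem holds_pair_iff {M : Equiv.Perm (Fin n)} {x : Fin n × Fin n} :
    Holds (base A false) M (some (some x)) ↔ A.boyRank x.1 x.2 < A.boyRank x.1 (M x.1) :=
  base_boy

theorem exists_stable {u : Lit n} (hu : isFalse u ≠ true) (hf : ¬ isFail (tableA A) u = true) :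
    ∃ M : StableMatching A, Holds (base A false) M.1 u ∧
      ∀ c g, base A false c g (M.1 c) = true ↔ tableA A (u, c, g) = true := by
  obtain ⟨M, h1, h2, h3⟩ := exists_robust (isRank_base A false) (base_total A true) hu hf
  exact ⟨⟨M, robust_base_iff.1 h1⟩, h2, h3⟩

theorem tableA_sound {u : Lit n} {M : StableMatching A} (hu : Holds (base A false) M.1 u) :
    ¬ isFail (tableA A) u = true ∧
      ∀ c g, tableA A (u, c, g) = true → base A false c g (M.1 c) = true :=
  ⟨fun h => fails_sound (isRank_base A false) h (robust_base_iff.2 M.2) hu, fun _ _ h =>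
    forced_sound (isRank_base A false) (robust_base_iff.2 M.2) hu h⟩

theorem isRotPair_of_mem {ρ : Rotation A} {x : Fin n × Fin n} (hx : x ∈ ρ.1) :
    isRotPair (base A false) (tableA A) x = true := by
  obtain ⟨N, hN⟩ := ρ.2
  obtain ⟨N', hN'⟩ := exists_elimination N ρ hN
  have hNx := hN.2.2.1 x hx
  have h1 : ¬ isFail (tableA A) (some (some x)) = true :=
    (tableA_sound (M := N') (holds_pair_iff.2 (hN'.mem_rotSet x hx))).1
  obtain ⟨u, hu1, hu2⟩ : ∃ u : Lit n, Holds (base A false) N.1 u ∧ ∀ M : StableMatching A,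
      Holds (base A false) M.1 u → A.boyRank x.1 x.2 ≤ A.boyRank x.1 (M.1 x.1) := by
    -- The proposition `u` puts the boy strictly below the girl just before `x.2` in his list; it is
    -- void if `x.2` is his favourite. The least stable matching satisfying `u` then gives him
    -- exactly `x.2`, as `N` satisfies `u`.
    by_cases h0 : (A.boyRank x.1 x.2).val = 0
    · exact ⟨none, trivial, fun M _ => by rw [Fin.le_def, h0]; exact Nat.zero_le _⟩
    · let k : Fin n := ⟨(A.boyRank x.1 x.2).val - 1, by omega⟩
      have hk : A.boyRank x.1 (A.boyList x.1 k) = k := Equiv.symm_apply_apply _ _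
      refine ⟨some (some (x.1, A.boyList x.1 k)), ?_, fun M hM => ?_⟩
      · rw [holds_pair_iff, hNx, hk, Fin.lt_def]
        change (A.boyRank x.1 x.2).val - 1 < (A.boyRank x.1 x.2).val
        omega
      · rw [holds_pair_iff, hk, Fin.lt_def] at hM
        change (A.boyRank x.1 x.2).val - 1 < (A.boyRank x.1 (M.1 x.1)).val at hM
        rw [Fin.le_def]
        omega
  have huF : isFalse u ≠ true := by
    rcases u with _ | _ | _ <;> simp_all [Holds, isFalse]
  have hs := tableA_sound hu1
  obtain ⟨M, h2, h3⟩ := exists_stable huF hs.1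
  have hMx : x.2 = M.1 x.1 := by
    have h4 := hu2 M h2
    refine boyRank_inj A (le_antisymm h4 (not_lt.1 fun hlt => ?_))
    have h5 := hs.2 _ _ ((h3 x.1 x.2).1 (base_boy.2 hlt))
    rw [base_boy, hNx] at h5
    exact lt_irrefl _ h5
  simp only [isRotPair, Bool.and_eq_true, List.any_eq_true, Bool.not_eq_true', ← Bool.not_eq_true]
  exact ⟨⟨u, mem_lits u, huF, hs.1, (firstLeft_iff (isRank_base A false) (h3 x.1)).2 hMx⟩, h1⟩

/-- Let `N` be maximal among the stable matchings containing `x`, and `Q` one past it. A rotation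
exposed in `N` on the way to `N ⊔ Q` contains `x`; otherwise its elimination would keep `x` and
contradict maximality. -/
theorem exists_rotation_of_isRotPair {x : Fin n × Fin n}
    (h : isRotPair (base A false) (tableA A) x = true) : ∃ ρ : Rotation A, x ∈ ρ.1 := by
  simp only [isRotPair, Bool.and_eq_true, List.any_eq_true, Bool.not_eq_true',
    ← Bool.not_eq_true] at h
  obtain ⟨⟨u, -, hu, hf, h1⟩, h2⟩ := h
  obtain ⟨M, -, hM⟩ := exists_stable hu hf
  rw [firstLeft_iff (isRank_base A false) (hM x.1)] at h1
  obtain ⟨Q, hQ, -⟩ := exists_stable (u := some (some x)) (by simp [isFalse]) h2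
  rw [holds_pair_iff] at hQ
  obtain ⟨N, hN, hmax⟩ := WellFounded.has_min (wellFounded_gt (α := StableMatching A))
    {N | N.1 x.1 = x.2} ⟨M, h1.symm⟩
  have hN : N.1 x.1 = x.2 := hN
  have hlt : N < N ⊔ Q := by
    refine lt_of_le_of_ne le_sup_left fun e => ?_
    have h3 := rank_sup N Q x.1
    rw [← e, hN, max_eq_right hQ.le] at h3
    exact hQ.ne h3
  obtain ⟨ρ, N', h4, -⟩ := exists_exposed_of_lt hlt
  refine ⟨ρ, ?_⟩
  by_contra hx
  refine hmax N' ?_ h4.lt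
  change N'.1 x.1 = x.2
  rw [h4.2.2 x.1, hN]
  intro p hp hpx
  have := h4.1.2.2.1 p hp
  rw [hpx, hN] at this
  exact hx (by rwa [show x = p from Prod.ext hpx.symm this])

theorem isRotPair_iff {x : Fin n × Fin n} :
    isRotPair (base A false) (tableA A) x = true ↔ ∃ ρ : Rotation A, x ∈ ρ.1 :=
  ⟨exists_rotation_of_isRotPair, fun ⟨_, h⟩ => isRotPair_of_mem h⟩

theorem tableA_pair_iff {ρ : Rotation A} {x y : Fin n × Fin n} (hx : x ∈ ρ.1) :
    tableA A (some (some x), y) = true ↔ ∀ M : StableMatching A, ρ ∈ rotSet M →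
      A.boyRank y.1 y.2 < A.boyRank y.1 (M.1 y.1) := by
  constructor
  · intro h M hM
    exact base_boy.1 ((tableA_sound (holds_pair_iff.2 (hM x hx))).2 _ _ h)
  · intro h
    have h1 := isRotPair_of_mem hx
    simp only [isRotPair, Bool.and_eq_true, Bool.not_eq_true', ← Bool.not_eq_true] at h1
    obtain ⟨M, h2, h3⟩ := exists_stable (by simp [isFalse]) h1.2
    exact (h3 _ _).1 (base_boy.2 (h M ((mem_rotSet_iff hx).2 (holds_pair_iff.1 h2))))

/-- If two rotations force each other, eliminating `ρ` brings in both of them at once, while an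
elimination adds a single rotation. -/
theorem sameRot_iff {ρ : Rotation A} {x y : Fin n × Fin n} (hx : x ∈ ρ.1) :
    sameRot (base A false) (tableA A) x y = true ↔ y ∈ ρ.1 := by
  simp only [sameRot, Bool.and_eq_true, isRotPair_iff]
  constructor
  · rintro ⟨⟨π, hy⟩, h1, h2⟩
    obtain ⟨N, hN⟩ := ρ.2
    obtain ⟨N', hN'⟩ := exists_elimination N ρ hN
    rw [tableA_pair_iff hx] at h1
    rw [tableA_pair_iff hy] at h2
    have h3 : π ∈ rotSet N' := (mem_rotSet_iff hy).2 (h1 N' hN'.mem_rotSet)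
    have h4 : π ∉ rotSet N := fun h =>
      notMem_rotSet_of_exposed hN ((mem_rotSet_iff hx).2 (h2 N h))
    rwa [← hN'.eq_of_mem h4 h3]
  · intro hy
    exact ⟨⟨ρ, hy⟩, (tableA_pair_iff hx).2 fun M hM => hM y hy,
      (tableA_pair_iff hy).2 fun M hM => hM x hx⟩

/-- In the least stable matching past `x`, the boy is no lower than in `N'`, which is past `x`, and
no higher by `exposed_beyond`. -/
theorem nextGirl_eq {ρ : Rotation A} {N N' : StableMatching A} (h : IsElimination N ρ N')
    {x : Fin n × Fin n} (hx : x ∈ ρ.1) :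
    nextGirl (base A false) (tableA A) x = N'.1 x.1 := by
  have h1 := tableA_sound (M := N') (holds_pair_iff.2 (h.mem_rotSet x hx))
  obtain ⟨M, h2, h3⟩ := exists_stable (by simp [isFalse]) h1.1
  have h4 : M.1 x.1 = N'.1 x.1 := by
    refine boyRank_inj A (le_antisymm (not_lt.1 fun hlt => ?_)
      (exposed_beyond h.1 hx (holds_pair_iff.1 h2) hx (h.2.1 x hx)))
    exact lt_irrefl _ (base_boy.1 (h1.2 _ _ ((h3 _ _).1 (base_boy.2 hlt))))
  rw [← h4]
  exact headD_filter_of_unique (List.mem_finRange _)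
    fun b _ => firstLeft_iff (isRank_base A false) (h3 x.1)

theorem mem_rotPairs {ρ : Rotation A} {x y : Fin n × Fin n} (hx : x ∈ ρ.1) :
    y ∈ rotPairs (base A false) (tableA A) x ↔ y ∈ ρ.1 := by
  rw [rotPairs, List.mem_filter, sameRot_iff hx]
  exact and_iff_right (mem_pairs y)

theorem nextPair_eq {ρ : Rotation A} {N : StableMatching A} (h : IsExposed A N.1 ρ.1)
    {x y : Fin n × Fin n} (hx : x ∈ ρ.1) (hy : y ∈ ρ.1) (hxy : IsNext A N.1 x.1 y.1) :
    nextPair (base A false) (tableA A) x = y := by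
  obtain ⟨N', hN'⟩ := exists_elimination N ρ h
  have h1 : N'.1 x.1 = y.2 := by
    rw [← h.2.2.1 y hy]
    exact (hN'.2.1 x hx).unique hxy
  refine headD_filter_of_unique ((mem_rotPairs hx).2 hy) fun z hz => ?_
  rw [mem_rotPairs hx] at hz
  rw [decide_eq_true_iff, nextGirl_eq hN' hx, h1]
  refine ⟨fun e => h.pair_eq hz hy (N.1.injective ?_), fun e => e ▸ rfl⟩
  rw [h.2.2.1 z hz, h.2.2.1 y hy, e]

theorem nodup_pairs : (pairs n).Nodup := (List.nodup_finRange n).product (List.nodup_finRange n)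

/-- By `nextPair_eq`, `nextPair` follows the rotation, and `rotPairs` supplies its length. -/
theorem orbit_eq {ρ : Rotation A} {x : Fin n × Fin n} (hx : x ∈ ρ.1) :
    (orbit (base A false) (tableA A) x : Cycle (Fin n × Fin n)) = ρ.1 := by
  obtain ⟨N, hN⟩ := ρ.2
  obtain ⟨l, hl⟩ := exists_cons_of_mem_cycle hx
  have hlen : (rotPairs (base A false) (tableA A) x).length = (x :: l).length := by
    refine List.Perm.length_eq ((List.perm_ext_iff_of_nodup (nodup_pairs.filter _) ?_).2
      fun y => ?_)
    · rw [← Cycle.nodup_coe_iff, ← hl]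
      exact hN.2.1
    · exact (mem_rotPairs hx).trans (by rw [hl]; exact Cycle.mem_coe_iff)
  have hch : ρ.1.Chain fun a b => nextPair (base A false) (tableA A) a = b :=
    chain_imp hN.2.2.2 fun a ha b hb hab => nextPair_eq hN ha hb hab
  rw [hl, Cycle.chain_coe_cons] at hch
  rw [orbit, hlen, hl]
  congr 1
  have key : ∀ (l : List (Fin n × Fin n)) (x y : Fin n × Fin n),
      List.IsChain (fun a b => nextPair (base A false) (tableA A) a = b) (x :: (l ++ [y])) →
      List.iterate (nextPair (base A false) (tableA A)) x (x :: l).length = x :: l := by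
    intro l
    induction l with
    | nil => intro x y _; rfl
    | cons z l ih =>
      intro x y h
      rw [List.cons_append, List.isChain_cons_cons] at h
      rw [List.length_cons, List.iterate, h.1, ih z y h.2]
  exact key l x x hch

theorem isCanon_iff {x : Fin n × Fin n} : isCanon (base A false) (tableA A) x = true ↔
    ∃ ρ : Rotation A, x ∈ ρ.1 ∧ (rotPairs (base A false) (tableA A) x).headD x = x := by
  simp [isCanon, isRotPair_iff]

theorem exists_canon (ρ : Rotation A) :
    ∃ x ∈ ρ.1, isCanon (base A false) (tableA A) x = true := by
  obtain ⟨y, hy⟩ := ρ.exists_mem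
  have h1 : (rotPairs (base A false) (tableA A) y).headD y ∈ ρ.1 := by
    rw [← mem_rotPairs hy]
    exact headD_mem (List.ne_nil_of_mem ((mem_rotPairs hy).2 hy))
  refine ⟨_, h1, isCanon_iff.2 ⟨ρ, h1, ?_⟩⟩
  have h2 : ∀ z ∈ ρ.1, rotPairs (base A false) (tableA A) z =
      rotPairs (base A false) (tableA A) y := by
    intro z hz
    refine List.filter_congr fun w _ => ?_
    rw [Bool.eq_iff_iff, sameRot_iff hz, sameRot_iff hy]
  rw [h2 _ h1]
  exact headD_congr (List.ne_nil_of_mem ((mem_rotPairs hy).2 hy))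

theorem rotation_eq_of_mem {ρ π : Rotation A} {x : Fin n × Fin n} (h : x ∈ ρ.1) (h' : x ∈ π.1) :
    ρ = π :=
  Subtype.ext ((orbit_eq h).symm.trans (orbit_eq h'))

theorem canon_unique {ρ : Rotation A} {x y : Fin n × Fin n} (hx : x ∈ ρ.1) (hy : y ∈ ρ.1)
    (h : isCanon (base A false) (tableA A) x = true)
    (h' : isCanon (base A false) (tableA A) y = true) : x = y := by
  obtain ⟨-, -, h1⟩ := isCanon_iff.1 h
  obtain ⟨-, -, h2⟩ := isCanon_iff.1 h'
  have h3 : rotPairs (base A false) (tableA A) x = rotPairs (base A false) (tableA A) y := by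
    refine List.filter_congr fun w _ => ?_
    rw [Bool.eq_iff_iff, sameRot_iff hx, sameRot_iff hy]
  rw [← h1, ← h2, h3]
  exact headD_congr (List.ne_nil_of_mem ((mem_rotPairs hy).2 hy))

/-! ### Correctness of the computation of the implications -/

/-- The element `z` of the rotation poset is represented by `u`. -/
def Rep : RotElem A → Lit n → Prop
  | .s, u => u = none
  | .t, u => u = some none
  | .rot ρ, u => ∃ x ∈ ρ.1, u = some (some x)

theorem exists_rep (z : RotElem A) : ∃ u, Rep z u := by
  cases z with
  | s => exact ⟨_, rfl⟩
  | t => exact ⟨_, rfl⟩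
  | rot ρ =>
    obtain ⟨x, hx⟩ := ρ.exists_mem
    exact ⟨_, x, hx, rfl⟩

theorem isElem_iff {u : Lit n} :
    isElem (base A false) (tableA A) u = true ↔ ∃ z : RotElem A, Rep z u := by
  constructor
  · intro h
    rcases u with _ | _ | x
    · exact ⟨.s, rfl⟩
    · exact ⟨.t, rfl⟩
    · obtain ⟨ρ, hρ⟩ := exists_rotation_of_isRotPair (A := A) h
      exact ⟨.rot ρ, x, hρ, rfl⟩
  · rintro ⟨z, hz⟩
    cases z with
    | s => obtain rfl := hz; rfl
    | t => obtain rfl := hz; rfl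
    | rot ρ =>
      obtain ⟨x, hx, rfl⟩ := hz
      exact isRotPair_of_mem hx

theorem Rep.holds_iff {z : RotElem A} {u : Lit n} (h : Rep z u) (M : StableMatching A) :
    Holds (base A false) M.1 u ↔ z.Holds M := by
  cases z with
  | s => obtain rfl := h; simp [Holds, RotElem.Holds]
  | t => obtain rfl := h; simp [Holds, RotElem.Holds]
  | rot ρ =>
    obtain ⟨x, hx, rfl⟩ := h
    rw [holds_pair_iff]
    exact (mem_rotSet_iff hx).symm

/-- Let `g` be the girl to whom the boy `b` of `x` moves. If `M` is past the rotation, `b` is at or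
below `g`, so stability forbids her to prefer him. If not, `b` is strictly above `g`; he has her in
`M ⊔ N'`, where girls do at least as well as in `M`, so she strictly prefers him. -/
theorem Rep.dual_iff {z : RotElem A} {u : Lit n} (h : Rep z u) (M : StableMatching A) :
    Holds (base A true) M.1.symm (dual (base A false) (tableA A) u) ↔ ¬ z.Holds M := by
  cases z with
  | s => obtain rfl := h; simp [Holds, RotElem.Holds, dual]
  | t => obtain rfl := h; simp [Holds, RotElem.Holds, dual]
  | rot ρ =>
    obtain ⟨x, hx, rfl⟩ := h
    obtain ⟨N, hN⟩ := ρ.2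
    obtain ⟨N', hN'⟩ := exists_elimination N ρ hN
    simp only [Holds, dual, Option.elim, RotElem.Holds, nextGirl_eq hN' hx]
    rw [base_girl]
    constructor
    · intro h1 h2
      have h3 := exposed_beyond hN hx (h2 x hx) hx (hN'.2.1 x hx)
      rcases h3.lt_or_eq with h4 | h4
      · exact M.2 _ _ ⟨h4, h1⟩
      · rw [boyRank_inj A h4, Equiv.symm_apply_apply] at h1
        exact lt_irrefl _ h1
    · intro h1
      rw [mem_rotSet_iff hx, not_lt] at h1
      have h2 : A.boyRank x.1 (M.1 x.1) < A.boyRank x.1 (N'.1 x.1) :=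
        h1.trans_lt (hN'.mem_rotSet x hx)
      have h3 := girlRank_antitone (le_sup_left : M ≤ M ⊔ N') (N'.1 x.1)
      have h4 : (M ⊔ N').1 x.1 = N'.1 x.1 := by
        apply boyRank_inj A
        rw [rank_sup, max_eq_right h2.le]
      rw [(Equiv.symm_apply_eq _).2 h4.symm] at h3
      refine lt_of_le_of_ne h3 fun e => h2.ne ?_
      rw [(Equiv.symm_apply_eq _).1 (girlRank_inj A e).symm]

variable {S : List (Perturbation n)}

theorem implG_iff {z w : RotElem A} {u v : Lit n} (hz : Rep z u) (hw : Rep w v) :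
    impl (tableG A (errors S)) u v = true ↔
      Implies (fullyRobustSet A (S.filter fun e => e.side)) z w := by
  rw [tableG, impl_iff (isRank_base A false) (extend_total A _ true)]
  simp only [robust_girl_iff]
  exact ⟨fun h M hM hzM => (hw.holds_iff M).1 (h M.1 hM ((hz.holds_iff M).2 hzM)),
    fun h M hM hu => (hw.holds_iff ⟨M, hM.1⟩).2 (h ⟨M, hM.1⟩ hM ((hz.holds_iff ⟨M, hM.1⟩).1 hu))⟩

theorem implB_iff {z w : RotElem A} {u v : Lit n} (hz : Rep z u) (hw : Rep w v) :
    impl (tableB A (errors S)) (dual (base A false) (tableA A) v)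
      (dual (base A false) (tableA A) u) = true ↔
      Implies (fullyRobustSet A (S.filter fun e => !e.side)) z w := by
  rw [tableB, impl_iff (isRank_base A true) (extend_total A _ false)]
  constructor
  · intro h M hM hzM
    by_contra hcon
    exact (hz.dual_iff M).1 (h M.1.symm (robust_boy_iff.2 hM) ((hw.dual_iff M).2 hcon)) hzM
  · intro h M hM hv
    have hM' : IsFullyRobust A (S.filter fun e => !e.side) M.symm := robust_boy_iff.1 hM
    exact (hz.dual_iff ⟨M.symm, hM'.1⟩).2 fun hzM =>
      (hw.dual_iff ⟨M.symm, hM'.1⟩).1 hv (h ⟨M.symm, hM'.1⟩ hM' hzM)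

theorem edge_iff {z w : RotElem A} {u v : Lit n} (hz : Rep z u) (hw : Rep w v) :
    edge (base A false) (tableA A) (tableG A (errors S)) (tableB A (errors S)) (u, v) = true ↔
      Implies (fullyRobustSet A (S.filter fun e => e.side)) z w ∨
      Implies (fullyRobustSet A (S.filter fun e => !e.side)) z w := by
  simp only [edge, Bool.and_eq_true, Bool.or_eq_true, implG_iff hz hw, implB_iff hz hw]
  rw [and_iff_right (isElem_iff.2 ⟨z, hz⟩), and_iff_right (isElem_iff.2 ⟨w, hw⟩)]

theorem reach_iff {z w : RotElem A} {u v : Lit n} (hz : Rep z u) (hw : Rep w v) :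
    reach A (errors S) (u, v) = true ↔ Implies (fullyRobustSet A S) z w := by
  constructor
  · intro h M hM hzM
    refine (hw.holds_iff M).1 (transClosure_le (R := fun u v => Holds (base A false) M.1 u →
      Holds (base A false) M.1 v) (fun _ _ _ h1 h2 h => h2 (h1 h)) ?_ h
      ((hz.holds_iff M).2 hzM))
    intro u v huv hu
    have h1 := huv
    simp only [edge, Bool.and_eq_true] at h1
    obtain ⟨z', hz'⟩ := isElem_iff.1 h1.1
    obtain ⟨w', hw'⟩ := isElem_iff.1 h1.2.1
    rw [hw'.holds_iff]
    rw [hz'.holds_iff] at hu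
    have h2 := isFullyRobust_iff.1 hM
    rcases (edge_iff hz' hw').1 huv with h3 | h3
    · exact h3 M h2.1 hu
    · exact h3 M h2.2 hu
  · intro h
    by_contra hcon
    -- The elements reachable from `z` are closed under both families of implications.
    set J : Set (RotElem A) := {y | ∃ u', Rep y u' ∧ reach A (errors S) (u, u') = true} with hJ
    have hstep : ∀ y ∈ J, ∀ y', (Implies (fullyRobustSet A (S.filter fun e => e.side)) y y' ∨
        Implies (fullyRobustSet A (S.filter fun e => !e.side)) y y') → ∀ u', Rep y' u' →
        reach A (errors S) (u, u') = true := by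
      rintro y ⟨u₁, hu₁, h1⟩ y' hyy' u' hu'
      exact transClosure_trans mem_lits h1 (transClosure_of ((edge_iff hu₁ hu').2 hyy'))
    have hzJ : z ∈ J := ⟨u, hz, transClosure_of ((edge_iff hz hz).2 (Or.inl fun _ _ h => h))⟩
    have hs : RotElem.s ∈ J :=
      ⟨none, rfl, hstep z hzJ .s (Or.inl fun _ _ _ => trivial) none rfl⟩
    -- Since `t` implies everything, reaching `t` would mean reaching `w`.
    have ht : RotElem.t ∉ J := fun ht =>
      hcon (hstep .t ht w (Or.inl fun _ _ h => h.elim) v hw)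
    have hsubG := isSublattice_fullyRobust A (S.filter fun e => e.side)
    have hsubB := isSublattice_fullyRobust A (S.filter fun e => !e.side)
    obtain ⟨M, hM, hMJ⟩ := exists_of_closed hsubG.1 hsubG.2 hs ht fun y hy y' h' => by
      obtain ⟨u', hu'⟩ := exists_rep y'
      exact ⟨u', hu', hstep y hy y' (Or.inl h') u' hu'⟩
    obtain ⟨N, hN, hNJ⟩ := exists_of_closed hsubB.1 hsubB.2 hs ht fun y hy y' h' => by
      obtain ⟨u', hu'⟩ := exists_rep y'
      exact ⟨u', hu', hstep y hy y' (Or.inr h') u' hu'⟩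
    -- The girl-robust `M` and the boy-robust `N` have the same closed set `J`, so they are one
    -- fully robust matching.
    have hMN : M = N := rotSet_injective (Set.ext fun ρ =>
      (hMJ (.rot ρ)).symm.trans (hNJ (.rot ρ)))
    subst hMN
    obtain ⟨u', hu', h1⟩ := (hMJ w).2 (h M (isFullyRobust_iff.2 ⟨hM, hN⟩) ((hMJ z).1 hzJ))
    exact hcon (hstep w ⟨u', hu', h1⟩ w (Or.inl fun _ _ h => h) v hw)

theorem reach_false_iff : reach A (errors S) (none, some none) = true ↔
    ¬ ∃ M, IsFullyRobust A S M := by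
  rw [reach_iff (z := .s) (w := .t) rfl rfl]
  constructor
  · rintro h ⟨M, hM⟩
    exact h ⟨M, hM.1⟩ hM trivial
  · exact fun h M hM _ => h ⟨M.1, hM⟩

/-! ### Correctness of the output -/

theorem isEquivOn_eqv : IsEquivOn ((lits n).filter (isElem (base A false) (tableA A)))
    (eqv (reach A (errors S))) := by
  constructor
  · intro u hu
    obtain ⟨z, hz⟩ := isElem_iff.1 (List.mem_filter.1 hu).2
    simp only [eqv, Bool.and_eq_true, reach_iff hz hz]
    exact ⟨fun _ _ h => h, fun _ _ h => h⟩
  · intro u _ v _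
    simp only [eqv, Bool.and_eq_true]
    exact And.symm
  · intro u _ v _ w _
    simp only [eqv, Bool.and_eq_true]
    exact fun h h' => ⟨transClosure_trans mem_lits h.1 h'.1, transClosure_trans mem_lits h'.2 h.2⟩

theorem exists_compression (A : Inst n) (S : List (Perturbation n)) :
    ∃ C : Compression A, (posetData (base A false) (tableA A) (reach A (errors S))).Describes C ∧
      C.Generates (fullyRobustSet A S) := by
  classical
  set X := base A false with hXdef
  set T := tableA A with hT
  set R := reach A (errors S) with hR
  have heqv := isEquivOn_eqv (A := A) (S := S)
  rw [← hXdef, ← hT, ← hR] at heqv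
  set L := reps X T R with hL
  have hb : ∀ u v : Lit n, decide (u = v) = true ↔ u = v := fun _ _ => decide_eq_true_iff
  have hLelem : ∀ u ∈ L, u ∈ (lits n).filter (isElem X T) := fun u hu => (List.mem_filter.1 hu).1
  have hex : ∀ {z : RotElem A} {u}, Rep z u → ∃ v ∈ L, eqv R u v = true := fun {z u} hz =>
    exists_classReps hb heqv (List.mem_filter.2 ⟨mem_lits u, isElem_iff.2 ⟨z, hz⟩⟩)
  have huniq : ∀ u ∈ L, ∀ v ∈ L, eqv R u v = true → u = v := fun u hu v hv h =>
    classReps_unique hb heqv hu hv h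
  have hnum : ∀ {z : RotElem A} {u}, Rep z u → clsNum X T R u < L.length := by
    intro z u hz
    obtain ⟨v, hv, h⟩ := hex hz
    exact List.findIdx_lt_length_of_exists ⟨v, hv, h⟩
  have hget : ∀ {z : RotElem A} {u} (hz : Rep z u), eqv R u (L[clsNum X T R u]'(hnum hz)) = true :=
    fun hz => List.findIdx_getElem (w := hnum hz)
  have hrepL : ∀ i : Fin L.length, ∃ z : RotElem A, Rep z L[i] := fun i =>
    isElem_iff.1 (List.mem_filter.1 (hLelem _ (List.getElem_mem i.2))).2
  have heqv_iff : ∀ {z w : RotElem A} {u v}, Rep z u → Rep w v → (eqv R u v = true ↔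
      Implies (fullyRobustSet A S) z w ∧ Implies (fullyRobustSet A S) w z) := by
    intro z w u v hz hw
    rw [eqv, Bool.and_eq_true, reach_iff hz hw, reach_iff hw hz]
  have hnodup : L.Nodup := by
    refine (List.Nodup.filter _ (List.Nodup.filter _ ?_))
    refine List.nodup_cons.2 ⟨by simp, List.Nodup.map (Option.some_injective _) ?_⟩
    exact List.nodup_cons.2 ⟨by simp, nodup_pairs.map (Option.some_injective _)⟩
  have hnum_eq : ∀ {z w : RotElem A} {u v} (hz : Rep z u) (hw : Rep w v),
      Implies (fullyRobustSet A S) z w → Implies (fullyRobustSet A S) w z →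
      clsNum X T R u = clsNum X T R v := by
    intro z w u v hz hw h h'
    obtain ⟨z', hz'⟩ := hrepL ⟨_, hnum hz⟩
    obtain ⟨w', hw'⟩ := hrepL ⟨_, hnum hw⟩
    have h1 := (heqv_iff hz hz').1 (hget hz)
    have h2 := (heqv_iff hw hw').1 (hget hw)
    refine (hnodup.getElem_inj_iff (hi := hnum hz) (hj := hnum hw)).1 (huniq _
      (List.getElem_mem _) _ (List.getElem_mem _) ((heqv_iff hz' hw').2 ⟨?_, ?_⟩))
    · exact fun M hM hzM => h2.1 M hM (h M hM (h1.2 M hM hzM))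
    · exact fun M hM hzM => h1.1 M hM (h' M hM (h2.2 M hM hzM))
  -- The choice of a representing pair is immaterial by `hnum_eq`.
  let cls : RotElem A → Fin L.length := fun z =>
    ⟨clsNum X T R (exists_rep z).choose, hnum (exists_rep z).choose_spec⟩
  have hcls : ∀ {z : RotElem A} {u}, Rep z u → clsNum X T R u = (cls z).val := fun {z u} hz =>
    hnum_eq hz (exists_rep z).choose_spec (fun _ _ h => h) (fun _ _ h => h)
  have hclsrep : ∀ z w : RotElem A, Rep w L[cls z] →
      Implies (fullyRobustSet A S) z w ∧ Implies (fullyRobustSet A S) w z := fun z w hw =>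
    (heqv_iff (exists_rep z).choose_spec hw).1 (hget (exists_rep z).choose_spec)
  -- The indices are swapped: an element is below those that imply it.
  let le : Fin L.length → Fin L.length → Prop := fun i j => R (L[j], L[i]) = true
  have hle : ∀ z w : RotElem A, le (cls z) (cls w) ↔ Implies (fullyRobustSet A S) w z := by
    intro z w
    obtain ⟨z', hz'⟩ := hrepL (cls z)
    obtain ⟨w', hw'⟩ := hrepL (cls w)
    have h1 := hclsrep z z' hz'
    have h2 := hclsrep w w' hw'
    refine (reach_iff hw' hz').trans ⟨fun h M hM hwM => ?_, fun h M hM hwM => ?_⟩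
    · exact h1.2 M hM (h M hM (h2.1 M hM hwM))
    · exact h1.1 M hM (h M hM (h2.2 M hM hwM))
  have hsurj : Function.Surjective cls := by
    intro i
    obtain ⟨z, hz⟩ := hrepL i
    refine ⟨z, Fin.ext ?_⟩
    rw [← hcls hz]
    exact (hnodup.getElem_inj_iff (hi := hnum hz) (hj := i.2)).1
      (huniq _ (List.getElem_mem i.2) _ (List.getElem_mem _) (hget hz)).symm
  have heq : ∀ z w : RotElem A, Implies (fullyRobustSet A S) z w →
      Implies (fullyRobustSet A S) w z → cls z = cls w := fun z w h h' =>
    Fin.ext (hnum_eq (exists_rep z).choose_spec (exists_rep w).choose_spec h h')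
  have hsub := isSublattice_fullyRobust A S
  refine ⟨Compression.ofImplies _ cls hsurj le hle heq, ⟨?_, hcls rfl, hcls rfl, ?_⟩,
    Compression.generates_ofImplies hsub.1 hsub.2 cls hsurj le hle heq⟩
  · have hch : ∀ x : {x // x ∈ (pairs n).filter (isCanon X T)}, ∃ ρ : Rotation A, x.1 ∈ ρ.1 := by
      rintro ⟨x, hx⟩
      obtain ⟨ρ, hρ, -⟩ := isCanon_iff.1 (List.mem_filter.1 hx).2
      exact ⟨ρ, hρ⟩
    choose f hf using hch
    refine ⟨((pairs n).filter (isCanon X T)).attach.map f, ?_, fun ρ => ?_, ?_⟩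
    · refine List.Nodup.map_on ?_ (List.nodup_attach.2 (nodup_pairs.filter _))
      intro x _ y _ hxy
      have h1 := hf y
      rw [← hxy] at h1
      exact Subtype.ext (canon_unique (hf x) h1 (List.mem_filter.1 x.2).2 (List.mem_filter.1 y.2).2)
    · obtain ⟨x, hx, hc⟩ := exists_canon ρ
      exact List.mem_map.2 ⟨⟨x, List.mem_filter.2 ⟨mem_pairs x, hc⟩⟩, List.mem_attach _ _,
        rotation_eq_of_mem (hf _) hx⟩
    · have h1 : (posetData X T R).rots = ((pairs n).filter (isCanon X T)).attach.map fun x =>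
          (orbit X T x.1, clsNum X T R (some (some x.1))) := by
        exact (List.attach_map_val (f := fun x => (orbit X T x, clsNum X T R (some (some x))))).symm
      rw [h1, List.forall₂_map_left_iff, List.forall₂_map_right_iff, List.forall₂_same]
      exact fun x _ => ⟨orbit_eq (hf x), hcls ⟨x.1, hf x, rfl⟩⟩
  · change (L.map fun u => L.map fun v => R (v, u)) = _
    refine List.ext_getElem (by simp) fun i h1 h2 => ?_
    refine List.ext_getElem (by simp) fun j h3 h4 => ?_
    simp [le]

theorem answer_isSome (A : Inst n) (S : List (Perturbation n)) :
    (answer A (errors S)).isSome = true ↔ ∃ M, IsFullyRobust A S M := by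
  have h := reach_false_iff (A := A) (S := S)
  rw [answer]
  split_ifs with h'
  · simpa using h.1 h'
  · simpa using not_not.1 (h.not.1 h')

theorem answer_spec (A : Inst n) (S : List (Perturbation n)) : ∀ P ∈ answer A (errors S),
    ∃ C : Compression A, P.Describes C ∧ C.Generates (fullyRobustSet A S) := by
  intro P hP
  rw [answer] at hP
  split_ifs at hP
  · simp at hP
  · obtain rfl := Option.some_injective _ hP
    exact exists_compression A S


/-! ### The algorithm runs in polynomial time -/

variable {Γ : Ctx}

namespace Fam

@[reducible] def ctx (F : Fam) (Γ : Ctx) : Ctx := Γ.ext (fun i => F.V (Γ.N i)) fun _ => F.enc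

variable (F : Fam)

theorem short_list : Easy.Short Γ fun i => F.list (Γ.N i) := by
  obtain ⟨p, hp⟩ := F.short
  exact ⟨p, fun _ => hp _⟩

theorem easy_all {f : ∀ i, F.V (Γ.N i) → Bool}
    (hf : Easy (F.ctx Γ) fun j => encBool (f j.1 j.2)) :
    Easy Γ fun i => encBool ((F.list (Γ.N i)).all (f i)) :=
  Easy.all F.short_list (F.easyList Γ) hf

theorem easy_any {f : ∀ i, F.V (Γ.N i) → Bool}
    (hf : Easy (F.ctx Γ) fun j => encBool (f j.1 j.2)) :
    Easy Γ fun i => encBool ((F.list (Γ.N i)).any (f i)) :=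
  Easy.any F.short_list (F.easyList Γ) hf

theorem easy_filter {f : ∀ i, F.V (Γ.N i) → Bool}
    (hf : Easy (F.ctx Γ) fun j => encBool (f j.1 j.2)) :
    Easy Γ fun i => encList F.enc ((F.list (Γ.N i)).filter (f i)) :=
  Easy.filter F.short_list (F.easyList Γ) hf

theorem easy_eq [∀ n, DecidableEq (F.V n)] {x y : ∀ i, F.V (Γ.N i)}
    (hx : Easy Γ fun i => F.enc (x i)) (hy : Easy Γ fun i => F.enc (y i)) :
    Easy Γ fun i => encBool (decide (x i = y i)) :=
  (F.easyEq Γ x y hx hy).congr fun i => by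
    congr 1
    rw [Bool.eq_iff_iff, decide_eq_true_iff, F.eqb_iff]

end Fam

theorem Easy.elim {D B : Γ.ι → Type} {e : ∀ i, D i → Data} {eB : ∀ i, B i → Data}
    {o : ∀ i, Option (D i)} {f : ∀ i, B i} {g : ∀ i, D i → B i}
    (ho : Easy Γ fun i => encOpt (e i) (o i)) (hf : Easy Γ fun i => eB i (f i))
    (hg : Easy (Γ.ext D e) fun j => eB j.1 (g j.1 j.2)) :
    Easy Γ fun i => eB i ((o i).elim (f i) (g i)) :=
  (ho.none_or_some hf hg).congr fun i => by cases o i <;> rfl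

@[reducible] def pairFam : Fam := .prod .fin .fin

@[reducible] def litFam : Fam := .opt (.opt pairFam)

@[reducible] def litPairFam : Fam := .prod litFam pairFam

@[reducible] def litLitFam : Fam := .prod litFam litFam

@[reducible] def tripleFam : Fam := .prod .fin (.prod .fin .fin)

@[reducible] def errorFam : Fam := .prod .bool tripleFam

/-! #### Preference lists -/

/-- Whether `x` occurs before `y` in a list. -/
def before {n : ℕ} (l : List (Fin n)) (x y : Fin n) : Bool :=
  l.foldr (fun a acc => if decide (a = y) then false else if decide (a = x) then true else acc)
    false

theorem before_iff {n : ℕ} {r : Fin n → Fin n} {l : List (Fin n)}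
    (hl : l.Pairwise fun a b => r a < r b) {x y : Fin n} (hx : x ∈ l) (hy : y ∈ l) :
    before l x y = true ↔ r x < r y := by
  induction l with
  | nil => simp at hx
  | cons a l ih =>
    rw [List.pairwise_cons] at hl
    simp only [before, List.foldr_cons, decide_eq_true_iff]
    split_ifs with h1 h2
    · subst h1
      rcases List.mem_cons.1 hx with rfl | hx
      · simp
      · simpa using (hl.1 x hx).le
    · subst h2
      simpa using hl.1 y ((List.mem_cons.1 hy).resolve_left (Ne.symm h1))
    · refine Iff.trans ?_ (ih hl.2 ((List.mem_cons.1 hx).resolve_left (Ne.symm h2))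
        ((List.mem_cons.1 hy).resolve_left (Ne.symm h1)))
      simp only [before, decide_eq_true_iff]

theorem encList_map {α β : Type} (e : β → Data) (f : α → β) (l : List α) :
    encList e (l.map f) = encList (fun a => e (f a)) l := by
  induction l with
  | nil => rfl
  | cons a l ih => simp [encList, ih]

/-- Ranks are compared by scanning the list for the first of the two agents, without inverting the
permutation. -/
theorem easy_lt_symm {σ : ∀ i, Equiv.Perm (Fin (Γ.N i))} {x y : ∀ i, Fin (Γ.N i)}
    (hσ : Easy Γ fun i => encPref (σ i)) (hx : Easy Γ fun i => encFin (x i))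
    (hy : Easy Γ fun i => encFin (y i)) :
    Easy Γ fun i => encBool (decide ((σ i).symm (x i) < (σ i).symm (y i))) := by
  refine (Easy.foldr (l := fun i => (List.finRange (Γ.N i)).map (σ i)) (eD := fun _ => encFin)
    (Y := fun _ => Bool) (eY := fun _ => encBool) (init := fun _ => false)
    (step := fun i a acc => if decide (a = y i) then false else
      if decide (a = x i) then true else acc)
    ⟨Polynomial.X, fun i => by simp⟩ (hσ.congr fun i => encList_map _ _ _) (Easy.bool false)
    ?_).congr fun i => ?_
  · let Δ := (Γ.ext (fun i => Fin (Γ.N i)) fun _ => encFin).ext (fun _ => Bool) fun _ => encBool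
    refine ((Easy.finEq (Γ := Δ) (x := fun j => j.1.2) (y := fun j => y j.1.1)
      (Easy.top (Γ := Γ)).wk hy.wk.wk).ite (Easy.bool false)
      ((Easy.finEq (Γ := Δ) (x := fun j => j.1.2) (y := fun j => x j.1.1) (Easy.top (Γ := Γ)).wk
        hx.wk.wk).ite (Easy.bool true) Easy.top)).congr fun j => ?_
    dsimp only
    split_ifs <;> rfl
  · congr 1
    change _ = before ((List.finRange (Γ.N i)).map (σ i)) (x i) (y i)
    rw [Bool.eq_iff_iff, decide_eq_true_iff, before_iff (r := (σ i).symm)]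
    · rw [List.pairwise_map]
      simpa using List.pairwise_lt_finRange (Γ.N i)
    · exact List.mem_map.2 ⟨(σ i).symm (x i), List.mem_finRange _, by simp⟩
    · exact List.mem_map.2 ⟨(σ i).symm (y i), List.mem_finRange _, by simp⟩

/-- A preference table whose entries can be computed in polynomial time. -/
def EasyPref (Γ : Ctx) (X : ∀ i, PrefTable (Γ.N i)) : Prop :=
  Easy (tripleFam.ctx Γ) fun j => encBool (X j.1 j.2.1 j.2.2.1 j.2.2.2)

namespace EasyPref

variable {X Y : ∀ i, PrefTable (Γ.N i)}

theorem app (hX : EasyPref Γ X) {a x y : ∀ i, Fin (Γ.N i)} (ha : Easy Γ fun i => encFin (a i))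
    (hx : Easy Γ fun i => encFin (x i)) (hy : Easy Γ fun i => encFin (y i)) :
    Easy Γ fun i => encBool (X i (a i) (x i) (y i)) :=
  Easy.bind (D := fun i => tripleFam.V (Γ.N i)) (e := fun _ => tripleFam.enc)
    (v := fun i => (a i, x i, y i)) (f := fun i t => encBool (X i t.1 t.2.1 t.2.2))
    (ha.node (hx.node hy)) hX

theorem wk (hX : EasyPref Γ X) {D : Γ.ι → Type} {e : ∀ i, D i → Data} :
    EasyPref (Γ.ext D e) fun j => X j.1 :=
  Easy.comp (Γ := tripleFam.ctx (Γ.ext D e)) hX (fun j => ⟨j.1.1, j.2⟩) (fun _ => rfl)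
    ((Easy.self (Γ := Γ)).wk.wk.node Easy.top)

end EasyPref

theorem easy_prefOf {A : ∀ i, Inst (Γ.N i)} (hA : Easy Γ fun i => encInst (A i))
    {side : Γ.ι → Bool} (hs : Easy Γ fun i => encBool (side i)) {a : ∀ i, Fin (Γ.N i)}
    (ha : Easy Γ fun i => encFin (a i)) : Easy Γ fun i => encPref (prefOf (A i) (side i) (a i)) := by
  have h1 := Easy.get (e := fun _ => encPref) (f := fun i => (A i).boyList) hA.hd ha
  have h2 := Easy.get (e := fun _ => encPref) (f := fun i => (A i).girlList) hA.tl ha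
  refine (hs.ite h2 h1).congr fun i => ?_
  rw [prefOf]
  split_ifs <;> rfl

theorem easyPref_base {A : ∀ i, Inst (Γ.N i)} (hA : Easy Γ fun i => encInst (A i))
    {side : Γ.ι → Bool} (hs : Easy Γ fun i => encBool (side i)) :
    EasyPref Γ fun i => base (A i) (side i) :=
  easy_lt_symm (Γ := tripleFam.ctx Γ) (easy_prefOf hA.wk hs.wk (Easy.top (Γ := Γ)).hd)
    (Easy.top (Γ := Γ)).tl.hd (Easy.top (Γ := Γ)).tl.tl

theorem easy_prefers {e : ∀ i, Perturbation (Γ.N i)} (he : Easy Γ fun i => encPerturbation (e i))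
    {side : Γ.ι → Bool} (hs : Easy Γ fun i => encBool (side i)) {a x y : ∀ i, Fin (Γ.N i)}
    (ha : Easy Γ fun i => encFin (a i)) (hx : Easy Γ fun i => encFin (x i))
    (hy : Easy Γ fun i => encFin (y i)) :
    Easy Γ fun i => encBool ((e i).prefers (side i) (a i) (x i) (y i)) := by
  have h1 : Easy Γ fun i => encBool (e i).side :=
    he.hd.congr fun i => by cases e i <;> rfl
  have h2 : Easy Γ fun i => encFin (e i).agent :=
    he.tl.hd.congr fun i => by cases e i <;> rfl
  have h3 : Easy Γ fun i => encPref (e i).newList :=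
    he.tl.tl.congr fun i => by cases e i <;> rfl
  exact (h1.boolEq hs).and ((h2.finEq ha).and (easy_lt_symm h3 hx hy))

/-! #### Exclusions -/

section Forced

variable {X Y : ∀ i, PrefTable (Γ.N i)} {T : ∀ i, LitTable (Γ.N i)}
  {u v : ∀ i, Lit (Γ.N i)} {b c g : ∀ i, Fin (Γ.N i)} {x y : ∀ i, Fin (Γ.N i) × Fin (Γ.N i)}

theorem easy_lit_some (hx : Easy Γ fun i => pairFam.enc (x i)) :
    Easy Γ fun i => litFam.enc (n := Γ.N i) (some (some (x i))) :=
  Easy.nil.node (Easy.nil.node hx)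

theorem easy_lookup (hT : Easy Γ fun i => litPairFam.table (T i))
    (hu : Easy Γ fun i => litFam.enc (u i)) (hx : Easy Γ fun i => pairFam.enc (x i)) :
    Easy Γ fun i => encBool (T i (u i, x i)) :=
  litPairFam.easy_lookup hT (hu.node hx)

theorem easy_allBetter (hX : EasyPref Γ X) (hT : Easy Γ fun i => litPairFam.table (T i))
    (hu : Easy Γ fun i => litFam.enc (u i)) (hc : Easy Γ fun i => encFin (c i))
    (hg : Easy Γ fun i => encFin (g i)) :
    Easy Γ fun i => encBool (allBetter (X i) (T i) (u i) (c i) (g i)) :=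
  Fam.fin.easy_all (((hX.wk.app hc.wk Easy.top hg.wk).not).or
    (easy_lookup (Γ := Fam.fin.ctx Γ) (T := fun j => T j.1) (u := fun j => u j.1)
      (x := fun j => (c j.1, j.2)) hT.wk hu.wk (hc.wk.node Easy.top)))

theorem easy_isFalse (hu : Easy Γ fun i => litFam.enc (u i)) :
    Easy Γ fun i => encBool (isFalse (u i)) :=
  Easy.elim (eB := fun _ => encBool) (D := fun i => Option (pairFam.V (Γ.N i)))
    (e := fun _ => encOpt pairFam.enc) hu (Easy.bool false)
    (Easy.elim (Γ := (Fam.opt pairFam).ctx Γ) (eB := fun _ => encBool)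
      (D := fun j => pairFam.V (Γ.N j.1)) (e := fun _ => pairFam.enc) Easy.top (Easy.bool true)
      (Easy.bool false))

theorem easy_isStart (hX : EasyPref Γ X) (hu : Easy Γ fun i => litFam.enc (u i))
    (hc : Easy Γ fun i => encFin (c i)) (hg : Easy Γ fun i => encFin (g i)) :
    Easy Γ fun i => encBool (isStart (X i) (u i) (c i) (g i)) := by
  refine Easy.elim (eB := fun _ => encBool) (D := fun i => Option (pairFam.V (Γ.N i)))
    (e := fun _ => encOpt pairFam.enc) hu (Easy.bool false)
    (Easy.elim (Γ := (Fam.opt pairFam).ctx Γ) (eB := fun _ => encBool)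
      (D := fun j => pairFam.V (Γ.N j.1)) (e := fun _ => pairFam.enc)
      (g := fun j q => decide (q.1 = c j.1) && !X j.1 (c j.1) q.2 (g j.1)) Easy.top
      (Easy.bool false) ?_)
  exact (Easy.finEq (Γ := pairFam.ctx ((Fam.opt pairFam).ctx Γ)) (x := fun j => j.2.1)
      (y := fun j => c j.1.1) (Easy.top (Γ := (Fam.opt pairFam).ctx Γ)).hd hc.wk.wk).and
    (hX.wk.wk.app hc.wk.wk (Easy.top (Γ := (Fam.opt pairFam).ctx Γ)).tl hg.wk.wk).not

theorem easy_forceStep (hX : EasyPref Γ X) (hY : EasyPref Γ Y)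
    (hT : Easy Γ fun i => litPairFam.table (T i)) {v : ∀ i, litPairFam.V (Γ.N i)}
    (hv : Easy Γ fun i => litPairFam.enc (v i)) :
    Easy Γ fun i => encBool (forceStep (X i) (Y i) (T i) (v i)) := by
  have hu : Easy Γ fun i => litFam.enc (v i).1 := hv.hd
  have hc : Easy Γ fun i => encFin (v i).2.1 := hv.tl.hd
  have hg : Easy Γ fun i => encFin (v i).2.2 := hv.tl.tl
  exact (litPairFam.easy_lookup hT hv).or ((easy_isStart hX hu hc hg).or
    ((easy_allBetter hX hT hu hc hg).and (Fam.fin.easy_any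
      ((Easy.finEq (Γ := Fam.fin.ctx Γ) (x := fun j => j.2) (y := fun j => (v j.1).2.1)
        Easy.top hc.wk).not.and
        ((hY.wk.app hg.wk Easy.top hc.wk).and
          (easy_allBetter (Γ := Fam.fin.ctx Γ) (T := fun j => T j.1)
            (u := fun j => (v j.1).1) (c := fun j => j.2) (g := fun j => (v j.1).2.2) hX.wk hT.wk hu.wk Easy.top hg.wk))))))

theorem easy_forced (hX : EasyPref Γ X) (hY : EasyPref Γ Y) :
    Easy Γ fun i => litPairFam.table (forced (X i) (Y i)) := by
  refine Easy.iterate (Y := fun i => LitTable (Γ.N i))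
    (eY := fun _ => litPairFam.table) (init := fun _ _ => false)
    (step := fun i => forceStep (X i) (Y i)) litPairFam.short_list (litPairFam.easyList Γ)
    (litPairFam.easy_table (Easy.bool false)) ?_
  let Δ := Γ.ext (fun i => LitTable (Γ.N i)) fun _ => litPairFam.table
  exact litPairFam.easy_table (Γ := Δ) (T := fun j => forceStep (X j.1) (Y j.1) j.2)
    (easy_forceStep (Γ := litPairFam.ctx Δ) (T := fun j => j.1.2) (v := fun j => j.2) hX.wk.wk hY.wk.wk
      (Easy.top (Γ := Γ)).wk Easy.top)

theorem easy_isFail (hT : Easy Γ fun i => litPairFam.table (T i))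
    (hu : Easy Γ fun i => litFam.enc (u i)) : Easy Γ fun i => encBool (isFail (T i) (u i)) :=
  Fam.fin.easy_any (Fam.fin.easy_all (Γ := Fam.fin.ctx Γ)
    (easy_lookup (Γ := Fam.fin.ctx (Fam.fin.ctx Γ)) (T := fun j => T j.1.1)
      (u := fun j => u j.1.1) (x := fun j => (j.1.2, j.2)) hT.wk.wk hu.wk.wk
      ((Easy.top (Γ := Γ)).wk.node Easy.top)))

theorem easy_impl (hT : Easy Γ fun i => litPairFam.table (T i))
    (hu : Easy Γ fun i => litFam.enc (u i)) (hv : Easy Γ fun i => litFam.enc (v i)) :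
    Easy Γ fun i => encBool (impl (T i) (u i) (v i)) := by
  refine Easy.elim (eB := fun _ => encBool) (D := fun i => Option (pairFam.V (Γ.N i)))
    (e := fun _ => encOpt pairFam.enc) hv (Easy.bool true) ?_
  refine (easy_isFalse hu.wk).or ((easy_isFail hT.wk hu.wk).or ?_)
  exact Easy.elim (Γ := (Fam.opt pairFam).ctx Γ) (eB := fun _ => encBool)
    (D := fun j => pairFam.V (Γ.N j.1)) (e := fun _ => pairFam.enc)
    (g := fun j q => T j.1 (u j.1, q)) Easy.top (Easy.bool false)
    (easy_lookup (Γ := pairFam.ctx ((Fam.opt pairFam).ctx Γ)) (T := fun j => T j.1.1)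
      (u := fun j => u j.1.1) (x := fun j => j.2) hT.wk.wk hu.wk.wk Easy.top)

/-! #### Rotations -/

theorem easy_firstLeft (hX : EasyPref Γ X) (hT : Easy Γ fun i => litPairFam.table (T i))
    (hu : Easy Γ fun i => litFam.enc (u i)) (hb : Easy Γ fun i => encFin (b i))
    (hg : Easy Γ fun i => encFin (g i)) :
    Easy Γ fun i => encBool (firstLeft (X i) (T i) (u i) (b i) (g i)) :=
  (easy_allBetter hX hT hu hb hg).and
    (easy_lookup (x := fun i => (b i, g i)) hT hu (hb.node hg)).not

theorem easy_isRotPair (hX : EasyPref Γ X) (hT : Easy Γ fun i => litPairFam.table (T i))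
    (hx : Easy Γ fun i => pairFam.enc (x i)) :
    Easy Γ fun i => encBool (isRotPair (X i) (T i) (x i)) :=
  (litFam.easy_any ((easy_isFalse (Γ := litFam.ctx Γ) (u := fun j => j.2) Easy.top).not.and
    ((easy_isFail (Γ := litFam.ctx Γ) (T := fun j => T j.1) (u := fun j => j.2) hT.wk Easy.top).not.and
      (easy_firstLeft (Γ := litFam.ctx Γ) (T := fun j => T j.1) (u := fun j => j.2) (b := fun j => (x j.1).1)
        (g := fun j => (x j.1).2) hX.wk hT.wk Easy.top hx.wk.hd hx.wk.tl)))).and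
    (easy_isFail hT (easy_lit_some hx)).not

theorem easy_nextGirl (hX : EasyPref Γ X) (hT : Easy Γ fun i => litPairFam.table (T i))
    (hx : Easy Γ fun i => pairFam.enc (x i)) :
    Easy Γ fun i => encFin (nextGirl (X i) (T i) (x i)) :=
  Easy.headD (eD := fun _ => encFin) (Fam.fin.easy_filter (easy_firstLeft
    (Γ := Fam.fin.ctx Γ) (T := fun j => T j.1)
    (u := fun j => some (some (x j.1))) (b := fun j => (x j.1).1) (g := fun j => j.2) hX.wk hT.wk
    (easy_lit_some (Γ := Fam.fin.ctx Γ) (x := fun j => x j.1) hx.wk) hx.wk.hd Easy.top)) hx.tl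

theorem easy_sameRot (hX : EasyPref Γ X) (hT : Easy Γ fun i => litPairFam.table (T i))
    (hx : Easy Γ fun i => pairFam.enc (x i)) (hy : Easy Γ fun i => pairFam.enc (y i)) :
    Easy Γ fun i => encBool (sameRot (X i) (T i) (x i) (y i)) :=
  (easy_isRotPair hX hT hy).and ((easy_lookup hT (easy_lit_some hx) hy).and
    (easy_lookup hT (easy_lit_some hy) hx))

theorem easy_rotPairs (hX : EasyPref Γ X) (hT : Easy Γ fun i => litPairFam.table (T i))
    (hx : Easy Γ fun i => pairFam.enc (x i)) :
    Easy Γ fun i => encList pairFam.enc (rotPairs (X i) (T i) (x i)) :=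
  pairFam.easy_filter (easy_sameRot (Γ := pairFam.ctx Γ) (T := fun j => T j.1) (x := fun j => x j.1)
    (y := fun j => j.2) hX.wk hT.wk hx.wk Easy.top)

theorem short_rotPairs : Easy.Short Γ fun i => rotPairs (X i) (T i) (x i) :=
  pairFam.short_list.filter _

theorem easy_nextPair (hX : EasyPref Γ X) (hT : Easy Γ fun i => litPairFam.table (T i))
    (hx : Easy Γ fun i => pairFam.enc (x i)) :
    Easy Γ fun i => pairFam.enc (nextPair (X i) (T i) (x i)) :=
  Easy.headD (eD := fun _ => pairFam.enc) (Easy.filter short_rotPairs (easy_rotPairs hX hT hx)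
    (Easy.finEq (Γ := pairFam.ctx Γ) (x := fun j => j.2.2)
      (y := fun j => nextGirl (X j.1) (T j.1) (x j.1)) (Easy.top (Γ := Γ)).tl
      (easy_nextGirl hX hT hx).wk)) hx

theorem easy_isCanon (hX : EasyPref Γ X) (hT : Easy Γ fun i => litPairFam.table (T i))
    (hx : Easy Γ fun i => pairFam.enc (x i)) :
    Easy Γ fun i => encBool (isCanon (X i) (T i) (x i)) :=
  (easy_isRotPair hX hT hx).and (pairFam.easy_eq
    (x := fun i => (rotPairs (X i) (T i) (x i)).headD (x i))
    (Easy.headD (eD := fun _ => pairFam.enc) (easy_rotPairs hX hT hx) hx) hx)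

theorem foldl_orbit {α β : Type} (f : α → α) (l : List β) (L : List α) (a : α) :
    l.foldl (fun q _ => (q.2 :: q.1, f q.2)) (L, a) =
      ((List.iterate f a l.length).reverse ++ L, f^[l.length] a) := by
  induction l generalizing L a with
  | nil => simp
  | cons b l ih => simp [ih]

theorem easy_orbit (hX : EasyPref Γ X) (hT : Easy Γ fun i => litPairFam.table (T i))
    (hx : Easy Γ fun i => pairFam.enc (x i)) :
    Easy Γ fun i => encList pairFam.enc (orbit (X i) (T i) (x i)) := by
  let Δ := (pairFam.ctx Γ).ext (fun j => List (pairFam.V (Γ.N j.1)) × pairFam.V (Γ.N j.1))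
    fun _ => encPair (encList pairFam.enc) pairFam.enc
  -- The orbit is collected in reverse, together with the current pair; the list of pairs of the
  -- rotation only counts the rounds.
  have h1 := Easy.foldl (Y := fun i => List (pairFam.V (Γ.N i)) × pairFam.V (Γ.N i))
    (eY := fun _ => encPair (encList pairFam.enc) pairFam.enc) (init := fun i => ([], x i))
    (step := fun i q _ => (q.2 :: q.1, nextPair (X i) (T i) q.2)) short_rotPairs
    (easy_rotPairs hX hT hx) (Easy.nil.node hx)
    (((Easy.top (Γ := pairFam.ctx Γ)).tl.node (Easy.top (Γ := pairFam.ctx Γ)).hd).node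
      (easy_nextPair (Γ := Δ) (T := fun j => T j.1.1) (x := fun j => j.2.2) hX.wk.wk hT.wk.wk
        (Easy.top (Γ := pairFam.ctx Γ)).tl))
  have h2 : Easy Γ fun i => encList pairFam.enc (orbit (X i) (T i) (x i)).reverse :=
    h1.hd.congr fun i => by
      rw [foldl_orbit, List.append_nil]
      rfl
  refine (h2.reverse (l := fun i => (orbit (X i) (T i) (x i)).reverse)
    (eD := fun _ => pairFam.enc) ?_).congr fun i => by rw [List.reverse_reverse]
  obtain ⟨q, hq⟩ := short_rotPairs (X := X) (T := T) (x := x)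
  exact ⟨q, fun i => by simpa [orbit] using hq i⟩

/-! #### Implications and the output -/

theorem easy_dual (hX : EasyPref Γ X) (hT : Easy Γ fun i => litPairFam.table (T i))
    (hu : Easy Γ fun i => litFam.enc (u i)) :
    Easy Γ fun i => litFam.enc (dual (X i) (T i) (u i)) := by
  refine Easy.elim (eB := fun _ => litFam.enc) (D := fun i => Option (pairFam.V (Γ.N i)))
    (e := fun _ => encOpt pairFam.enc) hu (Easy.nil.node Easy.nil)
    (Easy.elim (Γ := (Fam.opt pairFam).ctx Γ) (eB := fun _ => litFam.enc)
      (D := fun j => pairFam.V (Γ.N j.1)) (e := fun _ => pairFam.enc)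
      (g := fun j q => some (some (nextGirl (X j.1) (T j.1) q, q.1))) Easy.top Easy.nil ?_)
  exact easy_lit_some (Γ := pairFam.ctx ((Fam.opt pairFam).ctx Γ))
    (x := fun j => (nextGirl (X j.1.1) (T j.1.1) j.2, j.2.1))
    ((easy_nextGirl (Γ := pairFam.ctx ((Fam.opt pairFam).ctx Γ)) (T := fun j => T j.1.1) (x := fun j => j.2) hX.wk.wk hT.wk.wk Easy.top).node
      (Easy.top (Γ := (Fam.opt pairFam).ctx Γ)).hd)

theorem easy_isElem (hX : EasyPref Γ X) (hT : Easy Γ fun i => litPairFam.table (T i))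
    (hu : Easy Γ fun i => litFam.enc (u i)) :
    Easy Γ fun i => encBool (isElem (X i) (T i) (u i)) :=
  Easy.elim (eB := fun _ => encBool) (D := fun i => Option (pairFam.V (Γ.N i)))
    (e := fun _ => encOpt pairFam.enc) hu (Easy.bool true)
    (Easy.elim (Γ := (Fam.opt pairFam).ctx Γ) (eB := fun _ => encBool)
      (D := fun j => pairFam.V (Γ.N j.1)) (e := fun _ => pairFam.enc)
      (g := fun j q => isRotPair (X j.1) (T j.1) q) Easy.top (Easy.bool true)
      (easy_isRotPair (Γ := pairFam.ctx ((Fam.opt pairFam).ctx Γ)) (T := fun j => T j.1.1) (x := fun j => j.2) hX.wk.wk hT.wk.wk Easy.top))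

theorem easy_edge (hX : EasyPref Γ X) (hT : Easy Γ fun i => litPairFam.table (T i))
    {T₁ T₂ : ∀ i, LitTable (Γ.N i)} (hT₁ : Easy Γ fun i => litPairFam.table (T₁ i))
    (hT₂ : Easy Γ fun i => litPairFam.table (T₂ i)) {p : ∀ i, Lit (Γ.N i) × Lit (Γ.N i)}
    (hp : Easy Γ fun i => litLitFam.enc (p i)) :
    Easy Γ fun i => encBool (edge (X i) (T i) (T₁ i) (T₂ i) (p i)) := by
  have h1 : Easy Γ fun i => litFam.enc (p i).1 := hp.hd
  have h2 : Easy Γ fun i => litFam.enc (p i).2 := hp.tl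
  exact (easy_isElem hX hT h1).and ((easy_isElem hX hT h2).and ((easy_impl hT₁ h1 h2).or
    (easy_impl hT₂ (easy_dual hX hT h2) (easy_dual hX hT h1))))

variable {R E : ∀ i, Lit (Γ.N i) × Lit (Γ.N i) → Bool}

theorem easy_transClosure (hE : Easy Γ fun i => litLitFam.table (E i)) :
    Easy Γ fun i => litLitFam.table (transClosure (lits (Γ.N i)) (E i)) := by
  refine Easy.iterate (Y := fun i => litLitFam.V (Γ.N i) → Bool)
    (eY := fun _ => litLitFam.table) (init := E)
    (step := fun i => transStep (lits (Γ.N i))) litLitFam.short_list (litLitFam.easyList Γ) hE ?_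
  let Δ : Ctx := Γ.ext (fun i => litLitFam.V (Γ.N i) → Bool) fun _ => litLitFam.table
  refine litLitFam.easy_table (Γ := Δ) (T := fun j => transStep (lits (Γ.N j.1)) j.2) ?_
  refine (litLitFam.easy_lookup (Γ := litLitFam.ctx Δ) (T := fun j => j.1.2) (x := fun j => j.2)
    (Easy.top (Γ := Γ)).wk Easy.top).or (litFam.easy_any (Γ := litLitFam.ctx Δ)
    (f := fun j w => j.1.2 (j.2.1, w) && j.1.2 (w, j.2.2)) ?_)
  exact (litLitFam.easy_lookup (Γ := litFam.ctx (litLitFam.ctx Δ)) (T := fun j => j.1.1.2) (x := fun j => (j.1.2.1, j.2))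
      (Easy.top (Γ := Γ)).wk.wk ((Easy.top (Γ := Δ)).wk.hd.node Easy.top)).and
    (litLitFam.easy_lookup (Γ := litFam.ctx (litLitFam.ctx Δ)) (T := fun j => j.1.1.2) (x := fun j => (j.2, j.1.2.2))
      (Easy.top (Γ := Γ)).wk.wk (Easy.top.node (Easy.top (Γ := Δ)).wk.tl))

theorem easy_eqv (hR : Easy Γ fun i => litLitFam.table (R i))
    (hu : Easy Γ fun i => litFam.enc (u i)) (hv : Easy Γ fun i => litFam.enc (v i)) :
    Easy Γ fun i => encBool (eqv (R i) (u i) (v i)) :=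
  (litLitFam.easy_lookup (x := fun i => (u i, v i)) hR (hu.node hv)).and
    (litLitFam.easy_lookup (x := fun i => (v i, u i)) hR (hv.node hu))

theorem short_reps : Easy.Short Γ fun i => reps (X i) (T i) (R i) :=
  (litFam.short_list.filter _).filter _

theorem easy_reps (hX : EasyPref Γ X) (hT : Easy Γ fun i => litPairFam.table (T i))
    (hR : Easy Γ fun i => litLitFam.table (R i)) :
    Easy Γ fun i => encList litFam.enc (reps (X i) (T i) (R i)) := by
  have h1 : Easy Γ fun i =>
      encList litFam.enc ((lits (Γ.N i)).filter (isElem (X i) (T i))) :=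
    litFam.easy_filter (easy_isElem (Γ := litFam.ctx Γ) (T := fun j => T j.1) (u := fun j => j.2) hX.wk hT.wk Easy.top)
  have h2 : Easy (litFam.ctx Γ) fun j => litFam.enc
      (classRep ((lits (Γ.N j.1)).filter (isElem (X j.1) (T j.1))) (eqv (R j.1)) j.2) :=
    Easy.headD (Γ := litFam.ctx Γ) (eD := fun _ => litFam.enc)
      (Easy.filter (Γ := litFam.ctx Γ)
        ((litFam.short_list (Γ := litFam.ctx Γ)).filter fun j => isElem (X j.1) (T j.1)) h1.wk
        (easy_eqv (Γ := litFam.ctx (litFam.ctx Γ)) (R := fun j => R j.1.1) (u := fun j => j.1.2) (v := fun j => j.2) hR.wk.wk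
          (Easy.top (Γ := Γ)).wk Easy.top)) Easy.top
  exact Easy.filter (litFam.short_list.filter _) h1 (litFam.easy_eq (Γ := litFam.ctx Γ)
    (y := fun j => j.2) h2 Easy.top)

theorem easy_clsNum (hX : EasyPref Γ X) (hT : Easy Γ fun i => litPairFam.table (T i))
    (hR : Easy Γ fun i => litLitFam.table (R i)) (hu : Easy Γ fun i => litFam.enc (u i)) :
    Easy Γ fun i => encNat (clsNum (X i) (T i) (R i) (u i)) :=
  Easy.findIdx short_reps (easy_reps hX hT hR)
    (easy_eqv (Γ := litFam.ctx Γ) (R := fun j => R j.1) (u := fun j => u j.1) (v := fun j => j.2) hR.wk hu.wk Easy.top)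

theorem easy_posetData (hX : EasyPref Γ X) (hT : Easy Γ fun i => litPairFam.table (T i))
    (hR : Easy Γ fun i => litLitFam.table (R i)) :
    Easy Γ fun i => encPosetData (posetData (X i) (T i) (R i)) := by
  have h1 := Easy.map (B := fun i => List (pairFam.V (Γ.N i)) × ℕ)
    (eB := fun _ => encPair (encList pairFam.enc) encNat)
    (f := fun i x => (orbit (X i) (T i) x, clsNum (X i) (T i) (R i) (some (some x))))
    (pairFam.short_list.filter fun i => isCanon (X i) (T i))
    (pairFam.easy_filter
      (easy_isCanon (Γ := pairFam.ctx Γ) (T := fun j => T j.1) (x := fun j => j.2) hX.wk hT.wk Easy.top))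
    ((easy_orbit (Γ := pairFam.ctx Γ) (T := fun j => T j.1) (x := fun j => j.2) hX.wk hT.wk Easy.top).node
      (easy_clsNum (Γ := pairFam.ctx Γ) (T := fun j => T j.1) (R := fun j => R j.1) (u := fun j => some (some j.2))
        hX.wk hT.wk hR.wk (easy_lit_some (Γ := pairFam.ctx Γ) (x := fun j => j.2) Easy.top)))
  have h2 := Easy.map (B := fun _ => List Bool) (eB := fun _ => encList encBool)
    (f := fun i u => (reps (X i) (T i) (R i)).map fun v => R i (v, u)) short_reps
    (easy_reps hX hT hR)
    (Easy.map (Γ := litFam.ctx Γ) (B := fun _ => Bool) (eB := fun _ => encBool)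
      (f := fun j v => R j.1 (v, j.2))
      (short_reps (Γ := litFam.ctx Γ) (X := fun j => X j.1) (T := fun j => T j.1) (R := fun j => R j.1))
      (easy_reps hX hT hR).wk
      (litLitFam.easy_lookup (Γ := litFam.ctx (litFam.ctx Γ)) (T := fun j => R j.1.1) (x := fun j => (j.2, j.1.2)) hR.wk.wk
        (Easy.top.node (Easy.top (Γ := Γ)).wk)))
  exact h1.node ((easy_clsNum (u := fun _ => none) hX hT hR Easy.nil).node
    ((easy_clsNum (u := fun _ => some none) hX hT hR (Easy.nil.node Easy.nil)).node h2))

end Forced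

theorem easyPref_extend {A : ∀ i, Inst (Γ.N i)} (hA : Easy Γ fun i => encInst (A i))
    {W : ∀ i, errorFam.V (Γ.N i) → Bool} (hW : Easy Γ fun i => errorFam.table (W i))
    (side : Bool) :
    EasyPref Γ fun i => extend (A i) (fun s a x y => W i (s, a, x, y)) side :=
  Easy.or (Γ := tripleFam.ctx Γ) (easyPref_base hA (Easy.bool side))
    (errorFam.easy_lookup (Γ := tripleFam.ctx Γ) (T := fun j => W j.1) (x := fun j => (side, j.2))
      hW.wk ((Easy.bool side).node Easy.top))

/-- The errors enter only through the table of `W`, whose size depends on `n` alone. -/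
theorem easy_answer {A : ∀ i, Inst (Γ.N i)} (hA : Easy Γ fun i => encInst (A i))
    {W : ∀ i, errorFam.V (Γ.N i) → Bool} (hW : Easy Γ fun i => errorFam.table (W i)) :
    Easy Γ fun i => encOutput (answer (A i) fun s a x y => W i (s, a, x, y)) := by
  have hB := easyPref_base hA (Easy.bool false)
  have hG := easyPref_base hA (Easy.bool true)
  have hTA := easy_forced hB hG
  have hTG := easy_forced hB (easyPref_extend hA hW true)
  have hTB := easy_forced hG (easyPref_extend hA hW false)
  have hR : Easy Γ fun i => litLitFam.table (reach (A i) fun s a x y => W i (s, a, x, y)) :=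
    easy_transClosure (E := fun i => edge (base (A i) false) (tableA (A i))
      (tableG (A i) fun s a x y => W i (s, a, x, y))
      (tableB (A i) fun s a x y => W i (s, a, x, y)))
      (litLitFam.easy_table (Γ := Γ) (easy_edge (Γ := litLitFam.ctx Γ) (X := fun j => base (A j.1) false)
        (p := fun j => j.2) hB.wk hTA.wk hTG.wk hTB.wk Easy.top))
  refine ((litLitFam.easy_lookup (x := fun _ => (none, some none)) hR
    (Easy.nil.node (Easy.nil.node Easy.nil))).ite Easy.nil
    (Easy.nil.node (easy_posetData hB hTA hR))).congr fun i => ?_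
  rw [answer]
  exact apply_ite encOutput _ _ _


/-! ### The program -/

abbrev Input : Type := Σ n, Inst n × List (Perturbation n)

theorem foldl_count {α : Type} (l : List α) (k : ℕ) :
    l.foldl (fun y _ => (y.headD 0 + 1) :: y) (List.range (k + 1)).reverse =
      (List.range (k + l.length + 1)).reverse := by
  induction l generalizing k with
  | nil => simp
  | cons a l ih =>
    have h : ((List.range (k + 1)).reverse.headD 0 + 1) :: (List.range (k + 1)).reverse =
        (List.range (k + 1 + 1)).reverse := by
      rw [List.range_succ, List.reverse_append, List.range_succ (n := k + 1),
        List.range_succ (n := k)]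
      simp
    rw [List.foldl_cons, h, ih, List.length_cons]
    congr 3
    omega

theorem foldl_cons_eq {α : Type} (l l' : List α) :
    l.foldl (fun y a => a :: y) l' = l.reverse ++ l' := by
  induction l generalizing l' with
  | nil => rfl
  | cons a l ih => simp [ih]

/-- The size is measured by counting along the list of boys. This yields the numbers from `n` down
to `0`; the head `n` is dropped and the rest reversed. -/
theorem cmp_range : ∃ p : Polynomial ℕ, Cmp (fun i : Input => encInput i.2.1 i.2.2)
    (fun i => encList encFin (List.finRange i.1)) fun i => p.eval i.1 := by
  have h1 : Cmp (fun i : Input => encInput i.2.1 i.2.2)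
      (fun i => encList (fun b => encPref (i.2.1.boyList b)) (List.finRange i.1)) _ :=
    Cmp.expr (.hd (.hd (.var 0))) fun i σ h => by
      simp [Expr.eval, h, Data.hd, encInput, encInst]
  have h2 : Cmp (fun i : Input => encInput i.2.1 i.2.2) (fun _ => encList encNat [0]) _ :=
    Cmp.expr (.cons .nil .nil) fun i σ h => rfl
  have h3 := Cmp.foldl (Y := fun _ => List ℕ) (eY := fun _ => encList encNat)
    (init := fun _ => [0]) (step := fun _ y _ => (y.headD 0 + 1) :: y)
    (q := fun i => i.1) (T₃ := fun _ => 9) h1 h2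
    ((Cmp.expr (.cons (.cons .nil (.hd (.tl (.var 0)))) (.tl (.var 0))) fun j σ h => by
      obtain ⟨j, y⟩ := j
      cases y <;> simp [Expr.eval, h, Data.hd, Data.tl, encList, encNat]).mono
        fun _ => by simp [Expr.cost]) fun i => by simp
  have h4 : Cmp (fun i : Input => encInput i.2.1 i.2.2)
      (fun i => encList encNat (List.range i.1).reverse) _ :=
    h3.comp (Cmp.expr (.tl (.var 0)) fun i σ h => by
      have := foldl_count (List.finRange i.1) 0
      rw [show (List.range (0 + 1)).reverse = [0] from rfl] at this
      simp only [Expr.eval, h]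
      rw [this, List.length_finRange, Nat.zero_add, List.range_succ]
      simp [encList, Data.tl])
  have h5 := Cmp.foldl (Y := fun _ => List ℕ) (eY := fun _ => encList encNat)
    (eD := fun _ => encNat) (init := fun _ => []) (step := fun _ y a => a :: y)
    (q := fun i => i.1) (T₃ := fun _ => 7) h4
    (Cmp.expr (f := fun _ => encList encNat []) .nil fun _ _ _ => rfl)
    ((Cmp.expr (.cons (.tl (.hd (.var 0))) (.tl (.var 0))) fun j σ h => by
      simp [Expr.eval, h, Data.hd, Data.tl, encList]).mono
        fun _ => by simp [Expr.cost]) fun i => by simp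
  -- Per boy, the two folds cost `9 + 20` and `7 + 20` steps.
  refine ⟨Polynomial.X * Polynomial.C 56 + Polynomial.C 60,
    (h5.congr fun i => ?_).mono fun i => ?_⟩
  · rw [foldl_cons_eq, List.reverse_reverse, List.append_nil, ← List.map_coe_finRange_eq_range,
      encList_map]
    rfl
  · simp [Expr.cost]
    omega

theorem cmp_answer : ∃ p : Polynomial ℕ, Cmp (fun i : Input => encInput i.2.1 i.2.2)
    (fun i => encOutput (answer i.2.1 (errors i.2.2)))
    fun i => max i.2.2.length 1 * p.eval i.1 := by
  obtain ⟨p, hp⟩ := cmp_range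
  let Γ : Ctx :=
    { ι := Input
      N := fun i => i.1
      env := fun i => .node (encInput i.2.1 i.2.2) (encList encFin (List.finRange i.1))
      range := ⟨Polynomial.C 3, (Cmp.expr (.tl (.var 0)) fun i σ h => by
        simp [Expr.eval, h, Data.tl]).mono fun _ => by simp [Expr.cost]⟩ }
  have h1 : Cmp (fun i : Input => encInput i.2.1 i.2.2) Γ.env _ :=
    (Cmp.expr (.var 0) fun i σ h => by simp [Expr.eval, h]).node hp
  have hin : Easy Γ fun i => encInput i.2.1 i.2.2 := Easy.self.hd
  have hA : Easy Γ fun i => encInst i.2.1 := hin.hd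
  obtain ⟨p₁, hS⟩ : Easy Γ fun i => encList encPerturbation i.2.2 := hin.tl
  obtain ⟨p₂, h0⟩ : Easy Γ fun i => errorFam.table (n := i.1) fun _ => false :=
    errorFam.easy_table (Γ := Γ) (T := fun _ _ => false) (Easy.bool false)
  let step : ∀ i : Input, (errorFam.V i.1 → Bool) → Perturbation i.1 → errorFam.V i.1 → Bool :=
    fun _ W e v => W v || e.prefers v.1 v.2.1 v.2.2.1 v.2.2.2
  let Δ : Ctx := (Γ.ext (fun i => Perturbation i.1) fun _ => encPerturbation).ext
    (fun j => errorFam.V j.1.1 → Bool) fun _ => errorFam.table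
  obtain ⟨p₃, hstep⟩ : Easy Δ fun j => errorFam.table (step j.1.1 j.2 j.1.2) := by
    refine errorFam.easy_table (Γ := Δ) (T := fun j => step j.1.1 j.2 j.1.2)
      ((errorFam.easy_lookup (Γ := errorFam.ctx Δ) (T := fun j => j.1.2) (x := fun j => j.2)
        (Easy.top (Γ := Γ.ext (fun i => Perturbation i.1) fun _ => encPerturbation)).wk
        Easy.top).or ?_)
    exact easy_prefers (Γ := errorFam.ctx Δ) (e := fun j => j.1.1.2) (side := fun j => j.2.1)
      (a := fun j => j.2.2.1) (x := fun j => j.2.2.2.1) (y := fun j => j.2.2.2.2)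
      (Easy.top (Γ := Γ)).wk.wk (Easy.top (Γ := Δ)).hd (Easy.top (Γ := Δ)).tl.hd
      (Easy.top (Γ := Δ)).tl.tl.hd (Easy.top (Γ := Δ)).tl.tl.tl
  -- The length of `S` is not bounded by a polynomial in `n`, so this fold is made outside `Easy`,
  -- with `|S|` as the number of rounds.
  have h2 := Cmp.foldl (T₃ := fun i : Input => p₃.eval i.1) (step := step)
    (q := fun i => i.2.2.length) hS h0 hstep fun _ => le_rfl
  let Θ : Ctx := Γ.ext (fun i => errorFam.V i.1 → Bool) fun _ => errorFam.table
  obtain ⟨p₄, h3⟩ : Easy Θ fun j => encOutput (answer j.1.2.1 fun s a x y => j.2 (s, a, x, y)) :=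
    easy_answer (Γ := Θ) hA.wk (Easy.top (Γ := Γ))
  have h4 := h1.comp (((Cmp.expr (f := Γ.env) (.var 0) fun i σ h => by
    simp [Expr.eval, h]).node h2).comp (h3.reindex (κ := Input) fun i => ⟨i, _⟩))
  have herr : ∀ (n : ℕ) (S : List (Perturbation n)) (W : errorFam.V n → Bool)
      (v : errorFam.V n), S.foldl (fun W e v => W v || e.prefers v.1 v.2.1 v.2.2.1 v.2.2.2) W v =
        (W v || errors S v.1 v.2.1 v.2.2.1 v.2.2.2) := by
    intro n S
    induction S with
    | nil => simp [errors]
    | cons e S ih =>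
      intro W v
      rw [List.foldl_cons, ih]
      simp [errors, Bool.or_assoc]
  refine ⟨p + p₁ + p₂ + p₃ + p₄ + Polynomial.C 100, (h4.congr fun i => ?_).mono fun i => ?_⟩
  · congr 2
    funext s a x y
    exact ((herr i.1 i.2.2 (fun _ => false) (s, a, x, y)).trans (Bool.false_or _)).symm
  · simp only [Expr.cost, Polynomial.eval_add, Polynomial.eval_C]
    -- Only the term `p₃ + 20` is multiplied by `|S|`; the other terms are absorbed because the
    -- factor is at least `1`.
    have hm : 1 ≤ max i.2.2.length 1 := le_max_right _ _
    have hl : i.2.2.length ≤ max i.2.2.length 1 := le_max_left _ _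
    generalize max i.2.2.length 1 = m at *
    have hmul := Nat.mul_le_mul_right (Polynomial.eval i.1 p₃ + 20) hl
    have hrest := Nat.mul_le_mul_right (Polynomial.eval i.1 p + Polynomial.eval i.1 p₁ +
      Polynomial.eval i.1 p₂ + Polynomial.eval i.1 p₄ + 80) hm
    have e : m * (Polynomial.eval i.1 p + Polynomial.eval i.1 p₁ + Polynomial.eval i.1 p₂ +
      Polynomial.eval i.1 p₃ + Polynomial.eval i.1 p₄ + 100) =
      m * (Polynomial.eval i.1 p₃ + 20) + m * (Polynomial.eval i.1 p + Polynomial.eval i.1 p₁ +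
      Polynomial.eval i.1 p₂ + Polynomial.eval i.1 p₄ + 80) := by ring
    change _ ≤ m * _
    rw [e]
    dsimp only [Γ, Θ] at *
    omega

end FullyRobust

/-! ### The main theorem -/

theorem theorem2 :
    (∀ (n : ℕ) (A : FullyRobust.Inst n) (S : List (FullyRobust.Perturbation n)),
      ∃ L : Sublattice (FullyRobust.StableMatching A),
        (L : Set (FullyRobust.StableMatching A)) = FullyRobust.fullyRobustSet A S) ∧
    ∃ (alg : FullyRobust.Prog) (p : Polynomial ℕ),
      ∀ (n : ℕ) (A : FullyRobust.Inst n) (S : List (FullyRobust.Perturbation n)),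
        ∃ (out : Option (FullyRobust.PosetData n)) (time : ℕ),
          alg.Computes (FullyRobust.encInput A S) (FullyRobust.encOutput out) time ∧
          time ≤ max S.length 1 * p.eval n ∧
          (out.isSome = true ↔ ∃ M, FullyRobust.IsFullyRobust A S M) ∧
          ∀ P ∈ out, ∃ C : FullyRobust.Compression A,
            P.Describes C ∧ C.Generates (FullyRobust.fullyRobustSet A S) := by
  refine ⟨fun n A S => ?_, ?_⟩
  · have h := FullyRobust.isSublattice_fullyRobust A S
    exact ⟨⟨_, h.1, h.2⟩, rfl⟩
  · obtain ⟨p, c, _, _, h⟩ := FullyRobust.cmp_answer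
    refine ⟨c, p, fun n A S => ?_⟩
    obtain ⟨σ, t, h1, h2, -, h3⟩ := h ⟨n, A, S⟩
      (Function.update (fun _ => .nil) 0 (FullyRobust.encInput A S)) (by simp)
    exact ⟨_, t, ⟨σ, h1, h2⟩, h3, FullyRobust.answer_isSome A S, FullyRobust.answer_spec A S⟩
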